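/- **Conventions.** Let $\mathbb D=\{|z|<1\}$ and $\partial\mathbb D=\{|z|=1\}$. For $t>0$ and a doubly indexed family $X_{n,N}$, write $\lim_{n/N\to t}X_{n,N}=X$ if $X_{n_i,N_i}\to X$ for all sequences $n_i,N_i\in\mathbb N$ with $n_i\to\infty$, $N_i\to\infty$, $n_i/N_i\to t$ (and likewise with $kp/N\to t$, for sequences $k_i,N_i$). Given $\{\alpha_{n,N}\}_{n,N\ge0}\subset\mathbb D$, let $\Phi_{0,N}=1$ and $\Phi_{n+1,N}(z)=z\Phi_{n,N}(z)-\overline{\alpha_{n,N}}\,\Phi^*_{n,N}(z)$, where $\Phi^*_{n,N}(z)=z^n\overline{\Phi_{n,N}(1/\bar z)}$; for $\beta\in\partial\mathbb D$ and $n\ge1$ let $\Phi^{(\beta)}_{n,N}(z)=z\Phi_{n-1,N}(z)-\bar\beta\,\Phi^*_{n-1,N}(z)$. Let $\Lambda_{\beta,t}$ be the set of $\zeta\in\partial\mathbb D$ such that $\liminf_{i\to\infty}\operatorname{dist}\big(\zeta,\{z\in\partial\mathbb D:\Phi^{(\beta)}_{n_i,N_i}(z)=0\}\big)=0$ for some sequences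 $n_i,N_i\to\infty$ with $n_i/N_i\to t$, and let $\Lambda_t=\bigcap_{\beta\in\partial\mathbb D}\Lambda_{\beta,t}$. For a sequence $(\gamma_n)_{n\ge0}$ in $\mathbb D$ let $\mathcal C$ be the CMV operator on $\ell^2(\mathbb N_0)$ with Verblunsky coefficients $\gamma_n$, that is, $\mathcal C=\mathcal L\mathcal M$ with $\mathcal L=\Theta(\gamma_0)\oplus\Theta(\gamma_2)\oplus\cdots$, $\mathcal M=1\oplus\Theta(\gamma_1)\oplus\Theta(\gamma_3)\oplus\cdots$ and $\Theta(\gamma)=\begin{pmatrix}\bar\gamma&\rho\\ \rho&-\gamma\end{pmatrix}$, $\rho=\sqrt{1-|\gamma|^2}$. Its Carathéodory function is $F(z)=\langle e_0,(\mathcal C+z)(\mathcal C-z)^{-1}e_0\rangle$ and its Schur function is $f(z)=\frac1z\frac{F(z)-1}{F(z)+1}$, for $|z|\ne1$ (with $f(0)$ taken as the limit, and $f(z)=\infty$ where $F(z)=-1$). **Statement.** Let $p\ge1$, $\beta\in\partial\mathbb D$, $t>0$, and let $(\alpha_j)_{j\ge0}$ be a $p$-periodic sequence in $\mathbb D$ that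 is not identically zero. Let $\{\alpha_{n,N}\}_{n,N\ge0}\subset\mathbb D$ satisfy $$\lim_{kp/N\to t}\alpha_{kp+j,N}=\alpha_j,\qquad j=0,\dots,p-1 .$$ For $j\ge0$ let $f_1^{(j)}$ be the Schur function of the CMV operator with Verblunsky coefficients $(\gamma_{n+j})_{n\ge0}$, where $(\gamma_n)$ is the $p$-periodic sequence with first $p$ terms $-\bar\alpha_{p-1},-\bar\alpha_{p-2},\dots,-\bar\alpha_0$, and let $$\mathcal Z=\bigcup_{j=0}^{p-1}\{z\in\mathbb D: f_1^{(j)}(z)=0\},\qquad \mathcal P=\bigcup_{j=0}^{p-1}\{z\in\mathbb C\setminus\overline{\mathbb D}: f_1^{(j)}(z)=\infty\}.$$ With $\rho_j=\sqrt{1-|\alpha_j|^2}$, let $$\Delta(z)=z^{-p/2}\operatorname{Tr}\big(A(\alpha_{p-1},z)\cdots A(\alpha_0,z)\big),\quad A(\alpha,z)=\frac1{\sqrt{1-|\alpha|^2}}\begin{pmatrix}z&-\bar\alpha\\-\alpha z&1\end{pmatrix},\quad G_\Delta(z)=\frac{z^{p/2}}2\Big(\prod_{j=0}^{p-1}\rho_j\Big)\Big(\Delta(z)+\sqrt{\Delta(z)^2-4}\Big)$$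 for $z\neq0$, where the square root is the one that maximizes $|\Delta(z)+\sqrt{\Delta(z)^2-4}|$ and the same branch of $z^{1/2}$ is used in $z^{p/2}$ and in $\Delta$ (the choice does not matter), and let $G_\Delta(0)=1$ (its limit at $0$). Then $$\lim_{n/N\to t}\frac{\Phi^{(\beta)}_{n+p,N}(z)}{\Phi^{(\beta)}_{n,N}(z)}=\lim_{n/N\to t}\frac{\Phi_{n+p,N}(z)}{\Phi_{n,N}(z)}=\lim_{n/N\to t}\frac{\Phi^*_{n+p,N}(z)}{\Phi^*_{n,N}(z)}=G_\Delta(z),$$ uniformly on compact subsets of $\mathbb C\setminus\Lambda_{\beta,t}$, $\mathbb C\setminus(\Lambda_t\cup\mathcal Z)$ and $\mathbb C\setminus(\Lambda_t\cup\mathcal P)$, respectively. (For given sequences $n_i,N_i$ and a given compact set, the denominators have no zeros on the compact set for all large $i$, so the quotients are eventually defined there.) -/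

import Mathlib

open Filter Topology Polynomial
open scoped ENNReal

noncomputable section

namespace VaryingOPUC

/-! ### Limits along `n / N → t` -/

/-- `IsRatioSeq t n N`: the sequences `n_i`, `N_i` tend to infinity and `n_i / N_i → t`. -/
structure IsRatioSeq (t : ℝ) (n N : ℕ → ℕ) : Prop where
  tendsto_left : Tendsto n atTop atTop
  tendsto_right : Tendsto N atTop atTop
  tendsto_ratio : Tendsto (fun i => (n i : ℝ) / (N i : ℝ)) atTop (𝓝 t)

/-- The doubly indexed complex coefficients `a n N` are asymptotically `p`-periodic at `t` with
limits `α 0, …, α (p - 1)`: for each `j < p`, `a (k p + j) N → α j` as `k p / N → t`. -/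
def AsymptoticallyPeriodic (a : ℕ → ℕ → ℂ) (t : ℝ) (p : ℕ) (α : ℕ → ℂ) : Prop :=
  ∀ j < p, ∀ k N : ℕ → ℕ, IsRatioSeq t (fun i => k i * p) N →
    Tendsto (fun i => a (k i * p + j) (N i)) atTop (𝓝 (α j))

/-! ### Orthogonal and paraorthogonal polynomials on the unit circle -/

/-- The reversed polynomial `z ^ n * conj (P (1 / conj z))` of a polynomial `P` of degree at
most `n`: the coefficients are conjugated, and their order is reversed. -/
def reversed (n : ℕ) (P : ℂ[X]) : ℂ[X] :=
  (P.map (starRingEnd ℂ)).reflect n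

/-- The monic orthogonal polynomials with Verblunsky coefficients `α`, through the Szegő
recurrence `Φ_{n+1} = z Φ_n - conj α_n * Φ_n^*`, `Φ_0 = 1`. -/
def opuc (α : ℕ → ℂ) : ℕ → ℂ[X]
  | 0 => 1
  | n + 1 => X * opuc α n - C (starRingEnd ℂ (α n)) * reversed n (opuc α n)

/-- The reversed polynomials `Φ_n^*`. -/
def opucStar (α : ℕ → ℂ) (n : ℕ) : ℂ[X] :=
  reversed n (opuc α n)

/-- The paraorthogonal polynomials `Φ_{n+1}^{(β)} = z Φ_n - conj β * Φ_n^*`. (They have positive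
index; the value at index `0` is a convention that no limit `n → ∞` sees.) -/
def popuc (α : ℕ → ℂ) (β : ℂ) : ℕ → ℂ[X]
  | 0 => 1
  | n + 1 => X * opuc α n - C (starRingEnd ℂ β) * opucStar α n

/-! ### Limit points of the zeros of paraorthogonal polynomials

Here `a n N` is the `n`-th Verblunsky coefficient of the `N`-th sequence, so the `N`-th sequence
is `fun m => a m N`. -/

/-- The zeros on the unit circle of the paraorthogonal polynomial with indices `n`, `N`. -/
def popucZeros (a : ℕ → ℕ → ℂ) (β : ℂ) (n N : ℕ) : Set ℂ :=
  {z | ‖z‖ = 1 ∧ (popuc (fun m => a m N) β n).eval z = 0}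

/-- The set `Λ_{β,t}` of weak limit points of zeros of the paraorthogonal polynomials. -/
def limitZeros (a : ℕ → ℕ → ℂ) (t : ℝ) (β : ℂ) : Set ℂ :=
  {z | ‖z‖ = 1 ∧ ∃ n N : ℕ → ℕ, IsRatioSeq t n N ∧
    liminf (fun i => Metric.infEDist z (popucZeros a β (n i) (N i))) atTop = 0}

/-- The set `Λ_t`, the intersection of all `Λ_{β,t}` with `β` on the unit circle. -/
def limitZerosInter (a : ℕ → ℕ → ℂ) (t : ℝ) : Set ℂ :=
  {z | ∀ β : ℂ, ‖β‖ = 1 → z ∈ limitZeros a t β}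

/-! ### CMV operators -/

/-- `ρ = √(1 - |α|²)`. -/
def rho (α : ℂ) : ℝ := √(1 - ‖α‖ ^ 2)

/-- The Hilbert space `ℓ²(ℕ)`. -/
abbrev EllTwo : Type := lp (fun _ : ℕ => ℂ) 2

theorem memℓp_two_iff (x : ℕ → ℂ) : Memℓp x 2 ↔ Summable fun i => ‖x i‖ ^ 2 := by
  rw [memℓp_gen_iff (by norm_num)]
  simp

theorem norm_sq_eq_tsum (x : EllTwo) : ‖x‖ ^ 2 = ∑' i, ‖x i‖ ^ 2 := by
  have h := lp.norm_rpow_eq_tsum (p := 2) (by norm_num) x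
  simpa using h

theorem summable_norm_sq (x : EllTwo) : Summable fun i => ‖x i‖ ^ 2 :=
  (memℓp_two_iff _).1 (lp.memℓp x)

theorem summable_norm_sq_comp (x : EllTwo) {σ : ℕ → ℕ} (hσ : Function.Involutive σ) :
    Summable fun i => ‖x (σ i)‖ ^ 2 :=
  (summable_norm_sq x).comp_injective hσ.injective

theorem norm_sq_mul_add_mul_le {a b u v : ℂ} (ha : ‖a‖ ≤ 1) (hb : ‖b‖ ≤ 1) :
    ‖a * u + b * v‖ ^ 2 ≤ 2 * ‖u‖ ^ 2 + 2 * ‖v‖ ^ 2 := by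
  have h : ‖a * u + b * v‖ ≤ ‖u‖ + ‖v‖ := by
    refine (norm_add_le _ _).trans ?_
    rw [norm_mul, norm_mul]
    exact add_le_add (mul_le_of_le_one_left (norm_nonneg _) ha)
      (mul_le_of_le_one_left (norm_nonneg _) hb)
  nlinarith [norm_nonneg (a * u + b * v), sq_nonneg (‖u‖ - ‖v‖)]

/-- The bounded operator `(T x)_i = d_i x_i + o_i x_{σ i}` on `ℓ²(ℕ)`, for an involution `σ` of
the index set and coefficients of modulus at most one. -/
def pairOp (σ : ℕ → ℕ) (hσ : Function.Involutive σ) (d o : ℕ → ℂ)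
    (hd : ∀ i, ‖d i‖ ≤ 1) (ho : ∀ i, ‖o i‖ ≤ 1) : EllTwo →L[ℂ] EllTwo :=
  have hsum : ∀ x : EllTwo, Summable fun i => 2 * ‖x i‖ ^ 2 + 2 * ‖x (σ i)‖ ^ 2 := fun x =>
    ((summable_norm_sq x).mul_left 2).add ((summable_norm_sq_comp x hσ).mul_left 2)
  LinearMap.mkContinuous
    { toFun := fun x => (⟨fun i => d i * x i + o i * x (σ i), (memℓp_two_iff _).2
        (Summable.of_nonneg_of_le (fun i => by positivity)
          (fun i => norm_sq_mul_add_mul_le (hd i) (ho i)) (hsum x))⟩ : EllTwo)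
      map_add' := fun x y => by
        ext i
        simp only [lp.coeFn_add, Pi.add_apply]
        ring
      map_smul' := fun c x => by
        ext i
        simp only [lp.coeFn_smul, Pi.smul_apply, smul_eq_mul, RingHom.id_apply]
        ring }
    2 (fun x => by
      refine le_of_sq_le_sq ?_ (by positivity)
      rw [norm_sq_eq_tsum, mul_pow, norm_sq_eq_tsum x]
      have h1 : ∑' i, ‖x (σ i)‖ ^ 2 = ∑' i, ‖x i‖ ^ 2 :=
        (hσ.toPerm σ).tsum_eq (fun i => ‖x i‖ ^ 2)
      have h2 : ∑' i, (2 * ‖x i‖ ^ 2 + 2 * ‖x (σ i)‖ ^ 2) = 2 ^ 2 * ∑' i, ‖x i‖ ^ 2 := by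
        rw [Summable.tsum_add ((summable_norm_sq x).mul_left 2)
          ((summable_norm_sq_comp x hσ).mul_left 2),
          tsum_mul_left, tsum_mul_left, h1]
        ring
      rw [← h2]
      exact Summable.tsum_le_tsum (fun i => norm_sq_mul_add_mul_le (hd i) (ho i))
        (Summable.of_nonneg_of_le (fun i => by positivity)
          (fun i => norm_sq_mul_add_mul_le (hd i) (ho i)) (hsum x)) (hsum x))

theorem pairOp_apply (σ : ℕ → ℕ) (hσ : Function.Involutive σ) (d o : ℕ → ℂ)
    (hd : ∀ i, ‖d i‖ ≤ 1) (ho : ∀ i, ‖o i‖ ≤ 1) (x : EllTwo) (i : ℕ) :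
    pairOp σ hσ d o hd ho x i = d i * x i + o i * x (σ i) := rfl

/-- The involution with orbits `{0, 1}, {2, 3}, …`. -/
def evenPartner (i : ℕ) : ℕ := if Even i then i + 1 else i - 1

/-- The involution with orbits `{0}, {1, 2}, {3, 4}, …`. -/
def oddPartner (i : ℕ) : ℕ := if Odd i then i + 1 else i - 1

theorem evenPartner_involutive : Function.Involutive evenPartner := by
  intro i
  unfold evenPartner
  grind

theorem oddPartner_involutive : Function.Involutive oddPartner := by
  intro i
  unfold oddPartner
  grind

theorem norm_rho_le (α : ℂ) : ‖(rho α : ℂ)‖ ≤ 1 := by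
  rw [Complex.norm_real, rho, Real.norm_of_nonneg (Real.sqrt_nonneg _)]
  exact Real.sqrt_le_one.2 (by nlinarith [sq_nonneg ‖α‖])

/-- Diagonal entries of `Θ(α_0) ⊕ Θ(α_2) ⊕ …`, where `Θ(α)` is the symmetric unitary matrix with
rows `(conj α, ρ)` and `(ρ, -α)`. -/
def evenDiag (α : ℕ → ℂ) (i : ℕ) : ℂ :=
  if Even i then starRingEnd ℂ (α i) else -α (i - 1)

/-- Off-diagonal entries of `Θ(α_0) ⊕ Θ(α_2) ⊕ …`. -/
def evenOff (α : ℕ → ℂ) (i : ℕ) : ℂ :=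
  if Even i then (rho (α i) : ℂ) else (rho (α (i - 1)) : ℂ)

/-- Diagonal entries of `1 ⊕ Θ(α_1) ⊕ Θ(α_3) ⊕ …`. -/
def oddDiag (α : ℕ → ℂ) (i : ℕ) : ℂ :=
  if i = 0 then 1 else if Odd i then starRingEnd ℂ (α i) else -α (i - 1)

/-- Off-diagonal entries of `1 ⊕ Θ(α_1) ⊕ Θ(α_3) ⊕ …`. -/
def oddOff (α : ℕ → ℂ) (i : ℕ) : ℂ :=
  if i = 0 then 0 else if Odd i then (rho (α i) : ℂ) else (rho (α (i - 1)) : ℂ)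

theorem norm_evenDiag_le {α : ℕ → ℂ} (hα : ∀ n, ‖α n‖ < 1) (i : ℕ) : ‖evenDiag α i‖ ≤ 1 := by
  unfold evenDiag
  split_ifs
  · simpa using (hα i).le
  · simpa using (hα (i - 1)).le

theorem norm_evenOff_le (α : ℕ → ℂ) (i : ℕ) : ‖evenOff α i‖ ≤ 1 := by
  unfold evenOff
  split_ifs <;> exact norm_rho_le _

theorem norm_oddDiag_le {α : ℕ → ℂ} (hα : ∀ n, ‖α n‖ < 1) (i : ℕ) : ‖oddDiag α i‖ ≤ 1 := by
  unfold oddDiag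
  split_ifs
  · simp
  · simpa using (hα i).le
  · simpa using (hα (i - 1)).le

theorem norm_oddOff_le (α : ℕ → ℂ) (i : ℕ) : ‖oddOff α i‖ ≤ 1 := by
  unfold oddOff
  split_ifs
  · simp
  · exact norm_rho_le _
  · exact norm_rho_le _

/-- The CMV operator with Verblunsky coefficients `α`, as the product of
`Θ(α_0) ⊕ Θ(α_2) ⊕ …` and `1 ⊕ Θ(α_1) ⊕ Θ(α_3) ⊕ …`. Multiplied out, this is the five-diagonal
matrix with rows, for `k ≥ 0` and with `α_{-1} = -1`, `ρ_{-1} = 0`,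
`(conj α_{2k} ρ_{2k-1}, -conj α_{2k} α_{2k-1}, conj α_{2k+1} ρ_{2k}, ρ_{2k+1} ρ_{2k})` and
`(ρ_{2k} ρ_{2k-1}, -ρ_{2k} α_{2k-1}, -conj α_{2k+1} α_{2k}, -ρ_{2k+1} α_{2k})`
in the columns `2k-1, 2k, 2k+1, 2k+2`. -/
def cmv (α : ℕ → ℂ) (hα : ∀ n, ‖α n‖ < 1) : EllTwo →L[ℂ] EllTwo :=
  pairOp evenPartner evenPartner_involutive (evenDiag α) (evenOff α)
      (norm_evenDiag_le hα) (norm_evenOff_le α) *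
    pairOp oddPartner oddPartner_involutive (oddDiag α) (oddOff α)
      (norm_oddDiag_le hα) (norm_oddOff_le α)

/-! ### Carathéodory and Schur functions -/

/-- The first vector of the standard basis of `ℓ²(ℕ)`. -/
def e₀ : EllTwo := lp.single 2 0 1

/-- The Carathéodory function `F(z) = ⟨e₀, (𝒞 + z) (𝒞 - z)⁻¹ e₀⟩` of the CMV operator `𝒞` with
Verblunsky coefficients `α`, for `z` outside the spectrum of `𝒞`. -/
def caratheodory (α : ℕ → ℂ) (hα : ∀ n, ‖α n‖ < 1) (z : ℂ) : ℂ :=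
  inner ℂ e₀ (((cmv α hα + z • (1 : EllTwo →L[ℂ] EllTwo)) *
    Ring.inverse (cmv α hα - z • (1 : EllTwo →L[ℂ] EllTwo))) e₀)

/-- The Schur function `f(z) = z⁻¹ (F(z) - 1) / (F(z) + 1)`, with the value `∞` where
`F(z) = -1`, and at `z = 0` through the limit. -/
def schur (α : ℕ → ℂ) (hα : ∀ n, ‖α n‖ < 1) (z : ℂ) : OnePoint ℂ :=
  if z = 0 then
    ((limUnder (𝓝[≠] (0 : ℂ)) fun w =>
      1 / w * ((caratheodory α hα w - 1) / (caratheodory α hα w + 1)) : ℂ) : OnePoint ℂ)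
  else if caratheodory α hα z = -1 then OnePoint.infty
  else ((1 / z * ((caratheodory α hα z - 1) / (caratheodory α hα z + 1)) : ℂ) : OnePoint ℂ)

/-- The zeros of a Schur function in the open unit disk. -/
def schurZeros (f : ℂ → OnePoint ℂ) : Set ℂ :=
  {z | ‖z‖ < 1 ∧ f z = ((0 : ℂ) : OnePoint ℂ)}

/-- The poles of a Schur function outside the closed unit disk. -/
def schurPoles (f : ℂ → OnePoint ℂ) : Set ℂ :=
  {z | 1 < ‖z‖ ∧ f z = OnePoint.infty}

/-! ### The reversed periodic sequence and its discriminant -/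

/-- The `p`-periodic sequence with first `p` terms `-conj α_{p-1}, -conj α_{p-2}, …, -conj α_0`. -/
def reversedCoeff (p : ℕ) (α : ℕ → ℂ) (n : ℕ) : ℂ :=
  -starRingEnd ℂ (α (p - 1 - n % p))

theorem norm_reversedCoeff_lt (p : ℕ) {α : ℕ → ℂ} (hα : ∀ n, ‖α n‖ < 1) (n : ℕ) :
    ‖reversedCoeff p α n‖ < 1 := by
  simpa [reversedCoeff] using hα (p - 1 - n % p)

/-- The Schur function `f_1^{(j)}` of the `j` times stripped CMV operator of the reversed periodic
sequence: its Verblunsky coefficients are those of that sequence from index `j` on. -/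
def strippedSchur (p : ℕ) (α : ℕ → ℂ) (hα : ∀ n, ‖α n‖ < 1) (j : ℕ) : ℂ → OnePoint ℂ :=
  schur (fun n => reversedCoeff p α (n + j)) (fun n => norm_reversedCoeff_lt p hα (n + j))

/-- The set `𝒵`. -/
def zeroSet (p : ℕ) (α : ℕ → ℂ) (hα : ∀ n, ‖α n‖ < 1) : Set ℂ :=
  ⋃ j ∈ Finset.range p, schurZeros (strippedSchur p α hα j)

/-- The set `𝒫`. -/
def poleSet (p : ℕ) (α : ℕ → ℂ) (hα : ∀ n, ‖α n‖ < 1) : Set ℂ :=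
  ⋃ j ∈ Finset.range p, schurPoles (strippedSchur p α hα j)

/-- The one-step transfer matrix `A(α, z)`. -/
def stepMatrix (α z : ℂ) : Matrix (Fin 2) (Fin 2) ℂ :=
  (1 / (rho α : ℂ)) • !![z, -starRingEnd ℂ α; -α * z, 1]

/-- The product `A(α_{n-1}, z) ⋯ A(α_0, z)`. -/
def transferMatrix (α : ℕ → ℂ) (z : ℂ) : ℕ → Matrix (Fin 2) (Fin 2) ℂ
  | 0 => 1
  | n + 1 => stepMatrix (α n) z * transferMatrix α z n

/-- The discriminant `Δ(z) = z ^ (-p/2) Tr (A(α_{p-1}, z) ⋯ A(α_0, z))`, for `z ≠ 0`, with the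
principal branch of the power. -/
def discriminant (p : ℕ) (α : ℕ → ℂ) (z : ℂ) : ℂ :=
  z ^ (-(p : ℂ) / 2) * (transferMatrix α z p).trace

/-- The square root of `d ^ 2 - 4` for which `|d + √(d ^ 2 - 4)|` is the larger one. (The two
moduli agree only for `d` in `[-2, 2]`.) -/
def dominantSqrt (d : ℂ) : ℂ :=
  if ‖d - (d ^ 2 - 4) ^ (1 / 2 : ℂ)‖ ≤ ‖d + (d ^ 2 - 4) ^ (1 / 2 : ℂ)‖
  then (d ^ 2 - 4) ^ (1 / 2 : ℂ) else -(d ^ 2 - 4) ^ (1 / 2 : ℂ)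

/-- The function `G_Δ(z) = (z ^ (p/2) / 2) (∏_{j<p} ρ_j) (Δ(z) + √(Δ(z) ^ 2 - 4))`, with its
limit `1` at the removable singularity `z = 0`. The same branch of `z ^ (1/2)` is used in
`z ^ (p/2)` and in `Δ(z)`; the value does not depend on it. -/
def gDelta (p : ℕ) (α : ℕ → ℂ) (z : ℂ) : ℂ :=
  if z = 0 then 1
  else z ^ ((p : ℂ) / 2) / 2 * (∏ j ∈ Finset.range p, (rho (α j) : ℂ)) *
    (discriminant p α z + dominantSqrt (discriminant p α z))

/-- The quotients `P n N / Q n N` converge to `G` as `n / N → t`, uniformly on compact subsets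
of `S`. On each such subset the quotients are eventually defined, that is, the denominators
have no zeros there. -/
def QuotientsConverge (t : ℝ) (P Q : ℕ → ℕ → ℂ[X]) (G : ℂ → ℂ) (S : Set ℂ) : Prop :=
  ∀ K : Set ℂ, K ⊆ S → IsCompact K → ∀ n N : ℕ → ℕ, IsRatioSeq t n N →
    (∀ᶠ i in atTop, ∀ z ∈ K, (Q (n i) (N i)).eval z ≠ 0) ∧
    TendstoUniformlyOn (fun i z => (P (n i) (N i)).eval z / (Q (n i) (N i)).eval z) G atTop K

end VaryingOPUC

end

noncomputable section

namespace VaryingOPUC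

/-! ### Recurrences for the orthogonal polynomials -/

/-! In the disk the quotient `Φ_n / Φ_n^*` evolves by the Möbius maps `schurStep`. For `|z| ≤ r < 1`
these contract the hyperbolic metric by a definite factor, so the quotient forgets its start and
depends, up to a small error, on the last few coefficients only (`exists_schurIterate_sub_lt`).
Along `n / N → t` those coefficients approach periodic ones, hence `Φ_n / Φ_n^*` approaches a
function `s_n` that is `p`-periodic in `n` (`periodicSchur`). Since `Φ_{n+1}^* / Φ_n^* = 1 - α_n z
Φ_n / Φ_n^*`, the quotient `Φ_{n+p}^* / Φ_n^*` tends to the product of `1 - α_j z s_j` over a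
period. The vector `(s_0, 1)` is an eigenvector of the transfer matrix over a period, and its
eigenvalue has modulus at least one while the determinant is `z ^ p`; so it is the dominant
eigenvalue, and the product is `G_Δ` (`gDelta_eq_diskLimit`). The exterior follows by `z ↦ 1 / z`,
which exchanges `Φ_n` and `Φ_n^*` and conjugates the coefficients.

If one family has the ratio limit `G_Δ`, so has any other whose quotient by the first is almost
`p`-periodic and bounded away from zero (`VanishesOn.ratio_transfer`). For `Φ_n` in the disk this
needs `s_j ≠ 0`. The Weyl solution of the CMV operator identifies the `s_j` with the Schur functions
of the reversed sequence (`caratheodory_eq_of_schur`, `schur_eq`), so their zeros make up the set of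
zeros to be excluded. The poles arise from it by reflection.

Near a point of the circle off `Λ_{β,t}` the polynomials `Φ_n^* - β z Φ_n` have no zeros in a fixed
disk. The Cayley transform `(Φ_n^* + β z Φ_n) / (Φ_n^* - β z Φ_n)` grows at most like the inverse
distance to the circle, so it is bounded on a smaller disk by the maximum principle, and this bounds
all quotients in question (`bounds_near_circle`). Bounded holomorphic families that converge inside
the circle converge across it (`VanishesOn.of_bounded_near_circle`). The limit is `G_Δ` off the
circle; on the circle, the maximum principle for the quotient of the two eigenvalues shows that the
dominant one remains strictly dominant (`gDelta_eq_of_differentiableOn`). -/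

theorem natDegree_opuc_le (α : ℕ → ℂ) (n : ℕ) : (opuc α n).natDegree ≤ n := by
  induction n with
  | zero => simp [opuc]
  | succ n ih =>
    rw [opuc]
    refine (natDegree_sub_le _ _).trans (max_le ?_ ?_)
    · exact (natDegree_mul_le).trans (by have := natDegree_X_le (R := ℂ); omega)
    · refine (natDegree_C_mul_le _ _).trans ?_
      rw [reversed]
      refine natDegree_le_iff_coeff_eq_zero.2 fun m hm => ?_
      rw [coeff_reflect, revAt_eq_self_of_lt (by omega), coeff_map,
        coeff_eq_zero_of_natDegree_lt (by omega), map_zero]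

theorem reversed_X_mul (n : ℕ) {P : ℂ[X]} (hP : P.natDegree ≤ n) :
    reversed (n + 1) (X * P) = reversed n P := by
  rw [reversed, reversed, Polynomial.map_mul, map_X, add_comm n 1,
    reflect_mul _ _ natDegree_X_le (natDegree_map_le.trans hP)]
  have : reflect 1 (X : ℂ[X]) = 1 := by simp
  rw [this, one_mul]

theorem reversed_reversed (n : ℕ) {P : ℂ[X]} (hP : P.natDegree ≤ n) :
    reversed (n + 1) (reversed n P) = X * P := by
  ext m
  rw [reversed, reversed, coeff_reflect, coeff_map, coeff_reflect, coeff_map]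
  rcases m with _ | m
  -- `revAt n` fixes the indices beyond `n`, so the constant coefficient is the coefficient of `P`
  -- at `n + 1`, which the degree bound kills.
  · rw [revAt_le (Nat.zero_le _), Nat.sub_zero, revAt_eq_self_of_lt (Nat.lt_succ_self n),
      coeff_eq_zero_of_natDegree_lt (by omega)]
    simp
  · rw [coeff_X_mul]
    by_cases h : m ≤ n
    · rw [revAt_le (show m + 1 ≤ n + 1 by omega), Nat.add_sub_add_right,
        revAt_le (Nat.sub_le n m), Complex.conj_conj, Nat.sub_sub_self h]
    · rw [revAt_eq_self_of_lt (show n + 1 < m + 1 by omega),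
        revAt_eq_self_of_lt (show n < m + 1 by omega),
        coeff_eq_zero_of_natDegree_lt (by omega), coeff_eq_zero_of_natDegree_lt (by omega)]
      simp

theorem opucStar_succ (α : ℕ → ℂ) (n : ℕ) :
    opucStar α (n + 1) = opucStar α n - C (α n) * (X * opuc α n) := by
  have h : reversed (n + 1) (C (starRingEnd ℂ (α n)) * reversed n (opuc α n)) =
      C (α n) * (X * opuc α n) := by
    rw [← reversed_reversed n (natDegree_opuc_le α n), reversed, Polynomial.map_mul, map_C,
      reflect_C_mul, Complex.conj_conj]
    rfl
  rw [opucStar, opuc, ← h, opucStar, ← reversed_X_mul n (natDegree_opuc_le α n)]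
  simp only [reversed, Polynomial.map_sub, reflect_sub]

theorem eval_opuc_zero (α : ℕ → ℂ) (z : ℂ) : (opuc α 0).eval z = 1 := by simp [opuc]

theorem eval_opucStar_zero (α : ℕ → ℂ) (z : ℂ) : (opucStar α 0).eval z = 1 := by
  simp [opucStar, opuc, reversed]

theorem eval_opuc_succ (α : ℕ → ℂ) (n : ℕ) (z : ℂ) :
    (opuc α (n + 1)).eval z =
      z * (opuc α n).eval z - starRingEnd ℂ (α n) * (opucStar α n).eval z := by
  simp [opuc, opucStar]

theorem eval_opucStar_succ (α : ℕ → ℂ) (n : ℕ) (z : ℂ) :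
    (opucStar α (n + 1)).eval z =
      (opucStar α n).eval z - α n * z * (opuc α n).eval z := by
  simp [opucStar_succ, mul_assoc]

theorem eval_popuc_succ (α : ℕ → ℂ) (β : ℂ) (n : ℕ) (z : ℂ) :
    (popuc α β (n + 1)).eval z =
      z * (opuc α n).eval z - starRingEnd ℂ β * (opucStar α n).eval z := by
  simp [popuc]

/-- Up to the factor `1 - |α|²`, a Szegő step preserves the indefinite form `|y|² - |x|²` in the
variables `z x` and `y`. All comparisons of `Φ_n` with `Φ_n^*` and all contraction estimates come
from this identity. -/
theorem szego_norm_sq (α z x y : ℂ) :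
    ‖y - α * z * x‖ ^ 2 - ‖z * x - starRingEnd ℂ α * y‖ ^ 2 =
      (1 - ‖α‖ ^ 2) * (‖y‖ ^ 2 - ‖z * x‖ ^ 2) := by
  simp only [← Complex.normSq_eq_norm_sq, Complex.normSq_apply, Complex.sub_re, Complex.sub_im,
    Complex.mul_re, Complex.mul_im, Complex.conj_re, Complex.conj_im]
  ring

theorem one_sub_norm_sq_pos {α : ℂ} (hα : ‖α‖ < 1) : 0 < 1 - ‖α‖ ^ 2 := by
  nlinarith [norm_nonneg α]

/-- The two claims are proved together: the comparison of norms at `n` and `|α_n| < 1` exclude a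
zero at `n + 1`, and `szego_norm_sq` carries the comparison on. -/
theorem eval_opucStar_ne_zero_and_le {α : ℕ → ℂ} (hα : ∀ n, ‖α n‖ < 1) {z : ℂ} (hz : ‖z‖ ≤ 1)
    (n : ℕ) : (opucStar α n).eval z ≠ 0 ∧ ‖(opuc α n).eval z‖ ≤ ‖(opucStar α n).eval z‖ := by
  induction n with
  | zero => simp [eval_opuc_zero, eval_opucStar_zero]
  | succ n ih =>
    obtain ⟨h0, hle⟩ := ih
    have hz' : ‖z * (opuc α n).eval z‖ ≤ ‖(opucStar α n).eval z‖ := by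
      rw [norm_mul]
      exact (mul_le_of_le_one_left (norm_nonneg _) hz).trans hle
    rw [eval_opuc_succ, eval_opucStar_succ]
    constructor
    · intro h
      have h1 : ‖(opucStar α n).eval z‖ = ‖α n‖ * ‖z * (opuc α n).eval z‖ := by
        rw [← norm_mul, ← mul_assoc, sub_eq_zero.1 h]
      have := norm_pos_iff.2 h0
      nlinarith [hα n, norm_nonneg (α n), norm_nonneg (z * (opuc α n).eval z)]
    · have := szego_norm_sq (α n) z ((opuc α n).eval z) ((opucStar α n).eval z)
      refine le_of_sq_le_sq ?_ (norm_nonneg _)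
      have h2 : 0 ≤ (1 - ‖α n‖ ^ 2) * (‖(opucStar α n).eval z‖ ^ 2 -
          ‖z * (opuc α n).eval z‖ ^ 2) :=
        mul_nonneg (one_sub_norm_sq_pos (hα n)).le
          (sub_nonneg.2 (pow_le_pow_left₀ (norm_nonneg _) hz' 2))
      linarith

theorem eval_opuc_ne_zero_and_le {α : ℕ → ℂ} (hα : ∀ n, ‖α n‖ < 1) {z : ℂ} (hz : 1 ≤ ‖z‖)
    (n : ℕ) : (opuc α n).eval z ≠ 0 ∧ ‖(opucStar α n).eval z‖ ≤ ‖(opuc α n).eval z‖ := by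
  induction n with
  | zero => simp [eval_opuc_zero, eval_opucStar_zero]
  | succ n ih =>
    obtain ⟨h0, hle⟩ := ih
    have hz' : ‖(opucStar α n).eval z‖ ≤ ‖z * (opuc α n).eval z‖ := by
      rw [norm_mul]
      exact hle.trans (le_mul_of_one_le_left (norm_nonneg _) hz)
    rw [eval_opuc_succ, eval_opucStar_succ]
    constructor
    · intro h
      have h1 : ‖z * (opuc α n).eval z‖ = ‖α n‖ * ‖(opucStar α n).eval z‖ := by
        rw [sub_eq_zero.1 h, norm_mul, RCLike.norm_conj]
      have h2 := norm_pos_iff.2 h0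
      have h3 : ‖(opuc α n).eval z‖ ≤ ‖z * (opuc α n).eval z‖ := by
        rw [norm_mul]
        exact le_mul_of_one_le_left (norm_nonneg _) hz
      nlinarith [hα n, norm_nonneg (α n), norm_nonneg ((opucStar α n).eval z)]
    · have := szego_norm_sq (α n) z ((opuc α n).eval z) ((opucStar α n).eval z)
      refine le_of_sq_le_sq ?_ (norm_nonneg _)
      have h2 : 0 ≤ (1 - ‖α n‖ ^ 2) * (‖z * (opuc α n).eval z‖ ^ 2 -
          ‖(opucStar α n).eval z‖ ^ 2) :=
        mul_nonneg (one_sub_norm_sq_pos (hα n)).le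
          (sub_nonneg.2 (pow_le_pow_left₀ (norm_nonneg _) hz' 2))
      linarith

/-! ### The Schur algorithm, run backwards -/

/-- The step `w ↦ (z w - conj α) / (1 - α z w)`, which sends `Φ_n / Φ_n^*` to
`Φ_{n+1} / Φ_{n+1}^*`. -/
def schurStep (α z w : ℂ) : ℂ := (z * w - starRingEnd ℂ α) / (1 - α * z * w)

/-- The iterated step, with coefficients `α 0, α 1, …` in this order. -/
def schurIterate (α : ℕ → ℂ) (z w : ℂ) : ℕ → ℂ
  | 0 => w
  | n + 1 => schurStep (α n) z (schurIterate α z w n)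

theorem one_sub_norm_le {α z w : ℂ} (hz : ‖z‖ ≤ 1) (hw : ‖w‖ ≤ 1) :
    1 - ‖α‖ ≤ ‖1 - α * z * w‖ := by
  have h : ‖α * z * w‖ ≤ ‖α‖ := by
    rw [norm_mul, norm_mul]
    calc ‖α‖ * ‖z‖ * ‖w‖ ≤ ‖α‖ * 1 * 1 := by gcongr
      _ = ‖α‖ := by ring
  have := norm_sub_norm_le (1 : ℂ) (α * z * w)
  rw [norm_one] at this
  linarith

/-- `one_sub_norm_le` with `α` and `z` exchanged. This form is uniform in coefficients that may
approach the circle, the other one in `z` up to the circle. -/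
theorem one_sub_norm_le' {α z w : ℂ} (hα : ‖α‖ ≤ 1) (hw : ‖w‖ ≤ 1) :
    1 - ‖z‖ ≤ ‖1 - α * z * w‖ := by
  rw [mul_comm α z]
  exact one_sub_norm_le hα hw

theorem schurStep_denom_ne_zero {α z w : ℂ} (hα : ‖α‖ < 1) (hz : ‖z‖ ≤ 1) (hw : ‖w‖ ≤ 1) :
    1 - α * z * w ≠ 0 :=
  norm_pos_iff.1 ((sub_pos.2 hα).trans_le (one_sub_norm_le hz hw))

theorem one_sub_norm_sq_schurStep {α z w : ℂ} (h : 1 - α * z * w ≠ 0) :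
    1 - ‖schurStep α z w‖ ^ 2 =
      (1 - ‖α‖ ^ 2) * (1 - ‖z * w‖ ^ 2) / ‖1 - α * z * w‖ ^ 2 := by
  have h1 : ‖1 - α * z * w‖ ^ 2 ≠ 0 := pow_ne_zero _ (norm_ne_zero_iff.2 h)
  have h2 := szego_norm_sq α z w 1
  rw [mul_one, norm_one] at h2
  rw [schurStep, norm_div, div_pow, eq_div_iff h1, sub_mul, div_mul_cancel₀ _ h1]
  linarith

theorem norm_mul_le_one {z w : ℂ} (hz : ‖z‖ ≤ 1) (hw : ‖w‖ ≤ 1) : ‖z * w‖ ≤ 1 := by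
  rw [norm_mul]
  exact mul_le_one₀ hz (norm_nonneg _) hw

theorem norm_mul_lt_one {z w : ℂ} (hz : ‖z‖ < 1) (hw : ‖w‖ ≤ 1) : ‖z * w‖ < 1 := by
  rw [norm_mul]
  exact (mul_le_of_le_one_right (norm_nonneg _) hw).trans_lt hz

theorem norm_schurStep_le {α z w : ℂ} (hα : ‖α‖ < 1) (hz : ‖z‖ ≤ 1) (hw : ‖w‖ ≤ 1) :
    ‖schurStep α z w‖ ≤ 1 := by
  have h := one_sub_norm_sq_schurStep (schurStep_denom_ne_zero hα hz hw)
  have h1 : 0 ≤ 1 - ‖schurStep α z w‖ ^ 2 := by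
    rw [h]
    have := one_sub_norm_sq_pos hα
    have h3 : 0 ≤ 1 - ‖z * w‖ ^ 2 := by
      have := norm_mul_le_one hz hw
      nlinarith [norm_nonneg (z * w)]
    positivity
  exact (sq_le_one_iff₀ (norm_nonneg _)).1 (by linarith)

theorem norm_schurStep_lt {α z w : ℂ} (hα : ‖α‖ < 1) (hz : ‖z‖ < 1) (hw : ‖w‖ ≤ 1) :
    ‖schurStep α z w‖ < 1 := by
  have h0 := schurStep_denom_ne_zero hα hz.le hw
  have h := one_sub_norm_sq_schurStep h0
  have h1 : 0 < 1 - ‖schurStep α z w‖ ^ 2 := by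
    rw [h]
    have h2 := one_sub_norm_sq_pos hα
    have h3 := one_sub_norm_sq_pos (norm_mul_lt_one hz hw)
    have := norm_pos_iff.2 h0
    positivity
  exact (sq_lt_one_iff₀ (norm_nonneg _)).1 (by linarith)

theorem norm_schurIterate_le {α : ℕ → ℂ} (hα : ∀ n, ‖α n‖ < 1) {z w : ℂ} (hz : ‖z‖ ≤ 1)
    (hw : ‖w‖ ≤ 1) (n : ℕ) : ‖schurIterate α z w n‖ ≤ 1 := by
  induction n with
  | zero => exact hw
  | succ n ih => exact norm_schurStep_le (hα n) hz ih

theorem norm_schurIterate_succ_lt {α : ℕ → ℂ} (hα : ∀ n, ‖α n‖ < 1) {z w : ℂ} (hz : ‖z‖ < 1)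
    (hw : ‖w‖ ≤ 1) (n : ℕ) : ‖schurIterate α z w (n + 1)‖ < 1 :=
  norm_schurStep_lt (hα n) hz (norm_schurIterate_le hα hz.le hw n)

theorem schurIterate_add (α : ℕ → ℂ) (z w : ℂ) (n m : ℕ) :
    schurIterate α z w (n + m) =
      schurIterate (fun j => α (n + j)) z (schurIterate α z w n) m := by
  induction m with
  | zero => rfl
  | succ m ih => rw [← add_assoc, schurIterate, ih, schurIterate]

theorem conj_schurStep (α z w : ℂ) :
    starRingEnd ℂ (schurStep α z w) =
      schurStep (starRingEnd ℂ α) (starRingEnd ℂ z) (starRingEnd ℂ w) := by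
  simp [schurStep]

theorem conj_schurIterate (α : ℕ → ℂ) (z w : ℂ) (n : ℕ) :
    starRingEnd ℂ (schurIterate α z w n) =
      schurIterate (fun j => starRingEnd ℂ (α j)) (starRingEnd ℂ z) (starRingEnd ℂ w) n := by
  induction n with
  | zero => rfl
  | succ n ih => rw [schurIterate, conj_schurStep, ih, schurIterate]

theorem eval_opuc_eq {α : ℕ → ℂ} (hα : ∀ n, ‖α n‖ < 1) {z : ℂ} (hz : ‖z‖ ≤ 1) (n : ℕ) :
    (opuc α n).eval z = schurIterate α z 1 n * (opucStar α n).eval z := by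
  induction n with
  | zero => simp [eval_opuc_zero, eval_opucStar_zero, schurIterate]
  | succ n ih =>
    have h0 := schurStep_denom_ne_zero (hα n) hz (norm_schurIterate_le hα hz norm_one.le n)
    rw [eval_opuc_succ, eval_opucStar_succ, ih, schurIterate, schurStep, div_mul_eq_mul_div,
      eq_div_iff h0]
    ring

theorem eval_opucStar_succ_eq {α : ℕ → ℂ} (hα : ∀ n, ‖α n‖ < 1) {z : ℂ} (hz : ‖z‖ ≤ 1) (n : ℕ) :
    (opucStar α (n + 1)).eval z =
      (1 - α n * z * schurIterate α z 1 n) * (opucStar α n).eval z := by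
  rw [eval_opucStar_succ, eval_opuc_eq hα hz]
  ring

/-- The reflection `z ↦ 1 / z` exchanges `Φ_n` and `Φ_n^*`, with conjugated coefficients. -/
theorem eval_opuc_inv (α : ℕ → ℂ) {z : ℂ} (hz : z ≠ 0) (n : ℕ) :
    (opuc α n).eval z = z ^ n * (opucStar (fun j => starRingEnd ℂ (α j)) n).eval z⁻¹ ∧
    (opucStar α n).eval z = z ^ n * (opuc (fun j => starRingEnd ℂ (α j)) n).eval z⁻¹ := by
  induction n with
  | zero => simp [eval_opuc_zero, eval_opucStar_zero]
  | succ n ih =>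
    simp only [eval_opuc_succ, eval_opucStar_succ, ih.1, ih.2, Complex.conj_conj]
    constructor
    · field_simp
      ring
    · field_simp
      ring

/-! ### Contraction of the Schur algorithm -/

/-- The equality case of Schwarz–Pick: the step is multiplication by `z` followed by a disk
automorphism, which preserves `|u - v|² / ((1 - |u|²)(1 - |v|²))`. Denominators are cleared, so that
points of the circle are allowed. -/
theorem norm_sq_schurStep_sub {α z w w' : ℂ} (hα : ‖α‖ < 1) (hz : ‖z‖ ≤ 1) (hw : ‖w‖ ≤ 1)
    (hw' : ‖w'‖ ≤ 1) :
    ‖schurStep α z w - schurStep α z w'‖ ^ 2 * ((1 - ‖z * w‖ ^ 2) * (1 - ‖z * w'‖ ^ 2)) =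
      ‖z‖ ^ 2 * ‖w - w'‖ ^ 2 *
        ((1 - ‖schurStep α z w‖ ^ 2) * (1 - ‖schurStep α z w'‖ ^ 2)) := by
  have h := schurStep_denom_ne_zero hα hz hw
  have h' := schurStep_denom_ne_zero hα hz hw'
  rw [one_sub_norm_sq_schurStep h, one_sub_norm_sq_schurStep h']
  have h1 : schurStep α z w - schurStep α z w' =
      ((1 - ‖α‖ ^ 2 : ℝ) : ℂ) * (z * (w - w')) / ((1 - α * z * w) * (1 - α * z * w')) := by
    rw [schurStep, schurStep, div_sub_div _ _ h h']
    congr 1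
    push_cast
    rw [← Complex.mul_conj']
    ring
  have hn := norm_ne_zero_iff.2 h
  have hn' := norm_ne_zero_iff.2 h'
  rw [h1, norm_div, norm_mul, norm_mul, norm_mul, Complex.norm_real,
    Real.norm_of_nonneg (one_sub_norm_sq_pos hα).le]
  field_simp

/-- The hyperbolic quantity shrinks by `|z|²` at each step. It is infinite for starts on the circle,
such as `w = 1`; one step is spent to enter the open disk, which accounts for `n + 1` and for the
constant. -/
theorem norm_sq_schurIterate_sub_le {α : ℕ → ℂ} (hα : ∀ n, ‖α n‖ < 1) {r : ℝ} (hr : r < 1)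
    {z w w' : ℂ} (hz : ‖z‖ ≤ r) (hw : ‖w‖ ≤ 1) (hw' : ‖w'‖ ≤ 1) (n : ℕ) :
    ‖schurIterate α z w (n + 1) - schurIterate α z w' (n + 1)‖ ^ 2 ≤
      4 / (1 - r ^ 2) ^ 2 * (r ^ 2) ^ n := by
  have hr0 : 0 ≤ r := (norm_nonneg z).trans hz
  have hz1 : ‖z‖ < 1 := hz.trans_lt hr
  have hr2 : 0 < 1 - r ^ 2 := by nlinarith
  have hzr : ‖z‖ ^ 2 ≤ r ^ 2 := by gcongr
  have hzw : ∀ {v : ℂ}, ‖v‖ ≤ 1 → 1 - r ^ 2 ≤ 1 - ‖z * v‖ ^ 2 := fun {v} hv => by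
    have : ‖z * v‖ ≤ r := by
      rw [norm_mul]
      exact (mul_le_of_le_one_right (norm_nonneg _) hv).trans hz
    have : ‖z * v‖ ^ 2 ≤ r ^ 2 := by gcongr
    linarith
  -- The induction needs the hyperbolic form; the Euclidean distance alone need not contract.
  suffices h : ‖schurIterate α z w (n + 1) - schurIterate α z w' (n + 1)‖ ^ 2 ≤
      4 / (1 - r ^ 2) ^ 2 * (r ^ 2) ^ n *
        ((1 - ‖schurIterate α z w (n + 1)‖ ^ 2) * (1 - ‖schurIterate α z w' (n + 1)‖ ^ 2)) by
    refine h.trans (mul_le_of_le_one_right (by positivity) ?_)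
    have h1 := one_sub_norm_sq_pos (norm_schurIterate_succ_lt hα hz1 hw n)
    have h2 := one_sub_norm_sq_pos (norm_schurIterate_succ_lt hα hz1 hw' n)
    exact mul_le_one₀ (by linarith [sq_nonneg ‖schurIterate α z w (n + 1)‖]) h2.le
      (by linarith [sq_nonneg ‖schurIterate α z w' (n + 1)‖])
  induction n with
  | zero =>
    have h := norm_sq_schurStep_sub (hα 0) hz1.le hw hw'
    have h1 := one_sub_norm_sq_pos (norm_schurStep_lt (hα 0) hz1 hw)
    have h2 := one_sub_norm_sq_pos (norm_schurStep_lt (hα 0) hz1 hw')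
    simp only [schurIterate, pow_zero, mul_one]
    set A := ‖schurStep (α 0) z w - schurStep (α 0) z w'‖ ^ 2
    set B := (1 - ‖schurStep (α 0) z w‖ ^ 2) * (1 - ‖schurStep (α 0) z w'‖ ^ 2)
    have hB : 0 < B := mul_pos h1 h2
    rw [div_mul_eq_mul_div, le_div_iff₀ (by positivity)]
    have h3 : (1 - r ^ 2) ^ 2 ≤ (1 - ‖z * w‖ ^ 2) * (1 - ‖z * w'‖ ^ 2) := by
      rw [sq]
      exact mul_le_mul (hzw hw) (hzw hw') hr2.le (hr2.le.trans (hzw hw))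
    have h4 : ‖w - w'‖ ≤ 2 := (norm_sub_le _ _).trans (by linarith)
    have h5 : ‖z‖ ^ 2 * ‖w - w'‖ ^ 2 ≤ 4 := by
      have : ‖w - w'‖ ^ 2 ≤ 2 ^ 2 := by gcongr
      have h6 : ‖z‖ ^ 2 ≤ 1 := by nlinarith [norm_nonneg z]
      nlinarith [sq_nonneg ‖w - w'‖, sq_nonneg ‖z‖]
    calc A * (1 - r ^ 2) ^ 2 ≤ A * ((1 - ‖z * w‖ ^ 2) * (1 - ‖z * w'‖ ^ 2)) := by gcongr
      _ = ‖z‖ ^ 2 * ‖w - w'‖ ^ 2 * B := h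
      _ ≤ 4 * B := by gcongr
  | succ n ih =>
    rw [schurIterate, schurIterate.eq_2 α z w' (n + 1)]
    set v := schurIterate α z w (n + 1)
    set v' := schurIterate α z w' (n + 1)
    have hv : ‖v‖ < 1 := norm_schurIterate_succ_lt hα hz1 hw n
    have hv' : ‖v'‖ < 1 := norm_schurIterate_succ_lt hα hz1 hw' n
    have h := norm_sq_schurStep_sub (hα (n + 1)) hz1.le hv.le hv'.le
    have h1 := one_sub_norm_sq_pos (norm_schurStep_lt (hα (n + 1)) hz1 hv.le)
    have h2 := one_sub_norm_sq_pos (norm_schurStep_lt (hα (n + 1)) hz1 hv'.le)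
    set A := ‖schurStep (α (n + 1)) z v - schurStep (α (n + 1)) z v'‖ ^ 2
    set B := (1 - ‖schurStep (α (n + 1)) z v‖ ^ 2) * (1 - ‖schurStep (α (n + 1)) z v'‖ ^ 2)
    have hB : 0 < B := mul_pos h1 h2
    have hle : ∀ {u : ℂ}, 1 - ‖u‖ ^ 2 ≤ 1 - ‖z * u‖ ^ 2 := fun {u} => by
      have : ‖z * u‖ ≤ ‖u‖ := by
        rw [norm_mul]
        exact mul_le_of_le_one_left (norm_nonneg _) hz1.le
      have : ‖z * u‖ ^ 2 ≤ ‖u‖ ^ 2 := by gcongr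
      linarith
    have e1 := one_sub_norm_sq_pos hv
    have e2 := one_sub_norm_sq_pos hv'
    have hE : 0 < (1 - ‖v‖ ^ 2) * (1 - ‖v'‖ ^ 2) := mul_pos e1 e2
    refine le_of_mul_le_mul_right ?_ hE
    calc A * ((1 - ‖v‖ ^ 2) * (1 - ‖v'‖ ^ 2))
        ≤ A * ((1 - ‖z * v‖ ^ 2) * (1 - ‖z * v'‖ ^ 2)) := by
          refine mul_le_mul_of_nonneg_left ?_ (by positivity)
          exact mul_le_mul hle hle e2.le (e1.le.trans hle)
      _ = ‖z‖ ^ 2 * ‖v - v'‖ ^ 2 * B := h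
      _ ≤ r ^ 2 * (4 / (1 - r ^ 2) ^ 2 * (r ^ 2) ^ n * ((1 - ‖v‖ ^ 2) * (1 - ‖v'‖ ^ 2))) * B := by
          gcongr
      _ = 4 / (1 - r ^ 2) ^ 2 * (r ^ 2) ^ (n + 1) * B * ((1 - ‖v‖ ^ 2) * (1 - ‖v'‖ ^ 2)) := by
          ring

theorem norm_schurStep_sub_le {a α z w w' : ℂ} {r : ℝ} (hr : r < 1) (ha : ‖a‖ < 1)
    (hα : ‖α‖ < 1) (hz : ‖z‖ ≤ r) (hw : ‖w‖ ≤ 1) (hw' : ‖w'‖ ≤ 1) :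
    ‖schurStep a z w - schurStep α z w'‖ ≤
      (2 * ‖w - w'‖ + 4 * ‖a - α‖) / (1 - r) ^ 2 := by
  have hz1 : ‖z‖ < 1 := hz.trans_lt hr
  have h := schurStep_denom_ne_zero ha hz1.le hw
  have h' := schurStep_denom_ne_zero hα hz1.le hw'
  -- Over the common denominator each term of the numerator carries a factor `w - w'` or a
  -- difference of the coefficients.
  have h1 : schurStep a z w - schurStep α z w' =
      ((1 - starRingEnd ℂ a * α) * (z * (w - w')) + starRingEnd ℂ (α - a) +
        (starRingEnd ℂ a * (α - a) + a * starRingEnd ℂ (a - α)) * (z * w) +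
        (z * w) * (z * w') * (a - α)) / ((1 - a * z * w) * (1 - α * z * w')) := by
    rw [schurStep, schurStep, div_sub_div _ _ h h']
    congr 1
    simp only [map_sub]
    ring
  have h2 : (1 - r) ^ 2 ≤ ‖(1 - a * z * w) * (1 - α * z * w')‖ := by
    rw [norm_mul, sq]
    have e1 := one_sub_norm_le' (z := z) ha.le hw
    have e2 := one_sub_norm_le' (z := z) hα.le hw'
    exact mul_le_mul (by linarith) (by linarith) (by linarith) (norm_nonneg _)
  have hzw := norm_mul_le_one hz1.le hw
  have hzw' := norm_mul_le_one hz1.le hw'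
  have e : ‖α - a‖ = ‖a - α‖ := norm_sub_rev _ _
  have h3 : ‖(1 - starRingEnd ℂ a * α) * (z * (w - w'))‖ ≤ 2 * ‖w - w'‖ := by
    rw [norm_mul, norm_mul]
    have : ‖1 - starRingEnd ℂ a * α‖ ≤ 2 := by
      refine (norm_sub_le _ _).trans ?_
      rw [norm_one, norm_mul, RCLike.norm_conj]
      nlinarith [norm_nonneg a, norm_nonneg α]
    have h5 : ‖z‖ * ‖w - w'‖ ≤ ‖w - w'‖ := mul_le_of_le_one_left (norm_nonneg _) hz1.le
    gcongr
  have h4 : ‖(starRingEnd ℂ a * (α - a) + a * starRingEnd ℂ (a - α)) * (z * w)‖ ≤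
      2 * ‖a - α‖ := by
    rw [norm_mul]
    have : ‖starRingEnd ℂ a * (α - a) + a * starRingEnd ℂ (a - α)‖ ≤ 2 * ‖a - α‖ := by
      refine (norm_add_le _ _).trans ?_
      rw [norm_mul, norm_mul, RCLike.norm_conj, RCLike.norm_conj, e]
      nlinarith [norm_nonneg a, norm_nonneg (a - α)]
    nlinarith [norm_nonneg (z * w), norm_nonneg (a - α)]
  have h5 : ‖(z * w) * (z * w') * (a - α)‖ ≤ ‖a - α‖ := by
    rw [norm_mul, norm_mul]
    exact mul_le_of_le_one_left (norm_nonneg _) (mul_le_one₀ hzw (norm_nonneg _) hzw')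
  have h6 : 0 < (1 - r) ^ 2 := by have : 0 < 1 - r := sub_pos.2 hr; positivity
  rw [h1, norm_div]
  refine div_le_div₀ (by positivity) ?_ h6 h2
  refine (norm_add_le _ _).trans (add_le_add ((norm_add_le _ _).trans (add_le_add
    ((norm_add_le _ _).trans (add_le_add h3 (RCLike.norm_conj _).le)) h4)) h5) |>.trans ?_
  linarith

theorem exists_schurIterate_perturb {r : ℝ} (hr : r < 1) (m : ℕ) {ε : ℝ} (hε : 0 < ε) :
    ∃ η > 0, ∀ a α : ℕ → ℂ, (∀ n, ‖a n‖ < 1) → (∀ n, ‖α n‖ < 1) →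
      (∀ j < m, ‖a j - α j‖ < η) → ∀ z w : ℂ, ‖z‖ ≤ r → ‖w‖ ≤ 1 →
        ‖schurIterate a z w m - schurIterate α z w m‖ < ε := by
  induction m generalizing ε with
  | zero => exact ⟨1, one_pos, fun a α _ _ _ z w _ _ => by simpa [schurIterate] using hε⟩
  | succ m ih =>
    have h1 : 0 < (1 - r) ^ 2 := by have : 0 < 1 - r := sub_pos.2 hr; positivity
    -- The shares fit the Lipschitz bound of one step: `2 · (1/4) + 4 · (1/8) = 1`.
    obtain ⟨η, hη, h⟩ := ih (ε := ε * (1 - r) ^ 2 / 4) (by positivity)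
    refine ⟨min η (ε * (1 - r) ^ 2 / 8), lt_min hη (by positivity), ?_⟩
    intro a α ha hα hj z w hz hw
    have hz1 : ‖z‖ ≤ 1 := hz.trans hr.le
    have h2 := h a α ha hα (fun j hjm => (hj j (by omega)).trans_le (min_le_left _ _)) z w hz hw
    have h3 := (hj m (by omega)).trans_le (min_le_right _ _)
    rw [schurIterate, schurIterate]
    refine (norm_schurStep_sub_le hr (ha m) (hα m) hz (norm_schurIterate_le ha hz1 hw m)
      (norm_schurIterate_le hα hz1 hw m)).trans_lt ?_
    rw [div_lt_iff₀ h1]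
    linarith

/-- After sufficiently many steps, the Schur algorithm forgets its start, uniformly on smaller
disks, and depends only on the last coefficients. -/
theorem exists_schurIterate_sub_lt {r : ℝ} (hr : r < 1) {ε : ℝ} (hε : 0 < ε) :
    ∃ m : ℕ, ∃ η > 0, ∀ a α : ℕ → ℂ, (∀ n, ‖a n‖ < 1) → (∀ n, ‖α n‖ < 1) →
      (∀ j < m, ‖a j - α j‖ < η) → ∀ z w w' : ℂ, ‖z‖ ≤ r → ‖w‖ ≤ 1 → ‖w'‖ ≤ 1 →
        ‖schurIterate a z w m - schurIterate α z w' m‖ < ε := by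
  by_cases hr0 : r < 0
  · exact ⟨0, 1, one_pos, fun a α _ _ _ z w w' hz => by linarith [norm_nonneg z]⟩
  have hr2 : r ^ 2 < 1 := by nlinarith
  have ht : Tendsto (fun n : ℕ => 4 / (1 - r ^ 2) ^ 2 * (r ^ 2) ^ n) atTop (𝓝 0) := by
    simpa using (tendsto_pow_atTop_nhds_zero_of_lt_one (sq_nonneg r) hr2).const_mul
      (4 / (1 - r ^ 2) ^ 2)
  obtain ⟨n, hn⟩ := (ht.eventually (gt_mem_nhds (show 0 < (ε / 2) ^ 2 by positivity))).exists
  obtain ⟨η, hη, h⟩ := exists_schurIterate_perturb hr (n + 1) (half_pos hε)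
  refine ⟨n + 1, η, hη, fun a α ha hα hj z w w' hz hw hw' => ?_⟩
  have h1 := h a α ha hα hj z w hz hw
  have h2 : ‖schurIterate α z w (n + 1) - schurIterate α z w' (n + 1)‖ < ε / 2 :=
    lt_of_pow_lt_pow_left₀ 2 (half_pos hε).le
      ((norm_sq_schurIterate_sub_le hα hr hz hw hw' n).trans_lt hn)
  have h3 := norm_add_le (schurIterate a z w (n + 1) - schurIterate α z w (n + 1))
    (schurIterate α z w (n + 1) - schurIterate α z w' (n + 1))
  rw [sub_add_sub_cancel] at h3
  linarith

/-! ### The Schur functions of a periodic sequence -/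

/-- For a `p`-periodic sequence `α`, the limit of `Φ_{n + kp} / Φ_{n + kp}^*` as `k → ∞`. This is
the Schur function with Verblunsky coefficients `-conj α_{n-1}, -conj α_{n-2}, …`. -/
def periodicSchur (p : ℕ) (α : ℕ → ℂ) (z : ℂ) (n : ℕ) : ℂ :=
  limUnder atTop fun k => schurIterate α z 1 (n + k * p)

section Periodic

variable {p : ℕ} {α : ℕ → ℂ}

/-- Cauchy, since by periodicity the last `m` coefficients before `n + kp` do not depend on `k` once
`k ≥ m`, and the earlier ones are forgotten. -/
theorem tendsto_periodicSchur (hp : 0 < p) (hα : ∀ n, ‖α n‖ < 1) (hper : Function.Periodic α p)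
    {z : ℂ} (hz : ‖z‖ < 1) (n : ℕ) :
    Tendsto (fun k => schurIterate α z 1 (n + k * p)) atTop (𝓝 (periodicSchur p α z n)) := by
  refine CauchySeq.tendsto_limUnder (Metric.cauchySeq_iff'.2 fun ε hε => ?_)
  obtain ⟨m, η, hη, h⟩ := exists_schurIterate_sub_lt hz hε
  refine ⟨m, fun k hk => ?_⟩
  have hm : m ≤ m * p := Nat.le_mul_of_pos_right m hp
  have hkm : m * p ≤ k * p := Nat.mul_le_mul_right p hk
  obtain ⟨i, hi⟩ : ∃ i, n + m * p = i + m := ⟨n + m * p - m, by omega⟩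
  have hi' : n + k * p = (i + (k - m) * p) + m := by
    rw [Nat.sub_mul]
    omega
  rw [dist_eq_norm, hi, hi', schurIterate_add, schurIterate_add α z 1 i m]
  refine h _ _ (fun _ => hα _) (fun _ => hα _) (fun j _ => ?_) z _ _ le_rfl
    (norm_schurIterate_le hα hz.le norm_one.le _) (norm_schurIterate_le hα hz.le norm_one.le _)
  have : α (i + (k - m) * p + j) = α (i + j) := by
    rw [add_right_comm]
    exact hper.nat_mul (k - m) (i + j)
  simpa [this] using hη

theorem norm_periodicSchur_le (hp : 0 < p) (hα : ∀ n, ‖α n‖ < 1) (hper : Function.Periodic α p)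
    {z : ℂ} (hz : ‖z‖ < 1) (n : ℕ) : ‖periodicSchur p α z n‖ ≤ 1 :=
  le_of_tendsto (tendsto_periodicSchur hp hα hper hz n).norm
    (Eventually.of_forall fun _ => norm_schurIterate_le hα hz.le norm_one.le _)

theorem periodicSchur_succ (hp : 0 < p) (hα : ∀ n, ‖α n‖ < 1) (hper : Function.Periodic α p)
    {z : ℂ} (hz : ‖z‖ < 1) (n : ℕ) :
    periodicSchur p α z (n + 1) = schurStep (α n) z (periodicSchur p α z n) := by
  refine tendsto_nhds_unique (tendsto_periodicSchur hp hα hper hz (n + 1)) ?_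
  have h := tendsto_periodicSchur hp hα hper hz n
  have h0 := schurStep_denom_ne_zero (hα n) hz.le (norm_periodicSchur_le hp hα hper hz n)
  have h1 : Tendsto (fun k => schurStep (α n) z (schurIterate α z 1 (n + k * p))) atTop
      (𝓝 (schurStep (α n) z (periodicSchur p α z n))) :=
    ((h.const_mul z).sub_const _).div ((h.const_mul (α n * z)).const_sub 1) h0
  refine h1.congr fun k => ?_
  rw [add_right_comm, schurIterate]
  congr 1
  exact (hper.nat_mul k n).symm

theorem norm_periodicSchur_lt (hp : 0 < p) (hα : ∀ n, ‖α n‖ < 1) (hper : Function.Periodic α p)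
    {z : ℂ} (hz : ‖z‖ < 1) (n : ℕ) : ‖periodicSchur p α z (n + 1)‖ < 1 := by
  rw [periodicSchur_succ hp hα hper hz]
  exact norm_schurStep_lt (hα n) hz (norm_periodicSchur_le hp hα hper hz n)

theorem periodic_periodicSchur (hp : 0 < p) (hα : ∀ n, ‖α n‖ < 1) (hper : Function.Periodic α p)
    {z : ℂ} (hz : ‖z‖ < 1) : Function.Periodic (periodicSchur p α z) p := by
  intro n
  refine tendsto_nhds_unique (tendsto_periodicSchur hp hα hper hz (n + p)) ?_
  refine ((tendsto_periodicSchur hp hα hper hz n).comp (tendsto_add_atTop_nat 1)).congr fun k => ?_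
  simp only [Function.comp]
  congr 1
  ring

theorem periodicSchur_add (hp : 0 < p) (hα : ∀ n, ‖α n‖ < 1) (hper : Function.Periodic α p)
    {z : ℂ} (hz : ‖z‖ < 1) (n m : ℕ) :
    periodicSchur p α z (n + m) =
      schurIterate (fun j => α (n + j)) z (periodicSchur p α z n) m := by
  induction m with
  | zero => rfl
  | succ m ih => rw [← add_assoc, periodicSchur_succ hp hα hper hz, ih, schurIterate]

theorem conj_periodicSchur (hp : 0 < p) (hα : ∀ n, ‖α n‖ < 1) (hper : Function.Periodic α p)
    {z : ℂ} (hz : ‖z‖ < 1) (n : ℕ) :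
    starRingEnd ℂ (periodicSchur p α z n) =
      periodicSchur p (fun j => starRingEnd ℂ (α j)) (starRingEnd ℂ z) n := by
  have h := (Complex.continuous_conj.tendsto _).comp (tendsto_periodicSchur hp hα hper hz n)
  rw [← h.limUnder_eq, periodicSchur]
  congr 1
  ext k
  rw [Function.comp, conj_schurIterate, map_one]

/-- If the last coefficients of `a` are close to those of `α`, then the ratio `Φ_n / Φ_n^*` of `a`
is close to the periodic Schur function. -/
theorem exists_schurIterate_sub_periodicSchur_lt (hp : 0 < p) (hα : ∀ n, ‖α n‖ < 1)
    (hper : Function.Periodic α p) {r : ℝ} (hr : r < 1) {ε : ℝ} (hε : 0 < ε) :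
    ∃ m : ℕ, ∃ η > 0, ∀ a : ℕ → ℂ, (∀ n, ‖a n‖ < 1) → ∀ n, m ≤ n →
      (∀ j < m, ‖a (n - m + j) - α (n - m + j)‖ < η) → ∀ z : ℂ, ‖z‖ ≤ r →
        ‖schurIterate a z 1 n - periodicSchur p α z n‖ < ε := by
  obtain ⟨m, η, hη, h⟩ := exists_schurIterate_sub_lt hr hε
  refine ⟨m, η, hη, fun a ha n hn hj z hz => ?_⟩
  have hz1 : ‖z‖ < 1 := hz.trans_lt hr
  obtain ⟨i, rfl⟩ : ∃ i, n = i + m := ⟨n - m, by omega⟩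
  rw [Nat.add_sub_cancel] at hj
  rw [schurIterate_add, periodicSchur_add hp hα hper hz1]
  exact h _ _ (fun _ => ha _) (fun _ => hα _) hj z _ _ hz
    (norm_schurIterate_le ha hz1.le norm_one.le _) (norm_periodicSchur_le hp hα hper hz1 _)

end Periodic

/-! ### The resolvent of the CMV operator -/

theorem adjoint_pairOp (σ : ℕ → ℕ) (hσ : Function.Involutive σ) (d o : ℕ → ℂ)
    (hd : ∀ i, ‖d i‖ ≤ 1) (ho : ∀ i, ‖o i‖ ≤ 1) (hreal : ∀ i, starRingEnd ℂ (o i) = o i)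
    (hoσ : ∀ i, o (σ i) = o i) :
    star (pairOp σ hσ d o hd ho) =
      pairOp σ hσ (fun i => starRingEnd ℂ (d i)) o (fun i => by simpa using hd i) ho := by
  symm
  rw [ContinuousLinearMap.star_eq_adjoint, ContinuousLinearMap.eq_adjoint_iff]
  intro x y
  have hs : ∀ (c : ℕ → ℂ), (∀ i, ‖c i‖ ≤ 1) → ∀ (x y : ℕ → ℂ), (Summable fun i => ‖x i‖ ^ 2) →
      (Summable fun i => ‖y i‖ ^ 2) → Summable fun i => c i * (y i * starRingEnd ℂ (x i)) := by
    intro c hc x y hx hy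
    refine Summable.of_norm_bounded (hx.add hy) fun i => ?_
    rw [norm_mul, norm_mul, RCLike.norm_conj]
    have h1 : ‖c i‖ * (‖y i‖ * ‖x i‖) ≤ ‖y i‖ * ‖x i‖ :=
      mul_le_of_le_one_left (by positivity) (hc i)
    nlinarith [sq_nonneg (‖x i‖ - ‖y i‖), sq_nonneg ‖x i‖, sq_nonneg ‖y i‖]
  rw [lp.inner_eq_tsum, lp.inner_eq_tsum]
  simp only [pairOp_apply, RCLike.inner_apply, map_add, map_mul, Complex.conj_conj, hreal]
  have hx := summable_norm_sq x
  have hy := summable_norm_sq y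
  have hxσ := summable_norm_sq_comp x hσ
  have hyσ := summable_norm_sq_comp y hσ
  have e1 : ∀ i, y i * (d i * starRingEnd ℂ (x i) + o i * starRingEnd ℂ (x (σ i))) =
      d i * (y i * starRingEnd ℂ (x i)) + o i * (y i * starRingEnd ℂ (x (σ i))) := fun i => by ring
  have e2 : ∀ i, (d i * y i + o i * y (σ i)) * starRingEnd ℂ (x i) =
      d i * (y i * starRingEnd ℂ (x i)) + o i * (y (σ i) * starRingEnd ℂ (x i)) := fun i => by ring
  simp only [e1, e2]
  rw [(hs d hd _ _ hx hy).tsum_add (hs o ho _ _ hxσ hy),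
    (hs d hd _ _ hx hy).tsum_add (hs o ho _ _ hx hyσ)]
  congr 1
  rw [← (hσ.toPerm σ).tsum_eq (fun i => o i * (y i * starRingEnd ℂ (x (σ i))))]
  refine tsum_congr fun i => ?_
  simp only [Function.Involutive.coe_toPerm]
  rw [hσ i, hoσ i]

/-- `hone` and `hzero` say that each block of the involution is unitary. The factor `o i` in `hzero`
makes the condition void at a fixed point with zero off-diagonal entry, as at the index `0` of
`oddPartner`. -/
theorem pairOp_mem_unitary (σ : ℕ → ℕ) (hσ : Function.Involutive σ) (d o : ℕ → ℂ)
    (hd : ∀ i, ‖d i‖ ≤ 1) (ho : ∀ i, ‖o i‖ ≤ 1) (hreal : ∀ i, starRingEnd ℂ (o i) = o i)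
    (hoσ : ∀ i, o (σ i) = o i) (hone : ∀ i, d i * starRingEnd ℂ (d i) + o i * o i = 1)
    (hzero : ∀ i, o i * (starRingEnd ℂ (d i) + d (σ i)) = 0) :
    pairOp σ hσ d o hd ho ∈ unitary (EllTwo →L[ℂ] EllTwo) := by
  rw [Unitary.mem_iff, adjoint_pairOp σ hσ d o hd ho hreal hoσ]
  have hzero' : ∀ i, o i * (d i + starRingEnd ℂ (d (σ i))) = 0 := fun i => by
    have := hzero (σ i)
    rw [hoσ, hσ] at this
    linear_combination this
  constructor
  · ext x i
    simp only [mul_apply_eq_comp, one_apply_eq_self, pairOp_apply, hσ i,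
      hoσ]
    linear_combination x i * hone i + x (σ i) * hzero i
  · ext x i
    simp only [mul_apply_eq_comp, one_apply_eq_self, pairOp_apply, hσ i,
      hoσ]
    linear_combination x i * hone i + x (σ i) * hzero' i

theorem rho_mul_rho {α : ℂ} (hα : ‖α‖ < 1) :
    (rho α : ℂ) * rho α = 1 - α * starRingEnd ℂ α := by
  rw [← Complex.ofReal_mul, rho, Real.mul_self_sqrt (one_sub_norm_sq_pos hα).le, Complex.mul_conj']
  push_cast
  rfl

theorem rho_pos {α : ℂ} (hα : ‖α‖ < 1) : 0 < rho α :=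
  Real.sqrt_pos.2 (one_sub_norm_sq_pos hα)

theorem rho_sq {α : ℂ} (hα : ‖α‖ < 1) : rho α ^ 2 = 1 - ‖α‖ ^ 2 :=
  Real.sq_sqrt (one_sub_norm_sq_pos hα).le

theorem cmv_mem_unitary (γ : ℕ → ℂ) (hγ : ∀ n, ‖γ n‖ < 1) :
    cmv γ hγ ∈ unitary (EllTwo →L[ℂ] EllTwo) := by
  refine mul_mem (pairOp_mem_unitary _ _ _ _ _ _ ?_ ?_ ?_ ?_)
    (pairOp_mem_unitary _ _ _ _ _ _ ?_ ?_ ?_ ?_)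
  · intro i
    unfold evenOff
    split_ifs <;> simp
  · intro i
    by_cases h : Even i
    · have h' : ¬ Even (i + 1) := by simpa [Nat.even_add_one] using h
      simp [evenOff, evenPartner, h, h']
    · have h' : Even (i - 1) := by grind
      simp [evenOff, evenPartner, h, h']
  · intro i
    unfold evenDiag evenOff
    split_ifs
    · rw [rho_mul_rho (hγ i), Complex.conj_conj]; ring
    · rw [rho_mul_rho (hγ _), map_neg]; ring
  · intro i
    by_cases h : Even i
    · have h' : ¬ Even (i + 1) := by simpa [Nat.even_add_one] using h
      simp [evenDiag, evenPartner, h, h']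
    · have h' : Even (i - 1) := by grind
      simp [evenDiag, evenPartner, h, h']
  · intro i
    unfold oddOff
    split_ifs <;> simp
  · intro i
    rcases i with _ | i
    · rfl
    by_cases h : Odd (i + 1)
    · have h' : ¬ Odd (i + 1 + 1) := by simpa [Nat.odd_add_one] using h
      simp [oddOff, oddPartner, h, h']
    · have h' : Odd i := by grind
      have h'' : i ≠ 0 := by grind
      simp [oddOff, oddPartner, h, h', h'']
  · intro i
    unfold oddDiag oddOff
    split_ifs
    · simp
    · rw [rho_mul_rho (hγ i), Complex.conj_conj]; ring
    · rw [rho_mul_rho (hγ _), map_neg]; ring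
  · intro i
    rcases i with _ | i
    · simp [oddOff]
    by_cases h : Odd (i + 1)
    · have h' : ¬ Odd (i + 1 + 1) := by simpa [Nat.odd_add_one] using h
      simp [oddDiag, oddPartner, h, h']
    · have h' : Odd i := by grind
      have h'' : i ≠ 0 := by grind
      simp [oddDiag, oddPartner, h, h', h'']

/-! ### Carathéodory and Schur functions of CMV operators through the Schur algorithm -/

theorem inner_e₀ (x : EllTwo) : inner ℂ e₀ x = x 0 := by
  rw [e₀, lp.inner_single_left]
  simp

theorem e₀_zero : e₀ 0 = 1 := by
  rw [e₀, lp.single_apply_self]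

theorem e₀_succ (n : ℕ) : e₀ (n + 1) = 0 :=
  lp.single_apply_ne _ _ _ (by simp)

section Caratheodory

variable {γ : ℕ → ℂ} (hγ : ∀ n, ‖γ n‖ < 1)
include hγ

theorem isUnit_cmv_sub {z : ℂ} (hz : ‖z‖ ≠ 1) :
    IsUnit (cmv γ hγ - z • (1 : EllTwo →L[ℂ] EllTwo)) := by
  have h : z ∉ spectrum ℂ (cmv γ hγ) := fun h => hz (by
    simpa using spectrum.subset_circle_of_unitary (cmv_mem_unitary γ hγ) h)
  rw [spectrum.notMem_iff, Algebra.algebraMap_eq_smul_one] at h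
  rw [← neg_sub]
  exact h.neg

theorem exists_resolvent {z : ℂ} (hz : ‖z‖ ≠ 1) :
    ∃ x : EllTwo, cmv γ hγ x - z • x = e₀ ∧
      caratheodory γ hγ z = inner ℂ e₀ (cmv γ hγ x + z • x) := by
  refine ⟨Ring.inverse (cmv γ hγ - z • (1 : EllTwo →L[ℂ] EllTwo)) e₀, ?_, rfl⟩
  have := Ring.mul_inverse_cancel _ (isUnit_cmv_sub hγ hz)
  exact congrArg (fun T : EllTwo →L[ℂ] EllTwo => T e₀) this

theorem caratheodory_eq_of_resolvent {z : ℂ} (hz : ‖z‖ ≠ 1) {x : EllTwo}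
    (hx : cmv γ hγ x - z • x = e₀) :
    caratheodory γ hγ z = inner ℂ e₀ (cmv γ hγ x + z • x) := by
  have h := Ring.inverse_mul_cancel _ (isUnit_cmv_sub hγ hz)
  have h1 := congrArg (fun T : EllTwo →L[ℂ] EllTwo => T x) h
  have h2 : (cmv γ hγ - z • (1 : EllTwo →L[ℂ] EllTwo)) x = e₀ := hx
  simp only [mul_apply_eq_comp, h2, one_apply_eq_self] at h1
  rw [caratheodory, mul_apply_eq_comp, h1]
  rfl

theorem caratheodory_eq_add {z : ℂ} (hz : ‖z‖ ≠ 1) {x : EllTwo}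
    (hx : cmv γ hγ x - z • x = e₀) : caratheodory γ hγ z = 1 + 2 * z * x 0 := by
  rw [caratheodory_eq_of_resolvent hγ hz hx, sub_eq_iff_eq_add.1 hx, inner_e₀]
  simp only [lp.coeFn_add, lp.coeFn_smul, Pi.add_apply, Pi.smul_apply, smul_eq_mul, e₀_zero]
  ring

/-- The symmetry `F(z) = -conj F(1 / conj z)` of the Carathéodory function. -/
theorem caratheodory_reflect {z : ℂ} (hz0 : z ≠ 0) (hz : ‖z‖ ≠ 1) :
    caratheodory γ hγ z = -starRingEnd ℂ (caratheodory γ hγ (starRingEnd ℂ z)⁻¹) := by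
  set w := (starRingEnd ℂ z)⁻¹ with hw
  have hw1 : ‖w‖ ≠ 1 := by
    rw [hw, norm_inv, RCLike.norm_conj]
    simpa using hz
  obtain ⟨y, hy, hFz⟩ := exists_resolvent hγ hz
  obtain ⟨x, hx, hFw⟩ := exists_resolvent hγ hw1
  have hU := cmv_mem_unitary γ hγ
  set U := cmv γ hγ
  have hU1 : ∀ v v' : EllTwo, inner ℂ (U v) (U v') = inner ℂ v v' := by
    intro v v'
    rw [← ContinuousLinearMap.adjoint_inner_right, ← ContinuousLinearMap.star_eq_adjoint,
      ← mul_apply_eq_comp, hU.1, one_apply_eq_self]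
  have hzw : z * starRingEnd ℂ w = 1 := by
    rw [hw, map_inv₀, Complex.conj_conj, mul_inv_cancel₀ hz0]
  have e1 : inner ℂ e₀ (U y + z • y) = inner ℂ (U x - w • x) (U y + z • y) := by rw [hx]
  have e2 : starRingEnd ℂ (inner ℂ e₀ (U x + w • x)) = inner ℂ (U x + w • x) (U y - z • y) := by
    rw [inner_conj_symm, hy]
  rw [hFz, hFw, e1, e2]
  simp only [inner_sub_left, inner_add_right, inner_add_left, inner_sub_right, hU1,
    inner_smul_left, inner_smul_right]
  linear_combination (-2 * inner ℂ x y) * hzw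

/-- A bounded solution `φ` of the Schur algorithm yields an explicit square summable solution of `(𝒞
- z) u = e₀`, and `F(z) = 1 + 2 z u_0`. Since the resolvent is unique, no further information on `φ`
is needed. -/
theorem caratheodory_eq_of_schur {z : ℂ} (hz0 : z ≠ 0) (hz : ‖z‖ < 1) {φ : ℕ → ℂ}
    (hφ1 : ∀ n, ‖φ n‖ ≤ 1) (hφ : ∀ n, φ n = schurStep (-starRingEnd ℂ (γ n)) z (φ (n + 1))) :
    caratheodory γ hγ z = (1 + z * φ 0) / (1 - z * φ 0) := by
  have hγ' : ∀ n, ‖-starRingEnd ℂ (γ n)‖ < 1 := fun n => by simpa using hγ n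
  have hD : ∀ n, 1 + starRingEnd ℂ (γ n) * z * φ (n + 1) ≠ 0 := fun n => by
    simpa using schurStep_denom_ne_zero (hγ' n) hz.le (hφ1 (n + 1))
  have h0 : 1 - z * φ 0 ≠ 0 := by
    have := one_sub_norm_le' (α := 1) (z := z) norm_one.le (hφ1 0)
    rw [one_mul] at this
    exact norm_pos_iff.1 ((sub_pos.2 hz).trans_le this)
  -- the Weyl solution
  let y : ℕ → ℂ → ℂ := fun n w => rho (γ n) * w / (1 + starRingEnd ℂ (γ n) * z * φ (n + 1))
  let w : ℕ → ℂ := fun n => Nat.rec (1 / (1 - z * φ 0))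
    (fun n w => (if Even n then 1 else z) * y n w) n
  have hw0 : w 0 = 1 / (1 - z * φ 0) := rfl
  have hws : ∀ n, w (n + 1) = (if Even n then 1 else z) * y n (w n) := fun n => rfl
  have hyD : ∀ n v, y n v * (1 + starRingEnd ℂ (γ n) * z * φ (n + 1)) = rho (γ n) * v :=
    fun n v => div_mul_cancel₀ _ (hD n)
  have hφD : ∀ n, φ n * (1 + starRingEnd ℂ (γ n) * z * φ (n + 1)) = γ n + z * φ (n + 1) := by
    intro n
    conv_lhs => rw [hφ n]
    rw [schurStep]
    simp only [map_neg, Complex.conj_conj, sub_neg_eq_add, neg_mul]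
    rw [div_mul_cancel₀ _ (hD n)]
    ring
  -- Together with `key2`: the block `Θ(γ_n)` sends `(φ_n v, y)` to `(v, z φ_{n+1} y)` for `y = y n
  -- v`.
  have key1 : ∀ n v, starRingEnd ℂ (γ n) * (φ n * v) + rho (γ n) * y n v = v := by
    intro n v
    refine mul_right_cancel₀ (hD n) ?_
    linear_combination starRingEnd ℂ (γ n) * v * hφD n + rho (γ n) * hyD n v +
      v * rho_mul_rho (hγ n)
  have key2 : ∀ n v, rho (γ n) * (φ n * v) - γ n * y n v = z * φ (n + 1) * y n v := by
    intro n v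
    refine mul_right_cancel₀ (hD n) ?_
    linear_combination rho (γ n) * v * hφD n - (γ n + z * φ (n + 1)) * hyD n v
  -- An energy from the form in `szego_norm_sq`. It never increases, and it dominates `|w_n|²` up to
  -- the constant `1 - |z|²`.
  let Y : ℕ → ℝ := fun n => ‖w n‖ ^ 2 * (1 - ‖z * φ n‖ ^ 2)
  have hYφ : ∀ n, 1 - ‖z‖ ^ 2 ≤ 1 - ‖z * φ n‖ ^ 2 := fun n => by
    have h : ‖z * φ n‖ ≤ ‖z‖ := by
      rw [norm_mul]
      exact mul_le_of_le_one_right (norm_nonneg _) (hφ1 n)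
    have : ‖z * φ n‖ ^ 2 ≤ ‖z‖ ^ 2 := by gcongr
    linarith
  have hz2 := one_sub_norm_sq_pos hz
  have hY0 : ∀ n, 0 ≤ Y n := fun n => mul_nonneg (sq_nonneg _) (hz2.le.trans (hYφ n))
  have hYs : ∀ n, Y (n + 1) ≤ (if Even n then 1 else ‖z‖ ^ 2) * Y n := by
    intro n
    have h1 := one_sub_norm_sq_schurStep (schurStep_denom_ne_zero (hγ' n) hz.le (hφ1 (n + 1)))
    rw [← hφ n, norm_neg, RCLike.norm_conj, ← rho_sq (hγ n), eq_div_iff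
      (pow_ne_zero _ (norm_ne_zero_iff.2 (schurStep_denom_ne_zero (hγ' n) hz.le (hφ1 (n + 1)))))]
      at h1
    have e : (1 : ℂ) - -starRingEnd ℂ (γ n) * z * φ (n + 1) =
        1 + starRingEnd ℂ (γ n) * z * φ (n + 1) := by ring
    rw [e] at h1
    have hDn := norm_ne_zero_iff.2 (hD n)
    have h2 : ‖y n (w n)‖ ^ 2 * (1 - ‖z * φ (n + 1)‖ ^ 2) = (1 - ‖φ n‖ ^ 2) * ‖w n‖ ^ 2 := by
      have h3 : ‖y n (w n)‖ = rho (γ n) * ‖w n‖ / ‖1 + starRingEnd ℂ (γ n) * z * φ (n + 1)‖ := by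
        simp only [y, norm_div, norm_mul, Complex.norm_real, Real.norm_of_nonneg (rho_pos (hγ n)).le]
      rw [h3, div_pow, div_mul_eq_mul_div, div_eq_iff (pow_ne_zero _ hDn)]
      linear_combination -‖w n‖ ^ 2 * h1
    have h3 : Y (n + 1) = (if Even n then 1 else ‖z‖ ^ 2) * ((1 - ‖φ n‖ ^ 2) * ‖w n‖ ^ 2) := by
      rw [← h2]
      simp only [Y, hws, norm_mul, mul_pow]
      split_ifs <;> simp [mul_assoc]
    rw [h3]
    have h4 : ‖z * φ n‖ ≤ ‖φ n‖ := by
      rw [norm_mul]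
      exact mul_le_of_le_one_left (norm_nonneg _) hz.le
    have h5 : (1 - ‖φ n‖ ^ 2) * ‖w n‖ ^ 2 ≤ Y n := by
      have : ‖z * φ n‖ ^ 2 ≤ ‖φ n‖ ^ 2 := by gcongr
      simp only [Y]
      nlinarith [sq_nonneg ‖w n‖]
    refine mul_le_mul_of_nonneg_left h5 ?_
    split_ifs <;> positivity
  have hzpos : 0 < ‖z‖ := norm_pos_iff.2 hz0
  -- The factor `|z|²` is gained only from odd `n`, so the rate `|z|` per index appears over two
  -- steps and two consecutive bounds are carried. The division by `|z|` pays for the first step,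
  -- which gains nothing.
  have hYbound : ∀ n, Y n ≤ Y 0 / ‖z‖ * ‖z‖ ^ n ∧ Y (n + 1) ≤ Y 0 / ‖z‖ * ‖z‖ ^ (n + 1) := by
    intro n
    induction n with
    | zero =>
      constructor
      · rw [pow_zero, mul_one, le_div_iff₀ hzpos]
        exact mul_le_of_le_one_right (hY0 0) hz.le
      · have := hYs 0
        rw [zero_add, pow_one, div_mul_cancel₀ _ hzpos.ne']
        simpa using this
    | succ n ih =>
      refine ⟨ih.2, ?_⟩
      have h2 : Y (n + 1 + 1) ≤ ‖z‖ ^ 2 * Y n := by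
        have h3 := hYs (n + 1)
        have h4 := hYs n
        have hz21 : ‖z‖ ^ 2 ≤ 1 := by linarith
        by_cases hn : Even n
        · have hn' : ¬ Even (n + 1) := by simpa [Nat.even_add_one] using hn
          rw [if_neg hn'] at h3
          rw [if_pos hn, one_mul] at h4
          exact h3.trans (by gcongr)
        · have hn' : Even (n + 1) := by simpa [Nat.even_add_one] using hn
          rw [if_pos hn', one_mul] at h3
          rw [if_neg hn] at h4
          exact h3.trans h4
      calc Y (n + 1 + 1) ≤ ‖z‖ ^ 2 * Y n := h2
        _ ≤ ‖z‖ ^ 2 * (Y 0 / ‖z‖ * ‖z‖ ^ n) := by gcongr; exact ih.1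
        _ = Y 0 / ‖z‖ * ‖z‖ ^ (n + 1 + 1) := by ring
  have hsum : Summable fun n => ‖w n‖ ^ 2 := by
    refine Summable.of_nonneg_of_le (fun n => sq_nonneg _) (fun n => ?_)
      ((summable_geometric_of_lt_one hzpos.le hz).mul_left (Y 0 / ‖z‖ / (1 - ‖z‖ ^ 2)))
    rw [div_mul_eq_mul_div, le_div_iff₀ hz2]
    exact (mul_le_mul_of_nonneg_left (hYφ n) (sq_nonneg _)).trans (hYbound n).1
  -- The inner factor of `𝒞` turns `u` into `φ_i w_i` at even and `w_i` at odd `i`; the outer one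
  -- then gives `w_i` and `z φ_i w_i`. This is `z u_i` except at `i = 0`, where the choice of `w 0`
  -- leaves the entry `1` of `e₀`.
  let u : ℕ → ℂ := fun n => if n = 0 then φ 0 * w 0 else if Even n then w n / z else φ n * w n
  have hu : Memℓp u 2 := by
    rw [memℓp_two_iff]
    refine Summable.of_nonneg_of_le (fun n => sq_nonneg _) (fun n => ?_)
      (hsum.mul_left ((1 / ‖z‖) ^ 2))
    rw [← mul_pow]
    have h1 : ‖φ n * w n‖ ≤ 1 / ‖z‖ * ‖w n‖ := by
      rw [norm_mul]
      have : 1 ≤ 1 / ‖z‖ := by rw [le_div_iff₀ hzpos]; linarith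
      exact mul_le_mul_of_nonneg_right ((hφ1 n).trans this) (norm_nonneg _)
    refine pow_le_pow_left₀ (norm_nonneg _) ?_ 2
    simp only [u]
    split_ifs with h h'
    · simpa [h] using h1
    · rw [norm_div]
      exact (div_eq_mul_one_div _ _).le.trans (mul_comm _ _).le
    · exact h1
  have hM : ∀ i, pairOp oddPartner oddPartner_involutive (oddDiag γ) (oddOff γ)
      (norm_oddDiag_le hγ) (norm_oddOff_le γ) (⟨u, hu⟩ : EllTwo) i =
        if Even i then φ i * w i else w i := by
    intro i
    rw [pairOp_apply]
    change oddDiag γ i * u i + oddOff γ i * u (oddPartner i) = _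
    rcases i with _ | i
    · simp [oddDiag, oddOff, u]
    by_cases h : Even i
    · have h1 : ¬ Even (i + 1) := by simpa [Nat.even_add_one] using h
      have h2 : Odd (i + 1) := by grind
      have h3 : Even (i + 1 + 1) := by grind
      simp only [oddDiag, oddOff, u, oddPartner, h1, h2, h3, if_true, if_false, Nat.add_eq_zero_iff,
        one_ne_zero, and_false]
      rw [hws (i + 1), if_neg h1, mul_div_cancel_left₀ _ hz0]
      exact key1 _ _
    · have h1 : Even (i + 1) := by simpa [Nat.even_add_one] using h
      have h2 : ¬ Odd (i + 1) := by grind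
      have h3 : i ≠ 0 := by grind
      simp only [oddDiag, oddOff, u, oddPartner, h, h1, h2, h3, if_true, if_false,
        Nat.add_eq_zero_iff, one_ne_zero, and_false, Nat.add_sub_cancel]
      rw [hws i, if_neg h, mul_div_cancel_left₀ _ hz0]
      linear_combination key2 i (w i)
  have hres : cmv γ hγ (⟨u, hu⟩ : EllTwo) - z • (⟨u, hu⟩ : EllTwo) = e₀ := by
    ext i
    rw [lp.coeFn_sub, Pi.sub_apply, lp.coeFn_smul, Pi.smul_apply, smul_eq_mul, cmv,
      mul_apply_eq_comp, pairOp_apply, hM, hM]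
    change _ - z * u i = _
    by_cases h : Even i
    · have h1 : ¬ Even (i + 1) := by simpa [Nat.even_add_one] using h
      simp only [evenDiag, evenOff, evenPartner, h, h1, if_true, if_false]
      have h2 := key1 i (w i)
      rw [hws, if_pos h, one_mul, h2]
      rcases i with _ | i
      · rw [e₀_zero]
        simp only [u, if_true, hw0]
        field_simp
      · rw [e₀_succ]
        simp only [u, h, if_true, Nat.add_eq_zero_iff, one_ne_zero, and_false, if_false]
        rw [mul_div_cancel₀ _ hz0, sub_self]
    · rcases i with _ | i
      · simp at h
      have h1 : Even i := by grind
      rw [e₀_succ]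
      simp only [evenDiag, evenOff, evenPartner, u, h, h1, if_true, if_false, Nat.add_sub_cancel,
        Nat.add_eq_zero_iff, one_ne_zero, and_false]
      rw [hws, if_pos h1, one_mul]
      linear_combination key2 i (w i)
  rw [caratheodory_eq_add hγ hz.ne hres]
  change 1 + 2 * z * u 0 = _
  simp only [u, if_true, hw0]
  field_simp
  ring

theorem schur_eq_of_schurStep {z : ℂ} (hz0 : z ≠ 0) (hz : ‖z‖ < 1) {φ : ℕ → ℂ}
    (hφ1 : ∀ n, ‖φ n‖ ≤ 1) (hφ : ∀ n, φ n = schurStep (-starRingEnd ℂ (γ n)) z (φ (n + 1))) :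
    caratheodory γ hγ z ≠ -1 ∧
      1 / z * ((caratheodory γ hγ z - 1) / (caratheodory γ hγ z + 1)) = φ 0 := by
  have h0 : 1 - z * φ 0 ≠ 0 := by
    have := one_sub_norm_le' (α := 1) (z := z) norm_one.le (hφ1 0)
    rw [one_mul] at this
    exact norm_pos_iff.1 ((sub_pos.2 hz).trans_le this)
  have h1 : caratheodory γ hγ z + 1 = 2 / (1 - z * φ 0) := by
    rw [caratheodory_eq_of_schur hγ hz0 hz hφ1 hφ]
    field_simp
    ring
  have h2 : caratheodory γ hγ z - 1 = 2 * (z * φ 0) / (1 - z * φ 0) := by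
    rw [caratheodory_eq_of_schur hγ hz0 hz hφ1 hφ]
    field_simp
    ring
  constructor
  · intro h
    rw [h, neg_add_cancel] at h1
    exact div_ne_zero two_ne_zero h0 h1.symm
  · rw [h1, h2]
    field_simp

/-- The Schur function of a CMV operator (Geronimus' theorem), on the disk. -/
theorem schur_eq {z : ℂ} (hz : ‖z‖ < 1) {φ : ℂ → ℕ → ℂ}
    (hφ1 : ∀ z, ‖z‖ < 1 → ∀ n, ‖φ z n‖ ≤ 1)
    (hφ : ∀ z, ‖z‖ < 1 → ∀ n, φ z n = schurStep (-starRingEnd ℂ (γ n)) z (φ z (n + 1))) :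
    schur γ hγ z = ((φ z 0 : ℂ) : OnePoint ℂ) := by
  have hγ' : ‖-starRingEnd ℂ (γ 0)‖ < 1 := by simpa using hγ 0
  rw [schur]
  split_ifs with h0 h1
  · congr 1
    have hball : ∀ᶠ w in 𝓝 (0 : ℂ), ‖w‖ < 1 := by
      filter_upwards [Metric.ball_mem_nhds (0 : ℂ) one_pos] with w hw
      simpa using hw
    refine Tendsto.limUnder_eq ?_
    -- Continuity of `φ` is not assumed. One step of the recursion gives `φ w 0 = γ_0 + O(w)`, which
    -- is enough at the origin.
    have hlim : Tendsto (fun w => φ w 0) (𝓝[≠] (0 : ℂ)) (𝓝 (φ z 0)) := by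
      refine Tendsto.mono_left ?_ nhdsWithin_le_nhds
      rw [h0, tendsto_iff_norm_sub_tendsto_zero]
      have hmaj : Tendsto (fun w : ℂ => ‖w‖ * (2 / (1 - ‖γ 0‖))) (𝓝 0) (𝓝 0) := by
        have : Continuous fun w : ℂ => ‖w‖ * (2 / (1 - ‖γ 0‖)) := by fun_prop
        simpa using this.tendsto 0
      refine squeeze_zero' (Eventually.of_forall fun _ => norm_nonneg _) ?_ hmaj
      filter_upwards [hball] with w hw
      have e0 : φ 0 0 = γ 0 := by
        rw [hφ 0 (by simp) 0, schurStep]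
        simp
      have hden := schurStep_denom_ne_zero hγ' hw.le (hφ1 w hw 1)
      have e1 : φ w 0 - φ 0 0 =
          w * φ w 1 * (1 - γ 0 * starRingEnd ℂ (γ 0)) /
            (1 - -starRingEnd ℂ (γ 0) * w * φ w 1) := by
        rw [e0, hφ w hw 0, schurStep, eq_div_iff hden, sub_mul, div_mul_cancel₀ _ hden]
        simp only [map_neg, Complex.conj_conj]
        ring
      have hle := one_sub_norm_le (α := -starRingEnd ℂ (γ 0)) hw.le (hφ1 w hw 1)
      rw [norm_neg, RCLike.norm_conj] at hle
      have hpos : 0 < 1 - ‖γ 0‖ := sub_pos.2 (hγ 0)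
      rw [e1, norm_div, norm_mul, ← mul_div_assoc]
      refine div_le_div₀ (by positivity) ?_ hpos hle
      refine mul_le_mul ?_ ?_ (norm_nonneg _) (norm_nonneg _)
      · rw [norm_mul]
        exact mul_le_of_le_one_right (norm_nonneg _) (hφ1 w hw 1)
      · refine (norm_sub_le _ _).trans ?_
        rw [norm_one, norm_mul, RCLike.norm_conj]
        nlinarith [norm_nonneg (γ 0), hγ 0]
    refine hlim.congr' ?_
    filter_upwards [nhdsWithin_le_nhds hball, self_mem_nhdsWithin] with w hw hw0
    exact (schur_eq_of_schurStep hγ hw0 hw (hφ1 w hw) (hφ w hw)).2.symm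
  · exact absurd h1 (schur_eq_of_schurStep hγ h0 hz (hφ1 z hz) (hφ z hz)).1
  · rw [(schur_eq_of_schurStep hγ h0 hz (hφ1 z hz) (hφ z hz)).2]

/-- A zero of the Schur function at the reflected point means `F = 1` there, and
`caratheodory_reflect` turns this into `F(z) = -1`. -/
theorem schur_eq_infty {z : ℂ} (hz : 1 < ‖z‖) {φ : ℕ → ℂ} (hφ1 : ∀ n, ‖φ n‖ ≤ 1)
    (hφ : ∀ n, φ n = schurStep (-starRingEnd ℂ (γ n)) (starRingEnd ℂ z)⁻¹ (φ (n + 1)))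
    (h0 : φ 0 = 0) : schur γ hγ z = OnePoint.infty := by
  have hz0 : z ≠ 0 := norm_pos_iff.1 (one_pos.trans hz)
  have hw : ‖(starRingEnd ℂ z)⁻¹‖ < 1 := by
    rw [norm_inv, RCLike.norm_conj]
    exact inv_lt_one_of_one_lt₀ hz
  have h : caratheodory γ hγ z = -1 := by
    rw [caratheodory_reflect hγ hz0 hz.ne', caratheodory_eq_of_schur hγ
      (inv_ne_zero ((_root_.map_ne_zero _).2 hz0)) hw hφ1 hφ, h0]
    simp
  rw [schur, if_neg hz0, if_pos h]

end Caratheodory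

/-! ### The excluded zeros and poles as zeros of periodic Schur functions -/

section Periodic

variable {p : ℕ} {α : ℕ → ℂ}

/-- The Schur algorithm of the reversed sequence is the recursion of `periodicSchur` read backwards.
The representatives `p - n % p` run through `p, …, 1`, so each is a successor; only the wrap-around
from `1` to `p` uses periodicity. -/
theorem schurStep_reversedCoeff (hp : 0 < p) (hα : ∀ n, ‖α n‖ < 1)
    (hper : Function.Periodic α p) {z : ℂ} (hz : ‖z‖ < 1) (n : ℕ) :
    periodicSchur p α z (p - n % p) =
      schurStep (-starRingEnd ℂ (reversedCoeff p α n)) z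
        (periodicSchur p α z (p - (n + 1) % p)) := by
  have hlt := Nat.mod_lt n hp
  have h1 : p - n % p = (p - 1 - n % p) + 1 := by omega
  have h2 : periodicSchur p α z (p - (n + 1) % p) = periodicSchur p α z (p - 1 - n % p) := by
    by_cases h : n % p = p - 1
    · have h3 : (n + 1) % p = 0 := by
        rw [← Nat.mod_add_mod, h, Nat.sub_add_cancel hp, Nat.mod_self]
      rw [h3, h, Nat.sub_zero, Nat.sub_self]
      simpa using periodic_periodicSchur hp hα hper hz 0
    · have h3 : (n + 1) % p = n % p + 1 := by
        rw [← Nat.mod_add_mod, Nat.mod_eq_of_lt (by omega)]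
      rw [h3]
      congr 1
      omega
  rw [h1, h2, periodicSchur_succ hp hα hper hz, reversedCoeff]
  simp

theorem periodicSchur_eq_mod (hp : 0 < p) (hα : ∀ n, ‖α n‖ < 1) (hper : Function.Periodic α p)
    {z : ℂ} (hz : ‖z‖ < 1) (n : ℕ) :
    ∃ j < p, periodicSchur p α z n = periodicSchur p α z (p - j % p) := by
  have h := (periodic_periodicSchur hp hα hper hz).map_mod_nat n
  have hlt := Nat.mod_lt n hp
  rcases Nat.eq_zero_or_pos (n % p) with h0 | h0
  · refine ⟨0, hp, ?_⟩
    rw [← h, h0, Nat.zero_mod, Nat.sub_zero]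
    simpa using (periodic_periodicSchur hp hα hper hz 0).symm
  · refine ⟨p - n % p, by omega, ?_⟩
    rw [Nat.mod_eq_of_lt (show p - n % p < p by omega), Nat.sub_sub_self hlt.le, h]

theorem periodicSchur_ne_zero_of_notMem_zeroSet (hp : 0 < p) (hα : ∀ n, ‖α n‖ < 1)
    (hper : Function.Periodic α p) {z : ℂ} (hz : ‖z‖ < 1) (hZ : z ∉ zeroSet p α hα) (n : ℕ) :
    periodicSchur p α z n ≠ 0 := by
  intro h
  obtain ⟨j, hj, hnj⟩ := periodicSchur_eq_mod hp hα hper hz n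
  refine hZ (Set.mem_biUnion (Finset.mem_range.2 hj) ⟨hz, ?_⟩)
  rw [strippedSchur, schur_eq _ hz (φ := fun z n => periodicSchur p α z (p - (n + j) % p))
    (fun z hz n => norm_periodicSchur_le hp hα hper hz _), zero_add, ← hnj, h]
  intro z hz n
  rw [add_right_comm n 1 j]
  exact schurStep_reversedCoeff hp hα hper hz (n + j)

theorem periodicSchur_ne_zero_of_notMem_poleSet (hp : 0 < p) (hα : ∀ n, ‖α n‖ < 1)
    (hper : Function.Periodic α p) {z : ℂ} (hz : 1 < ‖z‖) (hP : z ∉ poleSet p α hα) (n : ℕ) :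
    periodicSchur p (fun j => starRingEnd ℂ (α j)) z⁻¹ n ≠ 0 := by
  intro h
  have hw : ‖(starRingEnd ℂ z)⁻¹‖ < 1 := by
    rw [norm_inv, RCLike.norm_conj]
    exact inv_lt_one_of_one_lt₀ hz
  have h' : periodicSchur p α (starRingEnd ℂ z)⁻¹ n = 0 := by
    have := conj_periodicSchur hp hα hper hw n
    rw [map_inv₀, Complex.conj_conj, h] at this
    simpa using this
  obtain ⟨j, hj, hnj⟩ := periodicSchur_eq_mod hp hα hper hw n
  refine hP (Set.mem_biUnion (Finset.mem_range.2 hj) ⟨hz, ?_⟩)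
  refine schur_eq_infty _ hz
    (φ := fun n => periodicSchur p α (starRingEnd ℂ z)⁻¹ (p - (n + j) % p))
    (fun n => norm_periodicSchur_le hp hα hper hw _) (fun n => ?_) ?_
  · rw [add_right_comm n 1 j]
    exact schurStep_reversedCoeff hp hα hper hw (n + j)
  · rw [zero_add, ← hnj, h']

end Periodic


/-! ### The dominant eigenvalue of the transfer matrix -/

theorem det_stepMatrix {α : ℂ} (hα : ‖α‖ < 1) (z : ℂ) : (stepMatrix α z).det = z := by
  have h : (rho α : ℂ) ≠ 0 := Complex.ofReal_ne_zero.2 (rho_pos hα).ne'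
  have h2 := rho_mul_rho hα
  rw [stepMatrix, Matrix.det_smul, Matrix.det_fin_two_of, Fintype.card_fin, div_pow, one_pow,
    div_mul_eq_mul_div, div_eq_iff (pow_ne_zero _ h)]
  linear_combination -z * h2

theorem det_transferMatrix {α : ℕ → ℂ} (hα : ∀ n, ‖α n‖ < 1) (z : ℂ) (n : ℕ) :
    (transferMatrix α z n).det = z ^ n := by
  induction n with
  | zero => simp [transferMatrix]
  | succ n ih => rw [transferMatrix, Matrix.det_mul, det_stepMatrix (hα n), ih, pow_succ']

/-- Each step satisfies `A(α, z) = z J A(conj α, 1 / z) J` with the swap `J`, and the inner swaps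
cancel in the product. -/
theorem transferMatrix_inv (α : ℕ → ℂ) {z : ℂ} (hz : z ≠ 0) (n : ℕ) :
    transferMatrix α z n = z ^ n • (!![0, 1; 1, 0] *
      transferMatrix (fun j => starRingEnd ℂ (α j)) z⁻¹ n * !![0, 1; 1, 0]) := by
  have hJ : (!![0, 1; 1, 0] : Matrix (Fin 2) (Fin 2) ℂ) * !![0, 1; 1, 0] = 1 := by
    simp [Matrix.one_fin_two]
  induction n with
  | zero => simp [transferMatrix, hJ]
  | succ n ih =>
    have h : stepMatrix (α n) z = z • (!![0, 1; 1, 0] *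
        stepMatrix (starRingEnd ℂ (α n)) z⁻¹ * !![0, 1; 1, 0]) := by
      have hr : rho (starRingEnd ℂ (α n)) = rho (α n) := by simp [rho]
      ext i j
      fin_cases i <;> fin_cases j <;>
        simp [stepMatrix, hr] <;> field_simp
    rw [transferMatrix, ih, h, transferMatrix, smul_mul_smul_comm, ← pow_succ']
    congr 1
    simp only [Matrix.mul_assoc]
    congr 2
    rw [← Matrix.mul_assoc (!![0, 1; 1, 0]) (!![0, 1; 1, 0]), hJ, Matrix.one_mul]

theorem trace_transferMatrix_inv (α : ℕ → ℂ) {z : ℂ} (hz : z ≠ 0) (n : ℕ) :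
    (transferMatrix α z n).trace =
      z ^ n * (transferMatrix (fun j => starRingEnd ℂ (α j)) z⁻¹ n).trace := by
  rw [transferMatrix_inv α hz, Matrix.trace_smul, smul_eq_mul, Matrix.trace_mul_comm,
    ← Matrix.mul_assoc]
  simp [← Matrix.one_fin_two]

/-- The product of the `ρ_j` over a period. -/
def rhoProd (p : ℕ) (α : ℕ → ℂ) : ℂ := ∏ j ∈ Finset.range p, (rho (α j) : ℂ)

theorem rhoProd_ne_zero (p : ℕ) {α : ℕ → ℂ} (hα : ∀ n, ‖α n‖ < 1) : rhoProd p α ≠ 0 :=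
  Finset.prod_ne_zero_iff.2 fun j _ => Complex.ofReal_ne_zero.2 (rho_pos (hα j)).ne'

/-- `G_Δ` is `∏ ρ_j` times the eigenvalue of larger modulus of the transfer matrix. -/
theorem gDelta_eq_of_eigenvalue (p : ℕ) (α : ℕ → ℂ) {z l : ℂ} (hz : z ≠ 0)
    (hl : l ^ 2 - (transferMatrix α z p).trace * l + z ^ p = 0) (hdom : ‖z‖ ^ p < ‖l‖ ^ 2) :
    gDelta p α z = rhoProd p α * l := by
  set s : ℂ := z ^ ((p : ℂ) / 2) with hs
  have hss : s * s = z ^ p := by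
    rw [hs, ← Complex.cpow_add _ _ hz, add_halves, Complex.cpow_natCast]
  have hs0 : s ≠ 0 := by
    intro h
    rw [h, mul_zero] at hss
    exact pow_ne_zero p hz hss.symm
  have hl0 : l ≠ 0 := by
    rintro rfl
    rw [norm_zero] at hdom
    have : 0 ≤ ‖z‖ ^ p := by positivity
    norm_num at hdom
    linarith
  -- The eigenvalues are `l` and `z ^ p / l`. Divided by `s`, a square root of `z ^ p`, they become
  -- reciprocal, so the square root of `Δ² - 4` is `±(l / s - s / l)` and dominance fixes the sign.
  have hd : discriminant p α z = l / s + s / l := by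
    rw [discriminant, neg_div, Complex.cpow_neg, ← hs]
    field_simp
    linear_combination -hl - hss
  have hsl : ‖s / l‖ < ‖l / s‖ := by
    rw [norm_div, norm_div, div_lt_div_iff₀ (norm_pos_iff.2 hl0) (norm_pos_iff.2 hs0),
      ← norm_mul, hss, norm_pow, ← sq]
    exact hdom
  have hsq : dominantSqrt (discriminant p α z) = l / s - s / l := by
    have e : (discriminant p α z) ^ 2 - 4 = (l / s - s / l) ^ 2 := by
      rw [hd]
      field_simp
      ring
    have h1 : ((discriminant p α z ^ 2 - 4) ^ (1 / 2 : ℂ)) ^ 2 = (l / s - s / l) ^ 2 := by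
      rw [← e, ← Complex.cpow_nat_mul]
      norm_num
    rw [dominantSqrt]
    have e1 : l / s + s / l + (l / s - s / l) = 2 * (l / s) := by ring
    have e2 : l / s + s / l - (l / s - s / l) = 2 * (s / l) := by ring
    have e3 : ‖2 * (s / l)‖ < ‖2 * (l / s)‖ := by
      rw [norm_mul, norm_mul]
      exact mul_lt_mul_of_pos_left hsl (by simp)
    rcases sq_eq_sq_iff_eq_or_eq_neg.1 h1 with h | h
    · rw [h, hd, e1, e2, if_pos e3.le]
    · rw [h, hd, sub_neg_eq_add, ← sub_eq_add_neg, e1, e2, if_neg (not_le.2 e3), neg_neg]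
  rw [gDelta, if_neg hz, hsq, hd, ← hs, rhoProd]
  field_simp
  ring

/-! ### The limit in the disk and in the exterior as a dominant eigenvalue -/

section Periodic

variable {p : ℕ} {α : ℕ → ℂ}

/-- The limit of `Φ_{n+p}^* / Φ_n^*` in the disk. -/
def diskLimit (p : ℕ) (α : ℕ → ℂ) (z : ℂ) : ℂ :=
  ∏ j ∈ Finset.range p, (1 - α j * z * periodicSchur p α z j)

theorem prod_range_add_of_periodic {g : ℕ → ℂ} (hg : Function.Periodic g p) (n : ℕ) :
    ∏ j ∈ Finset.range p, g (n + j) = ∏ j ∈ Finset.range p, g j := by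
  induction n with
  | zero => simp
  | succ n ih =>
    rw [← ih]
    rcases p with _ | p
    · simp
    · rw [Finset.prod_range_succ, Finset.prod_range_succ', add_zero]
      congr 1
      · refine Finset.prod_congr rfl fun j _ => ?_
        congr 1
        ring
      · rw [← hg n]
        congr 1
        ring

theorem diskLimit_eq_prod (hp : 0 < p) (hα : ∀ n, ‖α n‖ < 1) (hper : Function.Periodic α p)
    {z : ℂ} (hz : ‖z‖ < 1) (n : ℕ) :
    diskLimit p α z = ∏ j ∈ Finset.range p, (1 - α (n + j) * z * periodicSchur p α z (n + j)) := by
  rw [diskLimit, prod_range_add_of_periodic (g := fun j => 1 - α j * z * periodicSchur p α z j)]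
  intro j
  simp only [hper j, periodic_periodicSchur hp hα hper hz j]

/-- The transfer matrices carry the direction `(s_0, 1)` to `(s_n, 1)`; over a full period it is an
eigenvector, and the scalar is the eigenvalue. -/
theorem transferMatrix_mulVec (hp : 0 < p) (hα : ∀ n, ‖α n‖ < 1) (hper : Function.Periodic α p)
    {z : ℂ} (hz : ‖z‖ < 1) (n : ℕ) :
    (transferMatrix α z n).mulVec ![periodicSchur p α z 0, 1] =
      (∏ j ∈ Finset.range n, ((1 - α j * z * periodicSchur p α z j) / rho (α j))) •
        ![periodicSchur p α z n, 1] := by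
  induction n with
  | zero => simp [transferMatrix]
  | succ n ih =>
    have h : (stepMatrix (α n) z).mulVec ![periodicSchur p α z n, 1] =
        ((1 - α n * z * periodicSchur p α z n) / rho (α n)) •
          ![periodicSchur p α z (n + 1), 1] := by
      have h0 := schurStep_denom_ne_zero (hα n) hz.le (norm_periodicSchur_le hp hα hper hz n)
      have h0' : 1 - z * periodicSchur p α z n * α n ≠ 0 := by
        convert h0 using 1
        ring
      rw [periodicSchur_succ hp hα hper hz, schurStep]
      ext i
      fin_cases i
      · simp [stepMatrix, Matrix.mulVec, dotProduct, Fin.sum_univ_two]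
        field_simp
        ring
      · simp [stepMatrix, Matrix.mulVec, dotProduct, Fin.sum_univ_two]
        field_simp
        ring
    rw [transferMatrix, ← Matrix.mulVec_mulVec, ih, Matrix.mulVec_smul, h, smul_smul,
      Finset.prod_range_succ]

theorem exists_disk_eigenvalue (hp : 0 < p) (hα : ∀ n, ‖α n‖ < 1) (hper : Function.Periodic α p)
    {z : ℂ} (hz : ‖z‖ < 1) :
    ∃ l : ℂ, diskLimit p α z = rhoProd p α * l ∧
      l ^ 2 - (transferMatrix α z p).trace * l + z ^ p = 0 ∧ 1 ≤ ‖l‖ := by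
  refine ⟨∏ j ∈ Finset.range p, ((1 - α j * z * periodicSchur p α z j) / rho (α j)), ?_, ?_, ?_⟩
  · rw [diskLimit, rhoProd, ← Finset.prod_mul_distrib]
    refine Finset.prod_congr rfl fun j _ => ?_
    rw [mul_div_cancel₀ _ (Complex.ofReal_ne_zero.2 (rho_pos (hα j)).ne')]
  · have h := transferMatrix_mulVec hp hα hper hz p
    set l := ∏ j ∈ Finset.range p, ((1 - α j * z * periodicSchur p α z j) / rho (α j))
    have hp0 : periodicSchur p α z p = periodicSchur p α z 0 := by
      simpa using periodic_periodicSchur hp hα hper hz 0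
    rw [hp0] at h
    have h0 := congrFun h 0
    have h1 := congrFun h 1
    rw [← det_transferMatrix hα z p, Matrix.det_fin_two, Matrix.trace_fin_two]
    simp [Matrix.mulVec, dotProduct, Fin.sum_univ_two] at h0 h1
    set T := transferMatrix α z p
    set f := periodicSchur p α z 0
    linear_combination (T 0 0 - l) * h1 - T 1 0 * h0
  · have hlt : ∀ n, ‖periodicSchur p α z n‖ < 1 := fun n => by
      obtain ⟨q, rfl⟩ : ∃ q, p = q + 1 := ⟨p - 1, by omega⟩
      rw [← periodic_periodicSchur hp hα hper hz n]
      exact norm_periodicSchur_lt hp hα hper hz (n + q)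
    -- For `|z| < 1` the form `|v_2|² - |v_1|²` of the transported vector does not decrease. After a
    -- period it is multiplied by the squared modulus of the eigenvalue, and it is positive, so that
    -- modulus is at least one.
    have key : ∀ n, 1 - ‖periodicSchur p α z 0‖ ^ 2 ≤
        ‖∏ j ∈ Finset.range n, ((1 - α j * z * periodicSchur p α z j) / rho (α j))‖ ^ 2 *
          (1 - ‖periodicSchur p α z n‖ ^ 2) := by
      intro n
      induction n with
      | zero => simp
      | succ n ih =>
        have h0 := schurStep_denom_ne_zero (hα n) hz.le (hlt n).le
        have h1 := one_sub_norm_sq_schurStep h0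
        have hn := norm_ne_zero_iff.2 h0
        have hr := (rho_pos (hα n)).ne'
        rw [Finset.prod_range_succ, norm_mul, mul_pow, mul_assoc,
          periodicSchur_succ hp hα hper hz, h1, norm_div, Complex.norm_real,
          Real.norm_of_nonneg (rho_pos (hα n)).le, div_pow, ← rho_sq (hα n)]
        have e : ‖1 - α n * z * periodicSchur p α z n‖ ^ 2 / rho (α n) ^ 2 *
            (rho (α n) ^ 2 * (1 - ‖z * periodicSchur p α z n‖ ^ 2) /
              ‖1 - α n * z * periodicSchur p α z n‖ ^ 2) =
            1 - ‖z * periodicSchur p α z n‖ ^ 2 := by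
          field_simp
        rw [e]
        refine ih.trans (mul_le_mul_of_nonneg_left ?_ (sq_nonneg _))
        have : ‖z * periodicSchur p α z n‖ ≤ ‖periodicSchur p α z n‖ := by
          rw [norm_mul]
          exact mul_le_of_le_one_left (norm_nonneg _) hz.le
        have := pow_le_pow_left₀ (norm_nonneg _) this 2
        linarith
    have h := key p
    have hp0 : periodicSchur p α z p = periodicSchur p α z 0 := by
      simpa using periodic_periodicSchur hp hα hper hz 0
    rw [hp0] at h
    have hpos := one_sub_norm_sq_pos (hlt 0)
    exact (one_le_sq_iff₀ (norm_nonneg _)).1 (le_of_mul_le_mul_right (by linarith) hpos)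

theorem pow_norm_lt_one (hp : 0 < p) {z : ℂ} (hz : ‖z‖ < 1) : ‖z‖ ^ p < 1 :=
  pow_lt_one₀ (norm_nonneg _) hz hp.ne'

theorem gDelta_eq_diskLimit (hp : 0 < p) (hα : ∀ n, ‖α n‖ < 1) (hper : Function.Periodic α p)
    {z : ℂ} (hz : ‖z‖ < 1) : gDelta p α z = diskLimit p α z := by
  by_cases h0 : z = 0
  · simp [h0, gDelta, diskLimit]
  · obtain ⟨l, h1, h2, h3⟩ := exists_disk_eigenvalue hp hα hper hz
    rw [h1, gDelta_eq_of_eigenvalue p α h0 h2]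
    exact (pow_norm_lt_one hp hz).trans_le (one_le_pow₀ h3)

theorem periodic_conj (hper : Function.Periodic α p) :
    Function.Periodic (fun j => starRingEnd ℂ (α j)) p := fun j => by
  simp only [hper j]

theorem rhoProd_conj : rhoProd p (fun j => starRingEnd ℂ (α j)) = rhoProd p α := by
  simp [rhoProd, rho]

/-- Outside the disk the dominant eigenvalue is `z ^ p` times that of the conjugated sequence at `1
/ z`. -/
theorem exists_eigenvalue (hp : 0 < p) (hα : ∀ n, ‖α n‖ < 1) (hper : Function.Periodic α p)
    {z : ℂ} (hz0 : z ≠ 0) (hz : ‖z‖ ≠ 1) :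
    ∃ l : ℂ, gDelta p α z = rhoProd p α * l ∧
      l ^ 2 - (transferMatrix α z p).trace * l + z ^ p = 0 ∧ ‖z‖ ^ p < ‖l‖ ^ 2 ∧
      (1 < ‖z‖ → gDelta p α z = z ^ p * diskLimit p (fun j => starRingEnd ℂ (α j)) z⁻¹) := by
  rcases lt_or_gt_of_ne hz with h | h
  · obtain ⟨l, h1, h2, h3⟩ := exists_disk_eigenvalue hp hα hper h
    refine ⟨l, ?_, h2, (pow_norm_lt_one hp h).trans_le (one_le_pow₀ h3),
      fun h' => absurd h (not_lt.2 h'.le)⟩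
    rw [gDelta_eq_diskLimit hp hα hper h, h1]
  · have hw : ‖z⁻¹‖ < 1 := by
      rw [norm_inv]
      exact inv_lt_one_of_one_lt₀ h
    have hα' : ∀ n, ‖starRingEnd ℂ (α n)‖ < 1 := fun n => by simpa using hα n
    obtain ⟨l, h1, h2, h3⟩ := exists_disk_eigenvalue hp hα' (periodic_conj hper) hw
    have e1 : (z ^ p * l) ^ 2 - (transferMatrix α z p).trace * (z ^ p * l) + z ^ p = 0 := by
      rw [trace_transferMatrix_inv α hz0]
      have hzp : z ^ p * z⁻¹ ^ p = 1 := by rw [← mul_pow, mul_inv_cancel₀ hz0, one_pow]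
      linear_combination (z ^ p) ^ 2 * h2 - z ^ p * hzp
    have e2 : ‖z‖ ^ p < ‖z ^ p * l‖ ^ 2 := by
      rw [norm_mul, norm_pow, mul_pow]
      have h4 : 1 < ‖z‖ ^ p := one_lt_pow₀ h hp.ne'
      have h5 : 1 ≤ ‖l‖ ^ 2 := one_le_pow₀ h3
      nlinarith
    have e3 := gDelta_eq_of_eigenvalue p α hz0 e1 e2
    refine ⟨z ^ p * l, e3, e1, e2, fun _ => ?_⟩
    rw [e3, h1, rhoProd_conj]
    ring

end Periodic

/-! ### The filter of index pairs `n / N → t` -/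

/-- The filter on pairs `(n, N)` along which `n → ∞`, `N → ∞` and `n / N → t`. -/
def ratioFilter (t : ℝ) : Filter (ℕ × ℕ) :=
  comap Prod.fst atTop ⊓ comap Prod.snd atTop ⊓
    comap (fun x : ℕ × ℕ => (x.1 : ℝ) / (x.2 : ℝ)) (𝓝 t)

/-- This turns statements about all sequences `n_i, N_i` into statements about one filter, and a
failure along the filter into a single bad sequence. -/
instance (t : ℝ) : (ratioFilter t).IsCountablyGenerated := by
  unfold ratioFilter
  infer_instance

theorem tendsto_ratioFilter_iff {ι : Type*} {l : Filter ι} {t : ℝ} {f : ι → ℕ × ℕ} :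
    Tendsto f l (ratioFilter t) ↔ Tendsto (fun i => (f i).1) l atTop ∧
      Tendsto (fun i => (f i).2) l atTop ∧
      Tendsto (fun i => ((f i).1 : ℝ) / ((f i).2 : ℝ)) l (𝓝 t) := by
  simp only [ratioFilter, tendsto_inf, tendsto_comap_iff, and_assoc]
  rfl

theorem isRatioSeq_iff {t : ℝ} {n N : ℕ → ℕ} :
    IsRatioSeq t n N ↔ Tendsto (fun i => (n i, N i)) atTop (ratioFilter t) := by
  rw [tendsto_ratioFilter_iff]
  exact ⟨fun h => ⟨h.1, h.2, h.3⟩, fun h => ⟨h.1, h.2.1, h.2.2⟩⟩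

theorem tendsto_ratioFilter_perturb {t : ℝ} {g : ℕ → ℕ} {c : ℕ} (h1 : ∀ n, n ≤ g n + c)
    (h2 : ∀ n, g n ≤ n + c) :
    Tendsto (fun x : ℕ × ℕ => (g x.1, x.2)) (ratioFilter t) (ratioFilter t) := by
  obtain ⟨hn, hN, hr⟩ := tendsto_ratioFilter_iff.1 (tendsto_id (x := ratioFilter t))
  simp only [id] at hn hN hr
  refine tendsto_ratioFilter_iff.2 ⟨?_, hN, ?_⟩
  · refine tendsto_atTop_mono (f := fun x : ℕ × ℕ => x.1 - c) (fun x => ?_)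
      ((tendsto_sub_atTop_nat c).comp hn)
    have := h1 x.1
    dsimp only
    omega
  · have hc : Tendsto (fun x : ℕ × ℕ => (c : ℝ) / (x.2 : ℝ)) (ratioFilter t) (𝓝 0) :=
      (tendsto_natCast_atTop_atTop.comp hN).const_div_atTop (c : ℝ)
    have h : Tendsto (fun x : ℕ × ℕ => ((g x.1 : ℝ) - x.1) / (x.2 : ℝ)) (ratioFilter t) (𝓝 0) := by
      refine squeeze_zero_norm (fun x => ?_) hc
      rw [norm_div, Real.norm_natCast]
      have e1 : ((x.1 : ℕ) : ℝ) ≤ g x.1 + c := by exact_mod_cast h1 x.1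
      have e2 : ((g x.1 : ℕ) : ℝ) ≤ x.1 + c := by exact_mod_cast h2 x.1
      refine div_le_div_of_nonneg_right ?_ (Nat.cast_nonneg _)
      rw [Real.norm_eq_abs, abs_le]
      constructor <;> linarith
    have := hr.add h
    rw [add_zero] at this
    refine this.congr fun x => ?_
    rw [← add_div]
    congr 1
    ring

theorem tendsto_ratioFilter_add (t : ℝ) (k : ℕ) :
    Tendsto (fun x : ℕ × ℕ => (x.1 + k, x.2)) (ratioFilter t) (ratioFilter t) :=
  tendsto_ratioFilter_perturb (g := fun n => n + k) (c := k) (fun n => by omega) (fun n => by omega)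

theorem tendsto_ratioFilter_sub (t : ℝ) (k : ℕ) :
    Tendsto (fun x : ℕ × ℕ => (x.1 - k, x.2)) (ratioFilter t) (ratioFilter t) :=
  tendsto_ratioFilter_perturb (g := fun n => n - k) (c := k) (fun n => by omega) (fun n => by omega)

theorem eventually_ratioFilter_ge (t : ℝ) (m : ℕ) : ∀ᶠ x in ratioFilter t, m ≤ x.1 :=
  (tendsto_ratioFilter_iff.1 (tendsto_id (x := ratioFilter t))).1.eventually_ge_atTop m

/-- Along `n / N → t`, the coefficients approach the periodic sequence. -/
theorem AsymptoticallyPeriodic.tendsto_sub {a : ℕ → ℕ → ℂ} {t : ℝ} {p : ℕ} {α : ℕ → ℂ}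
    (hp : 0 < p) (hper : Function.Periodic α p) (h : AsymptoticallyPeriodic a t p α) :
    Tendsto (fun x : ℕ × ℕ => a x.1 x.2 - α x.1) (ratioFilter t) (𝓝 0) := by
  -- The hypothesis speaks of pairs `(k, N)` with `kp / N → t`; `G` is their filter. Division by `p`
  -- maps into it because `n / p * p` is within `p` of `n`.
  set G : Filter (ℕ × ℕ) := comap (fun x : ℕ × ℕ => (x.1 * p, x.2)) (ratioFilter t) with hG
  have hφ : Tendsto (fun x : ℕ × ℕ => (x.1 / p, x.2)) (ratioFilter t) G := by
    rw [hG, tendsto_comap_iff]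
    refine tendsto_ratioFilter_perturb (g := fun n => n / p * p) (c := p) (fun n => ?_) (fun n => ?_)
    · have := Nat.div_add_mod' n p
      have := Nat.mod_lt n hp
      omega
    · have := Nat.div_mul_le_self n p
      omega
  have hj : ∀ j < p, Tendsto (fun x : ℕ × ℕ => a (x.1 * p + j) x.2) G (𝓝 (α j)) := by
    intro j hj
    refine tendsto_of_seq_tendsto fun y hy => ?_
    refine h j hj (fun i => (y i).1) (fun i => (y i).2) (isRatioSeq_iff.2 ?_)
    rw [hG, tendsto_comap_iff] at hy
    exact hy
  rw [Metric.tendsto_nhds]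
  intro ε hε
  have hall : ∀ᶠ x in G, ∀ j < p, ‖a (x.1 * p + j) x.2 - α j‖ < ε := by
    have : ∀ᶠ x in G, ∀ j ∈ Finset.range p, ‖a (x.1 * p + j) x.2 - α j‖ < ε := by
      rw [Filter.eventually_all_finset]
      intro j hjp
      have := (Metric.tendsto_nhds.1 (hj j (Finset.mem_range.1 hjp))) ε hε
      simpa only [dist_eq_norm] using this
    exact this.mono fun x hx j hjp => hx j (Finset.mem_range.2 hjp)
  filter_upwards [hφ.eventually hall] with x hx
  have := hx (x.1 % p) (Nat.mod_lt _ hp)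
  -- The residue of `n` modulo `p` varies with `n`, which is why the bounds for all `j < p` were
  -- made simultaneous.
  rw [Nat.div_add_mod', hper.map_mod_nat] at this
  rwa [dist_zero_right]

/-! ### Families that tend to zero uniformly -/

/-- The family `h` of functions tends to zero uniformly on `K` along `l`. -/
def VanishesOn {ι : Type*} (l : Filter ι) (h : ι → ℂ → ℂ) (K : Set ℂ) : Prop :=
  ∀ ε > 0, ∀ᶠ x in l, ∀ z ∈ K, ‖h x z‖ < ε

namespace VanishesOn

variable {ι κ : Type*} {l : Filter ι} {h g : ι → ℂ → ℂ} {K K' : Set ℂ}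

theorem mono (hh : VanishesOn l h K) (hK : K' ⊆ K) : VanishesOn l h K' := fun ε hε =>
  (hh ε hε).mono fun _ hx z hz => hx z (hK hz)

theorem congr (hh : VanishesOn l h K) (hg : ∀ᶠ x in l, ∀ z ∈ K, h x z = g x z) :
    VanishesOn l g K := fun ε hε => by
  filter_upwards [hh ε hε, hg] with x h1 h2 z hz
  rw [← h2 z hz]
  exact h1 z hz

theorem comp {l' : Filter κ} {φ : κ → ι} (hh : VanishesOn l h K) (hφ : Tendsto φ l' l) :
    VanishesOn l' (fun x => h (φ x)) K := fun ε hε => hφ.eventually (hh ε hε)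

theorem add (hh : VanishesOn l h K) (hg : VanishesOn l g K) :
    VanishesOn l (fun x z => h x z + g x z) K := fun ε hε => by
  filter_upwards [hh _ (half_pos hε), hg _ (half_pos hε)] with x h1 h2 z hz
  have := norm_add_le (h x z) (g x z)
  linarith [h1 z hz, h2 z hz]

theorem mul_bounded (hh : VanishesOn l h K) {M : ℝ} (hg : ∀ᶠ x in l, ∀ z ∈ K, ‖g x z‖ ≤ M) :
    VanishesOn l (fun x z => h x z * g x z) K := fun ε hε => by
  have hM : 0 < |M| + 1 := by positivity
  filter_upwards [hh _ (div_pos hε hM), hg] with x h1 h2 z hz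
  rw [norm_mul]
  have h3 := h1 z hz
  rw [lt_div_iff₀ hM] at h3
  refine lt_of_le_of_lt ?_ h3
  refine mul_le_mul_of_nonneg_left ?_ (norm_nonneg _)
  linarith [h2 z hz, le_abs_self M]

theorem sub (hh : VanishesOn l h K) (hg : VanishesOn l g K) :
    VanishesOn l (fun x z => h x z - g x z) K := by
  refine (hh.add (hg.mul_bounded (g := fun _ _ => -1) (M := 1)
    (Eventually.of_forall fun _ _ _ => by simp))).congr (Eventually.of_forall fun x z _ => by ring)

theorem union (hh : VanishesOn l h K) (hg : VanishesOn l h K') : VanishesOn l h (K ∪ K') :=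
  fun ε hε => by
    filter_upwards [hh ε hε, hg ε hε] with x h1 h2 z hz
    exact hz.elim (h1 z) (h2 z)

/-- If `u x → 1` and `v x → G` uniformly and `v` is bounded, then `v x * u x → G` uniformly. -/
theorem mul_sub {u v : ι → ℂ → ℂ} {G : ℂ → ℂ} {M : ℝ} (hv : VanishesOn l (fun x z => v x z - G z) K)
    (hu : VanishesOn l (fun x z => u x z - 1) K) (hM : ∀ᶠ x in l, ∀ z ∈ K, ‖v x z‖ ≤ M) :
    VanishesOn l (fun x z => v x z * u x z - G z) K :=
  (hv.add (hu.mul_bounded hM)).congr (Eventually.of_forall fun x z _ => by ring)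

theorem bounded {v : ι → ℂ → ℂ} {G : ℂ → ℂ} {M : ℝ} (hv : VanishesOn l (fun x z => v x z - G z) K)
    (hG : ∀ z ∈ K, ‖G z‖ ≤ M) : ∀ᶠ x in l, ∀ z ∈ K, ‖v x z‖ ≤ M + 1 := by
  filter_upwards [hv 1 one_pos] with x hx z hz
  have := norm_add_le (v x z - G z) (G z)
  rw [sub_add_cancel] at this
  linarith [hx z hz, hG z hz]

/-- Induction by the product rule: replace one factor at a time and bound the others. -/
theorem prod_sub {u v : ℕ → ι → ℂ → ℂ} {M : ℝ} (m : ℕ)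
    (hu : ∀ j < m, ∀ᶠ x in l, ∀ z ∈ K, ‖u j x z‖ ≤ M)
    (hv : ∀ j < m, ∀ᶠ x in l, ∀ z ∈ K, ‖v j x z‖ ≤ M)
    (huv : ∀ j < m, VanishesOn l (fun x z => u j x z - v j x z) K) :
    VanishesOn l (fun x z => ∏ j ∈ Finset.range m, u j x z - ∏ j ∈ Finset.range m, v j x z) K := by
  induction m with
  | zero => intro ε hε; simpa using Eventually.of_forall fun _ _ _ => hε
  | succ m ih =>
    have h1 := ih (fun j hj => hu j (by omega)) (fun j hj => hv j (by omega))
      (fun j hj => huv j (by omega))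
    have hb : ∀ᶠ x in l, ∀ z ∈ K, ‖∏ j ∈ Finset.range m, v j x z‖ ≤ |M| ^ m := by
      have : ∀ᶠ x in l, ∀ j ∈ Finset.range m, ∀ z ∈ K, ‖v j x z‖ ≤ M := by
        rw [Filter.eventually_all_finset]
        exact fun j hj => hv j (by have := Finset.mem_range.1 hj; omega)
      filter_upwards [this] with x hx z hz
      rw [norm_prod]
      refine (Finset.prod_le_prod (fun _ _ => norm_nonneg _)
        (fun j hj => (hx j hj z hz).trans (le_abs_self M))).trans ?_
      simp
    refine ((h1.mul_bounded (hu m (by omega))).add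
      ((huv m (by omega)).mul_bounded hb)).congr (Eventually.of_forall fun x z _ => ?_)
    simp only [Finset.prod_range_succ]
    ring

end VanishesOn

/-! ### Ratio asymptotics inside and outside the circle -/

/-- `Φ_n / Φ_n^*` on the closed disk, as a function of the index pair. -/
def schurRatio (a : ℕ → ℕ → ℂ) (x : ℕ × ℕ) (z : ℂ) : ℂ :=
  schurIterate (fun m => a m x.2) z 1 x.1

/-- The value `Φ_{n,N}(z)`. -/
def opucVal (a : ℕ → ℕ → ℂ) (x : ℕ × ℕ) (z : ℂ) : ℂ :=
  (opuc (fun m => a m x.2) x.1).eval z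

/-- The value `Φ_{n,N}^*(z)`. -/
def starVal (a : ℕ → ℕ → ℂ) (x : ℕ × ℕ) (z : ℂ) : ℂ :=
  (opucStar (fun m => a m x.2) x.1).eval z

section Asymptotics

variable {p : ℕ} {α : ℕ → ℂ} {a : ℕ → ℕ → ℂ} {t : ℝ}

theorem vanishesOn_schurRatio_sub (hp : 0 < p) (hα : ∀ n, ‖α n‖ < 1)
    (hper : Function.Periodic α p) (ha : ∀ n N, ‖a n N‖ < 1)
    (hlim : Tendsto (fun x : ℕ × ℕ => a x.1 x.2 - α x.1) (ratioFilter t) (𝓝 0))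
    {r : ℝ} (hr : r < 1) :
    VanishesOn (ratioFilter t) (fun x z => schurRatio a x z - periodicSchur p α z x.1)
      (Metric.closedBall 0 r) := by
  intro ε hε
  obtain ⟨m, η, hη, h⟩ := exists_schurIterate_sub_periodicSchur_lt hp hα hper hr hε
  have hev : ∀ᶠ x in ratioFilter t, ∀ j ∈ Finset.range m,
      ‖a (x.1 - m + j) x.2 - α (x.1 - m + j)‖ < η := by
    rw [Filter.eventually_all_finset]
    intro j hj
    have hj' := Finset.mem_range.1 hj
    have := hlim.comp (tendsto_ratioFilter_perturb (t := t) (g := fun n => n - m + j) (c := m)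
      (fun n => by omega) (fun n => by omega))
    simpa [dist_eq_norm] using Metric.tendsto_nhds.1 this η hη
  filter_upwards [hev, eventually_ratioFilter_ge t m] with x h1 h2 z hz
  exact h _ (fun n => ha n x.2) x.1 h2 (fun j hj => h1 j (Finset.mem_range.2 hj)) z (by simpa using hz)

/-- The comparison function depends on `n`, but it is the same at `n` and `n + p`. -/
theorem vanishesOn_schurRatio_add_sub (hp : 0 < p) (hα : ∀ n, ‖α n‖ < 1)
    (hper : Function.Periodic α p) (ha : ∀ n N, ‖a n N‖ < 1)
    (hlim : Tendsto (fun x : ℕ × ℕ => a x.1 x.2 - α x.1) (ratioFilter t) (𝓝 0))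
    {r : ℝ} (hr : r < 1) :
    VanishesOn (ratioFilter t) (fun x z => schurRatio a (x.1 + p, x.2) z - schurRatio a x z)
      (Metric.closedBall 0 r) := by
  have h := vanishesOn_schurRatio_sub hp hα hper ha hlim hr
  refine ((h.comp (tendsto_ratioFilter_add t p)).sub h).congr
    (Eventually.of_forall fun x z hz => ?_)
  have hz1 : ‖z‖ < 1 := by
    rw [mem_closedBall_zero_iff] at hz
    exact hz.trans_lt hr
  dsimp only
  rw [periodic_periodicSchur hp hα hper hz1 x.1]
  ring

theorem starVal_add (ha : ∀ n N, ‖a n N‖ < 1) {z : ℂ} (hz : ‖z‖ ≤ 1) (x : ℕ × ℕ) (m : ℕ) :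
    starVal a (x.1 + m, x.2) z = (∏ j ∈ Finset.range m,
      (1 - a (x.1 + j) x.2 * z * schurRatio a (x.1 + j, x.2) z)) * starVal a x z := by
  induction m with
  | zero => simp
  | succ m ih =>
    rw [Finset.prod_range_succ, mul_right_comm, ← ih, starVal, ← add_assoc,
      eval_opucStar_succ_eq (fun n => ha n x.2) hz, mul_comm]
    rfl

/-- Factor by factor, the product over indices `n, …, n + p - 1` approaches a product over one
period of `1 - α_j z s_j`, and the latter does not depend on where the period starts. -/
theorem vanishesOn_starRatio (hp : 0 < p) (hα : ∀ n, ‖α n‖ < 1)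
    (hper : Function.Periodic α p) (ha : ∀ n N, ‖a n N‖ < 1)
    (hlim : Tendsto (fun x : ℕ × ℕ => a x.1 x.2 - α x.1) (ratioFilter t) (𝓝 0))
    {r : ℝ} (hr : r < 1) :
    VanishesOn (ratioFilter t)
      (fun x z => starVal a (x.1 + p, x.2) z / starVal a x z - gDelta p α z)
      (Metric.closedBall 0 r) := by
  have hz1 : ∀ z ∈ Metric.closedBall (0 : ℂ) r, ‖z‖ < 1 := fun z hz => by
    rw [mem_closedBall_zero_iff] at hz
    exact hz.trans_lt hr
  have hbd : ∀ c z w : ℂ, ‖c‖ ≤ 1 → ‖z‖ < 1 → ‖w‖ ≤ 1 → ‖1 - c * z * w‖ ≤ 2 := by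
    intro c z w hc hz hw
    refine (norm_sub_le _ _).trans ?_
    rw [norm_one, norm_mul]
    have h1 := norm_mul_le_one hc hz.le
    have : ‖c * z‖ * ‖w‖ ≤ 1 := mul_le_one₀ h1 (norm_nonneg _) hw
    linarith
  let u : ℕ → ℕ × ℕ → ℂ → ℂ :=
    fun j x z => 1 - a (x.1 + j) x.2 * z * schurRatio a (x.1 + j, x.2) z
  let v : ℕ → ℕ × ℕ → ℂ → ℂ :=
    fun j x z => 1 - α (x.1 + j) * z * periodicSchur p α z (x.1 + j)
  have hu : ∀ j < p, ∀ᶠ x in ratioFilter t, ∀ z ∈ Metric.closedBall (0 : ℂ) r, ‖u j x z‖ ≤ 2 :=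
    fun j _ => Eventually.of_forall fun x z hz => hbd _ _ _ (ha _ _).le (hz1 z hz)
      (norm_schurIterate_le (fun n => ha n _) (hz1 z hz).le norm_one.le _)
  have hv : ∀ j < p, ∀ᶠ x in ratioFilter t, ∀ z ∈ Metric.closedBall (0 : ℂ) r, ‖v j x z‖ ≤ 2 :=
    fun j _ => Eventually.of_forall fun x z hz => hbd _ _ _ (hα _).le (hz1 z hz)
      (norm_periodicSchur_le hp hα hper (hz1 z hz) _)
  have huv : ∀ j < p, VanishesOn (ratioFilter t) (fun x z => u j x z - v j x z)
      (Metric.closedBall 0 r) := by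
    intro j _
    have hj := tendsto_ratioFilter_add t j
    have h1 := (vanishesOn_schurRatio_sub hp hα hper ha hlim hr).comp hj
    have h2 : VanishesOn (ratioFilter t)
        (fun x _ => a (x.1 + j) x.2 - α (x.1 + j)) (Metric.closedBall 0 r) := fun ε hε => by
      filter_upwards [Metric.tendsto_nhds.1 (hlim.comp hj) ε hε] with x hx z _
      simpa [dist_eq_norm] using hx
    refine ((h1.mul_bounded (g := fun x z => -(a (x.1 + j) x.2 * z)) (M := 1)
      (Eventually.of_forall fun x z hz => ?_)).add
      (h2.mul_bounded (g := fun x z => -(z * periodicSchur p α z (x.1 + j))) (M := 1)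
      (Eventually.of_forall fun x z hz => ?_))).congr (Eventually.of_forall fun x z _ => ?_)
    · rw [norm_neg]
      exact norm_mul_le_one (ha _ _).le (hz1 z hz).le
    · rw [norm_neg]
      exact norm_mul_le_one (hz1 z hz).le (norm_periodicSchur_le hp hα hper (hz1 z hz) _)
    · simp only [u, v]
      ring
  have key := VanishesOn.prod_sub p hu hv huv
  refine key.congr (Eventually.of_forall fun x z hz => ?_)
  have h0 : starVal a x z ≠ 0 :=
    (eval_opucStar_ne_zero_and_le (fun n => ha n x.2) (hz1 z hz).le x.1).1
  rw [starVal_add ha (hz1 z hz).le, mul_div_cancel_right₀ _ h0,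
    gDelta_eq_diskLimit hp hα hper (hz1 z hz), diskLimit_eq_prod hp hα hper (hz1 z hz) x.1]

/-- The coefficients with conjugation, which govern the exterior of the disk. -/
def conjCoeff (a : ℕ → ℕ → ℂ) (n N : ℕ) : ℂ := starRingEnd ℂ (a n N)

theorem starVal_div_opucVal (ha : ∀ n N, ‖a n N‖ < 1) {z : ℂ} (hz : 1 ≤ ‖z‖) (x : ℕ × ℕ) :
    starVal a x z / opucVal a x z = schurRatio (conjCoeff a) x z⁻¹ := by
  have hz0 : z ≠ 0 := norm_pos_iff.1 (one_pos.trans_le hz)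
  have hw : ‖z⁻¹‖ ≤ 1 := by
    rw [norm_inv]
    exact inv_le_one_of_one_le₀ hz
  have ha' : ∀ n, ‖conjCoeff a n x.2‖ < 1 := fun n => by simpa [conjCoeff] using ha n x.2
  have h := (eval_opucStar_ne_zero_and_le ha' hw x.1).1
  have h1 := eval_opuc_inv (fun m => a m x.2) hz0 x.1
  rw [starVal, opucVal, h1.1, h1.2, mul_div_mul_left _ _ (pow_ne_zero _ hz0)]
  change (opuc (fun n => conjCoeff a n x.2) x.1).eval z⁻¹ /
    (opucStar (fun n => conjCoeff a n x.2) x.1).eval z⁻¹ = _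
  rw [eval_opuc_eq ha' hw, mul_div_cancel_right₀ _ h]
  rfl

theorem opucVal_div (a : ℕ → ℕ → ℂ) {z : ℂ} (hz : z ≠ 0) (x : ℕ × ℕ) (m : ℕ) :
    opucVal a (x.1 + m, x.2) z / opucVal a x z =
      z ^ m * (starVal (conjCoeff a) (x.1 + m, x.2) z⁻¹ / starVal (conjCoeff a) x z⁻¹) := by
  rw [opucVal, opucVal, (eval_opuc_inv _ hz _).1, (eval_opuc_inv _ hz _).1, pow_add, mul_assoc,
    mul_div_mul_left _ _ (pow_ne_zero _ hz), mul_div_assoc]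
  rfl

theorem tendsto_conjCoeff
    (hlim : Tendsto (fun x : ℕ × ℕ => a x.1 x.2 - α x.1) (ratioFilter t) (𝓝 0)) :
    Tendsto (fun x : ℕ × ℕ => conjCoeff a x.1 x.2 - starRingEnd ℂ (α x.1)) (ratioFilter t)
      (𝓝 0) := by
  have := (Complex.continuous_conj.tendsto 0).comp hlim
  rw [map_zero] at this
  exact this.congr fun x => by simp [conjCoeff]

theorem VanishesOn.comp_inv {ι : Type*} {l : Filter ι} {h : ι → ℂ → ℂ} {r : ℝ} {K : Set ℂ}
    (hh : VanishesOn l h (Metric.closedBall 0 r)) (hK : ∀ z ∈ K, ‖z⁻¹‖ ≤ r) :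
    VanishesOn l (fun x z => h x z⁻¹) K := fun ε hε =>
  (hh ε hε).mono fun _ hx z hz => hx z⁻¹ (by simpa using hK z hz)

theorem vanishesOn_opucRatio (hp : 0 < p) (hα : ∀ n, ‖α n‖ < 1)
    (hper : Function.Periodic α p) (ha : ∀ n N, ‖a n N‖ < 1)
    (hlim : Tendsto (fun x : ℕ × ℕ => a x.1 x.2 - α x.1) (ratioFilter t) (𝓝 0))
    {r M : ℝ} (hr : r < 1) {K : Set ℂ} (hK : ∀ z ∈ K, 1 < ‖z‖ ∧ ‖z⁻¹‖ ≤ r ∧ ‖z‖ ≤ M) :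
    VanishesOn (ratioFilter t)
      (fun x z => opucVal a (x.1 + p, x.2) z / opucVal a x z - gDelta p α z) K := by
  have hα' : ∀ n, ‖starRingEnd ℂ (α n)‖ < 1 := fun n => by simpa using hα n
  have h := (vanishesOn_starRatio hp hα' (periodic_conj hper)
    (fun n N => by simpa [conjCoeff] using ha n N) (tendsto_conjCoeff hlim) hr).comp_inv
    fun z hz => (hK z hz).2.1
  refine (h.mul_bounded (g := fun _ z => z ^ p) (M := M ^ p)
    (Eventually.of_forall fun x z hz => ?_)).congr (Eventually.of_forall fun x z hz => ?_)
  · rw [norm_pow]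
    exact pow_le_pow_left₀ (norm_nonneg _) (hK z hz).2.2 p
  · have hz0 : z ≠ 0 := norm_pos_iff.1 (one_pos.trans (hK z hz).1)
    obtain ⟨-, -, -, -, h4⟩ := exists_eigenvalue hp hα hper hz0 (hK z hz).1.ne'
    rw [opucVal_div a hz0, h4 (hK z hz).1, gDelta_eq_diskLimit hp hα' (periodic_conj hper)
      ((hK z hz).2.1.trans_lt hr)]
    ring

end Asymptotics

/-! ### Propagation of convergence for bounded families -/

/-- A quantitative form of propagation: the Taylor coefficients at `c` satisfy Cauchy estimates from
the small disk, with `η`, and from the large disk, with `M`. The smaller one is taken termwise; the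
second makes the series converge and the first makes each term small. -/
theorem norm_le_tsum_min {h : ℂ → ℂ} {c : ℂ} {e R R' η M : ℝ} (he : 0 < e) (hR' : 0 ≤ R')
    (hR : R' < R) (hd : DifferentiableOn ℂ h (Metric.ball c R)) (hη : 0 ≤ η) (heR : e < R)
    (hM : ∀ z ∈ Metric.ball c R, ‖h z‖ ≤ M) (hs : ∀ z ∈ Metric.closedBall c e, ‖h z‖ ≤ η)
    {z : ℂ} (hz : z ∈ Metric.closedBall c R') :
    ‖h z‖ ≤ ∑' k : ℕ, min (η * (R' / e) ^ k) (M * (2 * R' / (R' + R)) ^ k) := by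
  -- An intermediate radius: `h` is holomorphic only on the open disk of radius `R`, and the ratio
  -- `R' / R₁` is still less than one.
  set R₁ := (R' + R) / 2 with hR₁
  have hR0 : 0 < R := hR'.trans_lt hR
  have h1 : R' < R₁ := by rw [hR₁]; linarith
  have h2 : R₁ < R := by rw [hR₁]; linarith
  have h3 : 0 < R₁ := hR'.trans_lt h1
  have hM0 : 0 ≤ M := (norm_nonneg _).trans (hM c (Metric.mem_ball_self hR0))
  have hdc : ∀ s < R, DiffContOnCl ℂ h (Metric.ball c s) := fun s hs =>
    (hd.mono ((Metric.closedBall_subset_ball hs))).diffContOnCl_ball subset_rfl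
  have e1 : ∀ k : ℕ, ‖iteratedDeriv k h c‖ ≤ k.factorial * η / e ^ k := fun k =>
    Complex.norm_iteratedDeriv_le_of_forall_mem_sphere_norm_le k he (hdc e heR)
      fun z hz => hs z (Metric.sphere_subset_closedBall hz)
  have e2 : ∀ k : ℕ, ‖iteratedDeriv k h c‖ ≤ k.factorial * M / R₁ ^ k := fun k =>
    Complex.norm_iteratedDeriv_le_of_forall_mem_sphere_norm_le k h3 (hdc R₁ h2)
      fun z hz => hM z (Metric.sphere_subset_closedBall.trans (Metric.closedBall_subset_ball h2) hz)
  have hzR : z ∈ Metric.ball c R := Metric.closedBall_subset_ball hR hz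
  have hzc : ‖z - c‖ ≤ R' := by rwa [← dist_eq_norm]
  have hq : 2 * R' / (R' + R) = R' / R₁ := by
    rw [hR₁]
    field_simp
  rw [← (Complex.hasSum_taylorSeries_on_ball hd hzR).tsum_eq, hq]
  have hq1 : R' / R₁ < 1 := (div_lt_one h3).2 h1
  have hq0 : 0 ≤ R' / R₁ := div_nonneg hR' h3.le
  refine tsum_of_norm_bounded (Summable.hasSum ?_) fun k => ?_
  · exact Summable.of_nonneg_of_le (fun k => le_min (by positivity) (by positivity))
      (fun k => min_le_right _ _) ((summable_geometric_of_lt_one hq0 hq1).mul_left M)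
  · have hf : (0 : ℝ) < k.factorial := by exact_mod_cast k.factorial_pos
    have aux : ∀ {C s : ℝ}, 0 ≤ C → 0 < s → ‖iteratedDeriv k h c‖ ≤ k.factorial * C / s ^ k →
        ‖((k.factorial : ℂ)⁻¹ • (z - c) ^ k • iteratedDeriv k h c)‖ ≤ C * (R' / s) ^ k := by
      intro C s hC hs hk
      rw [norm_smul, norm_smul, norm_inv, norm_pow, Complex.norm_natCast]
      calc (k.factorial : ℝ)⁻¹ * (‖z - c‖ ^ k * ‖iteratedDeriv k h c‖)
          ≤ (k.factorial : ℝ)⁻¹ * (R' ^ k * (k.factorial * C / s ^ k)) := by gcongr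
        _ = C * (R' / s) ^ k := by
          rw [div_pow]
          field_simp
    exact le_min (aux hη he (e1 k)) (aux hM0 h3 (e2 k))

theorem tendsto_tsum_min {A q M : ℝ} (hA : 0 ≤ A) (hM : 0 ≤ M) (hq0 : 0 ≤ q) (hq : q < 1) :
    Tendsto (fun η : ℝ => ∑' k : ℕ, min (η * A ^ k) (M * q ^ k)) (𝓝[>] 0) (𝓝 0) := by
  have h : Tendsto (fun η : ℝ => ∑' k : ℕ, min (η * A ^ k) (M * q ^ k)) (𝓝[>] 0)
      (𝓝 (∑' _ : ℕ, (0 : ℝ))) := by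
    refine tendsto_tsum_of_dominated_convergence
      ((summable_geometric_of_lt_one hq0 hq).mul_left M) (fun k => ?_) ?_
    · have hc : Continuous fun η : ℝ => min (η * A ^ k) (M * q ^ k) := by fun_prop
      have h0 : min (0 * A ^ k) (M * q ^ k) = 0 := by
        rw [zero_mul]
        exact min_eq_left (by positivity)
      have := hc.tendsto 0
      rw [h0] at this
      exact this.mono_left nhdsWithin_le_nhds
    · filter_upwards [self_mem_nhdsWithin] with η hη k
      have hη' : (0 : ℝ) < η := hη
      rw [Real.norm_of_nonneg (le_min (by positivity) (by positivity))]
      exact min_le_right _ _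
  simpa using h

/-- A bounded family of holomorphic functions on a disk that tends to zero uniformly on a small
concentric disk does so on each smaller concentric disk. -/
theorem VanishesOn.of_bounded {ι : Type*} {l : Filter ι} {h : ι → ℂ → ℂ} {c : ℂ} {e R R' M : ℝ}
    (he : 0 < e) (hR' : 0 ≤ R') (hR : R' < R) (heR : e < R)
    (hd : ∀ᶠ x in l, DifferentiableOn ℂ (h x) (Metric.ball c R))
    (hM : ∀ᶠ x in l, ∀ z ∈ Metric.ball c R, ‖h x z‖ ≤ M)
    (hs : VanishesOn l h (Metric.closedBall c e)) :
    VanishesOn l h (Metric.closedBall c R') := by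
  intro ε hε
  have hR0 : 0 < R := hR'.trans_lt hR
  have ht := tendsto_tsum_min (A := R' / e) (q := 2 * R' / (R' + R)) (M := |M|) (by positivity)
    (abs_nonneg M) (by positivity) (by rw [div_lt_one (by positivity)]; linarith)
  obtain ⟨η, hη, hη0⟩ := ((ht.eventually (gt_mem_nhds hε)).and self_mem_nhdsWithin).exists
  have hη0' : (0 : ℝ) < η := hη0
  filter_upwards [hd, hM, hs η hη0'] with x h1 h2 h3 z hz
  exact (norm_le_tsum_min he hR' hR h1 hη0'.le heR (fun z hz => (h2 z hz).trans (le_abs_self M))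
    (fun z hz => (h3 z hz).le) hz).trans_lt hη

/-- A bounded family of holomorphic functions near a point of the unit circle that tends to zero
uniformly on smaller disks does so near that point. -/
theorem VanishesOn.of_bounded_near_circle {ι : Type*} {l : Filter ι} {h : ι → ℂ → ℂ} {ζ : ℂ}
    (hζ : ‖ζ‖ = 1) {e M : ℝ} (he : 0 < e) (he1 : e ≤ 1)
    (hd : ∀ᶠ x in l, DifferentiableOn ℂ (h x) (Metric.ball ζ e))
    (hM : ∀ᶠ x in l, ∀ z ∈ Metric.ball ζ e, ‖h x z‖ ≤ M)
    (hs : ∀ r < 1, VanishesOn l h (Metric.closedBall 0 r)) :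
    VanishesOn l h (Metric.closedBall ζ (e / 4)) := by
  -- A centre slightly inside the circle: its disk of radius `e / 8` stays in `|z| ≤ 1 - e / 8`,
  -- that of radius `3e / 4` stays near `ζ`, and that of radius `e / 2` covers the target.
  set c : ℂ := ((1 - e / 4 : ℝ) : ℂ) * ζ with hc
  have hcζ : dist c ζ = e / 4 := by
    have : c - ζ = ((-(e / 4) : ℝ) : ℂ) * ζ := by rw [hc]; push_cast; ring
    rw [dist_eq_norm, this, norm_mul, hζ, mul_one, Complex.norm_real, norm_neg,
      Real.norm_of_nonneg (by positivity)]
  have hc0 : dist c 0 = 1 - e / 4 := by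
    rw [dist_zero_right, hc, norm_mul, hζ, mul_one, Complex.norm_real,
      Real.norm_of_nonneg (by linarith)]
  have hsub : Metric.ball c (3 * e / 4) ⊆ Metric.ball ζ e :=
    Metric.ball_subset_ball' (by rw [hcζ]; linarith)
  refine (VanishesOn.of_bounded (c := c) (e := e / 8) (R := 3 * e / 4) (R' := e / 2) (M := M)
    (by positivity) (by positivity) (by linarith) (by linarith)
    (hd.mono fun x hx => hx.mono hsub) (hM.mono fun x hx z hz => hx z (hsub hz))
    ((hs (1 - e / 8) (by linarith)).mono
      (Metric.closedBall_subset_closedBall' (by rw [hc0]; linarith)))).mono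
    (Metric.closedBall_subset_closedBall' (by rw [dist_comm, hcζ]; linarith))

/-! ### Bounds near arcs without zeros -/

section CircleBounds

variable {A B : ℂ → ℂ} {β ζ : ℂ}

/-- The Carathéodory bound `(1 + |z|) / |1 - |z||` for the Cayley transform of `β z B / A`, with
denominators cleared and valid on both sides of the circle; `9` is `(1 + |z|)²` at `|z| = 2`. -/
theorem norm_cayley_mul_le (hin : ∀ z, ‖z‖ ≤ 1 → ‖B z‖ ≤ ‖A z‖)
    (hout : ∀ z, 1 ≤ ‖z‖ → ‖A z‖ ≤ ‖B z‖) (hβ : ‖β‖ = 1) {z : ℂ} (hz : ‖z‖ ≤ 2) :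
    ‖A z + β * z * B z‖ * |‖z‖ ^ 2 - 1| ≤ 9 * ‖A z - β * z * B z‖ := by
  have hn : ‖β * z * B z‖ = ‖z‖ * ‖B z‖ := by rw [norm_mul, norm_mul, hβ, one_mul]
  have h1 := norm_add_le (A z) (β * z * B z)
  have h0 := norm_nonneg z
  have hA := norm_nonneg (A z)
  have hB := norm_nonneg (B z)
  rcases le_total ‖z‖ 1 with h | h
  · have h2 := norm_sub_norm_le (A z) (β * z * B z)
    rw [hn] at h1 h2
    have h3 := hin z h
    have h4 : ‖A z + β * z * B z‖ ≤ (1 + ‖z‖) * ‖A z‖ := by nlinarith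
    have h5 : (1 - ‖z‖) * ‖A z‖ ≤ ‖A z - β * z * B z‖ := by nlinarith
    rw [abs_of_nonpos (by nlinarith)]
    calc ‖A z + β * z * B z‖ * -(‖z‖ ^ 2 - 1)
        ≤ (1 + ‖z‖) * ‖A z‖ * -(‖z‖ ^ 2 - 1) := by
          refine mul_le_mul_of_nonneg_right h4 (by nlinarith)
      _ = (1 + ‖z‖) ^ 2 * ((1 - ‖z‖) * ‖A z‖) := by ring
      _ ≤ 9 * ((1 - ‖z‖) * ‖A z‖) := by
          refine mul_le_mul_of_nonneg_right (by nlinarith) (mul_nonneg (by linarith) hA)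
      _ ≤ _ := by linarith
  · have h2 := norm_sub_norm_le (β * z * B z) (A z)
    rw [norm_sub_rev] at h2
    rw [hn] at h1 h2
    have h3 := hout z h
    have h4 : ‖A z + β * z * B z‖ ≤ (1 + ‖z‖) * ‖B z‖ := by nlinarith
    have h5 : (‖z‖ - 1) * ‖B z‖ ≤ ‖A z - β * z * B z‖ := by nlinarith
    rw [abs_of_nonneg (by nlinarith)]
    calc ‖A z + β * z * B z‖ * (‖z‖ ^ 2 - 1)
        ≤ (1 + ‖z‖) * ‖B z‖ * (‖z‖ ^ 2 - 1) := by
          refine mul_le_mul_of_nonneg_right h4 (by nlinarith)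
      _ = (1 + ‖z‖) ^ 2 * ((‖z‖ - 1) * ‖B z‖) := by ring
      _ ≤ 9 * ((‖z‖ - 1) * ‖B z‖) := by
          refine mul_le_mul_of_nonneg_right (by nlinarith) (mul_nonneg (by linarith) hB)
      _ ≤ _ := by linarith

theorem norm_le_two_of_mem {s : ℝ} (hζ : ‖ζ‖ = 1) (hs : s ≤ 1 / 2) {z : ℂ}
    (hz : z ∈ Metric.closedBall ζ s) : 1 / 2 ≤ ‖z‖ ∧ ‖z‖ ≤ 2 := by
  rw [Metric.mem_closedBall, dist_eq_norm] at hz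
  have h1 := norm_sub_norm_le z ζ
  have h2 := norm_sub_norm_le ζ z
  rw [norm_sub_rev] at h2
  constructor <;> linarith

/-- The bound of `norm_cayley_mul_le` blows up where the circle around `ζ` crosses the unit circle.
A polynomial with zeros at these crossings absorbs this, and the maximum principle carries the
estimate inside. -/
theorem norm_cayley_le (hA : Differentiable ℂ A) (hB : Differentiable ℂ B)
    (hin : ∀ z, ‖z‖ ≤ 1 → ‖B z‖ ≤ ‖A z‖) (hout : ∀ z, 1 ≤ ‖z‖ → ‖A z‖ ≤ ‖B z‖)
    (hβ : ‖β‖ = 1) (hζ : ‖ζ‖ = 1) {s : ℝ} (hs0 : 0 < s) (hs : s ≤ 1 / 2)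
    (hQ : ∀ z ∈ Metric.closedBall ζ s, A z - β * z * B z ≠ 0) {z : ℂ}
    (hz : z ∈ Metric.closedBall ζ (s / 2)) :
    ‖(A z + β * z * B z) / (A z - β * z * B z)‖ ≤ 18 / s := by
  set F : ℂ → ℂ := fun z => (A z + β * z * B z) / (A z - β * z * B z) with hF
  set u : ℂ → ℂ := fun z => starRingEnd ℂ ζ * (z - ζ) with hu
  set q : ℂ → ℂ := fun z => u z ^ 2 + s ^ 2 * u z + s ^ 2 with hq
  have hFd : DifferentiableOn ℂ F (Metric.closedBall ζ s) := by
    refine DifferentiableOn.div ?_ ?_ hQ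
    · exact (by fun_prop : Differentiable ℂ fun z => A z + β * z * B z).differentiableOn
    · exact (by fun_prop : Differentiable ℂ fun z => A z - β * z * B z).differentiableOn
  have hqd : Differentiable ℂ q := by fun_prop
  have hcl : closure (Metric.ball ζ s) = Metric.closedBall ζ s := closure_ball _ hs0.ne'
  have hζζ : starRingEnd ℂ ζ * ζ = 1 := by
    rw [mul_comm, Complex.mul_conj', hζ]
    simp
  have hun : ∀ z, ‖u z‖ = dist z ζ := fun z => by
    rw [hu, dist_eq_norm, norm_mul, RCLike.norm_conj, hζ, one_mul]
  have hbound : ∀ z ∈ closure (Metric.ball ζ s), ‖F z * q z‖ ≤ 9 * s := by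
    intro z hz
    refine Complex.norm_le_of_forall_mem_frontier_norm_le Metric.isBounded_ball
      ((hFd.mul hqd.differentiableOn).diffContOnCl_ball subset_rfl) (fun z hz => ?_) hz
    rw [frontier_ball _ hs0.ne'] at hz
    have hzc := Metric.sphere_subset_closedBall hz
    have hus : ‖u z‖ = s := by rw [hun]; exact hz
    -- With `z = ζ (1 + u)` one has `|z|² - 1 = u + conj u + |u|²`; on `|u| = s`, multiplication by
    -- `u` makes this the polynomial `q`.
    have hqz : q z = u z * ((‖z‖ ^ 2 - 1 : ℝ) : ℂ) := by
      have h1 : z = ζ * (1 + u z) := by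
        simp only [hu]
        linear_combination (ζ - z) * hζζ
      have h2 : ((‖z‖ ^ 2 : ℝ) : ℂ) = (1 + u z) * (1 + starRingEnd ℂ (u z)) := by
        have : ‖z‖ = ‖1 + u z‖ := by
          conv_lhs => rw [h1]
          rw [norm_mul, hζ, one_mul]
        rw [this, Complex.ofReal_pow, ← Complex.mul_conj']
        simp
      have h3 : u z * starRingEnd ℂ (u z) = (s : ℂ) ^ 2 := by
        rw [Complex.mul_conj', hus]
      rw [Complex.ofReal_sub, h2]
      simp only [hq, Complex.ofReal_one]
      linear_combination (-u z - 1) * h3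
    have hQz := norm_pos_iff.2 (hQ z hzc)
    have h4 := norm_cayley_mul_le hin hout hβ (norm_le_two_of_mem hζ hs hzc).2
    change ‖F z * q z‖ ≤ _
    rw [hqz, norm_mul, norm_mul (u z), hus, Complex.norm_real, Real.norm_eq_abs]
    have h5 : ‖F z‖ * |‖z‖ ^ 2 - 1| ≤ 9 := by
      rw [hF, norm_div, div_mul_eq_mul_div, div_le_iff₀ hQz]
      exact h4
    nlinarith
  have h1 := hbound z (by
    rw [hcl]
    exact Metric.closedBall_subset_closedBall (by linarith) hz)
  -- On the half disk, where `|u| ≤ s / 2 ≤ 1 / 4`, the constant term `s²` dominates the other two.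
  have h2 : s ^ 2 / 2 ≤ ‖q z‖ := by
    have hu2 : ‖u z‖ ≤ s / 2 := by rw [hun]; exact hz
    have h3 : ‖u z ^ 2 + s ^ 2 * u z‖ ≤ s ^ 2 / 2 := by
      refine (norm_add_le _ _).trans ?_
      rw [norm_pow (u z), norm_mul _ (u z), norm_pow (s : ℂ), Complex.norm_real,
        Real.norm_of_nonneg hs0.le]
      have := norm_nonneg (u z)
      have h4 : ‖u z‖ ^ 2 ≤ (s / 2) ^ 2 := by gcongr
      have h5 : s ^ 2 * ‖u z‖ ≤ s ^ 2 * (1 / 4) := by gcongr; linarith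
      nlinarith
    have h4 := norm_sub_norm_le ((s : ℂ) ^ 2) (-(u z ^ 2 + s ^ 2 * u z))
    rw [norm_neg, norm_pow, Complex.norm_real, Real.norm_of_nonneg hs0.le, sub_neg_eq_add,
      add_comm ((s : ℂ) ^ 2) (u z ^ 2 + (s : ℂ) ^ 2 * u z)] at h4
    simp only [hq]
    linarith
  rw [norm_mul] at h1
  rw [le_div_iff₀ hs0]
  change ‖F z‖ * s ≤ 18
  have h3 : ‖F z‖ * (s ^ 2 / 2) ≤ 9 * s :=
    (mul_le_mul_of_nonneg_left h2 (norm_nonneg _)).trans h1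
  nlinarith

/-- Bounds near a point of the circle at a distance from the zeros of `A - β z B`, which depend
on that distance alone. -/
theorem bounds_near_circle (hA : Differentiable ℂ A) (hB : Differentiable ℂ B)
    (hin : ∀ z, ‖z‖ ≤ 1 → ‖B z‖ ≤ ‖A z‖) (hout : ∀ z, 1 ≤ ‖z‖ → ‖A z‖ ≤ ‖B z‖)
    (hβ : ‖β‖ = 1) (hζ : ‖ζ‖ = 1) {s : ℝ} (hs0 : 0 < s) (hs : s ≤ 1 / 2)
    (hQ : ∀ z ∈ Metric.closedBall ζ s, A z - β * z * B z ≠ 0) {z : ℂ}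
    (hz : z ∈ Metric.ball ζ (s ^ 2 / 148)) :
    A z ≠ 0 ∧ B z ≠ 0 ∧ A z - β * z * B z ≠ 0 ∧ ‖B z / A z‖ ≤ 4 * (18 / s + 1) ∧
      ‖A z / B z‖ ≤ 4 * (18 / s + 1) ∧ ‖A z / (A z - β * z * B z)‖ ≤ 4 * (18 / s + 1) := by
  set F : ℂ → ℂ := fun z => (A z + β * z * B z) / (A z - β * z * B z) with hF
  have hsub : Metric.ball ζ (s ^ 2 / 148) ⊆ Metric.ball ζ (s / 2) :=
    Metric.ball_subset_ball (by nlinarith)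
  have hzs := hsub hz
  have hFle : ∀ z ∈ Metric.ball ζ (s / 2), ‖F z‖ ≤ 18 / s := fun z hz =>
    norm_cayley_le hA hB hin hout hβ hζ hs0 hs hQ (Metric.ball_subset_closedBall hz)
  have hsubQ : Metric.ball ζ (s / 2) ⊆ Metric.closedBall ζ s :=
    (Metric.ball_subset_ball (by linarith)).trans Metric.ball_subset_closedBall
  have hFd : DifferentiableOn ℂ F (Metric.ball ζ (s / 2)) := by
    refine DifferentiableOn.div ?_ ?_ fun z hz => hQ z (hsubQ hz)
    · exact (by fun_prop : Differentiable ℂ fun z => A z + β * z * B z).differentiableOn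
    · exact (by fun_prop : Differentiable ℂ fun z => A z - β * z * B z).differentiableOn
  have hζmem : ζ ∈ Metric.ball ζ (s / 2) := Metric.mem_ball_self (by positivity)
  -- Schwarz's lemma gives the Lipschitz constant `72 / s²`, which explains the radius `s² / 148`.
  have hlip : ‖F z - F ζ‖ ≤ 1 / 2 := by
    have hmaps : Set.MapsTo F (Metric.ball ζ (s / 2)) (Metric.closedBall (F ζ) (36 / s)) := by
      intro w hw
      rw [Metric.mem_closedBall, dist_eq_norm]
      refine (norm_sub_le _ _).trans ((add_le_add (hFle w hw) (hFle ζ hζmem)).trans ?_)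
      rw [← add_div]
      norm_num
    have h := Complex.dist_le_div_mul_dist_of_mapsTo_ball hFd hmaps hzs
    rw [dist_eq_norm] at h
    rw [Metric.mem_ball] at hz
    refine h.trans ?_
    have e : 36 / s / (s / 2) = 72 / s ^ 2 := by
      field_simp
      norm_num
    rw [e]
    calc 72 / s ^ 2 * dist z ζ ≤ 72 / s ^ 2 * (s ^ 2 / 148) := by gcongr
      _ = 72 / 148 := by field_simp
      _ ≤ 1 / 2 := by norm_num
  have hplus : ∀ w ∈ Metric.ball ζ (s / 2), F w + 1 = 2 * (A w / (A w - β * w * B w)) := by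
    intro w hw
    have := hQ w (hsubQ hw)
    rw [hF]
    field_simp
    ring
  have hminus : ∀ w ∈ Metric.ball ζ (s / 2),
      F w - 1 = 2 * (β * w * B w / (A w - β * w * B w)) := by
    intro w hw
    have := hQ w (hsubQ hw)
    rw [hF]
    field_simp
    ring
  have hnorm : ∀ w, ‖β * w * B w / (A w - β * w * B w)‖ =
      ‖w‖ * ‖B w / (A w - β * w * B w)‖ := fun w => by
    rw [mul_div_assoc, norm_mul, norm_mul, hβ, one_mul]
  -- At `ζ` itself `|A| = |B|`, so `F ζ` is purely imaginary and at distance at least one from `±1`.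
  -- This keeps `A / Q` and `B / Q` away from zero nearby.
  have hpm : ‖F ζ + 1‖ = ‖F ζ - 1‖ := by
    rw [hplus ζ hζmem, hminus ζ hζmem, norm_mul, norm_mul, hnorm, hζ, one_mul, norm_div, norm_div,
      le_antisymm (hout ζ hζ.ge) (hin ζ hζ.le)]
  have hge : 1 ≤ ‖F ζ + 1‖ ∧ 1 ≤ ‖F ζ - 1‖ := by
    have h := norm_sub_le (F ζ + 1) (F ζ - 1)
    have e : F ζ + 1 - (F ζ - 1) = 2 := by ring
    rw [e, Complex.norm_ofNat] at h
    constructor <;> linarith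
  have hge' : 1 / 2 ≤ ‖F z + 1‖ ∧ 1 / 2 ≤ ‖F z - 1‖ := by
    have h1 := norm_sub_norm_le (F ζ + 1) (F z + 1)
    have h2 := norm_sub_norm_le (F ζ - 1) (F z - 1)
    have e1 : F ζ + 1 - (F z + 1) = -(F z - F ζ) := by ring
    have e2 : F ζ - 1 - (F z - 1) = -(F z - F ζ) := by ring
    rw [e1, norm_neg] at h1
    rw [e2, norm_neg] at h2
    constructor <;> linarith [hge.1, hge.2]
  have hle' : ‖F z + 1‖ ≤ 18 / s + 1 ∧ ‖F z - 1‖ ≤ 18 / s + 1 := by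
    have h1 := norm_add_le (F z) 1
    have h2 := norm_sub_le (F z) 1
    rw [norm_one] at h1 h2
    have := hFle z hzs
    constructor <;> linarith
  rw [hplus z hzs, hminus z hzs, norm_mul, norm_mul, hnorm, Complex.norm_ofNat] at hge' hle'
  set Q := A z - β * z * B z
  have hQz : Q ≠ 0 := hQ z (hsubQ hzs)
  obtain ⟨hzl, hzu⟩ := norm_le_two_of_mem hζ hs (hsubQ hzs)
  have hAQ : 1 / 4 ≤ ‖A z / Q‖ := by linarith
  have hBQ : 1 / 8 ≤ ‖B z / Q‖ := by nlinarith [norm_nonneg (B z / Q)]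
  have hA0 : A z ≠ 0 := by
    intro h
    rw [h, zero_div, norm_zero] at hAQ
    linarith
  have hB0 : B z ≠ 0 := by
    intro h
    rw [h, zero_div, norm_zero] at hBQ
    linarith
  have hM : 0 < 18 / s := by positivity
  refine ⟨hA0, hB0, hQz, ?_, ?_, ?_⟩
  · have e : B z / A z = (B z / Q) / (A z / Q) := by field_simp
    rw [e, norm_div, div_le_iff₀ (by linarith)]
    nlinarith [norm_nonneg (B z / Q)]
  · have e : A z / B z = (A z / Q) / (B z / Q) := by field_simp
    rw [e, norm_div, div_le_iff₀ (by linarith)]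
    nlinarith [norm_nonneg (A z / Q), norm_nonneg (B z / Q)]
  · linarith

end CircleBounds

/-! ### Convergence near points of the circle off the limit set -/

section Circle

variable {p : ℕ} {α : ℕ → ℂ} {a : ℕ → ℕ → ℂ} {t : ℝ}

theorem differentiable_starVal (a : ℕ → ℕ → ℂ) (x : ℕ × ℕ) : Differentiable ℂ (starVal a x) :=
  Polynomial.differentiable _

theorem differentiable_opucVal (a : ℕ → ℕ → ℂ) (x : ℕ × ℕ) : Differentiable ℂ (opucVal a x) :=
  Polynomial.differentiable _

/-- Near a point off `Λ_{β,t}`, the paraorthogonal polynomials eventually have no zeros. -/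
theorem exists_zero_free_of_notMem_limitZeros {β ζ : ℂ} (hζ : ‖ζ‖ = 1)
    (h : ζ ∉ limitZeros a t β) :
    ∃ δ > 0, ∀ᶠ x in ratioFilter t, ∀ z : ℂ, ‖z‖ = 1 → dist z ζ < δ →
      (popuc (fun m => a m x.2) β x.1).eval z ≠ 0 := by
  -- Otherwise, zeros at distance below `1 / (k + 1)` can be chosen along a basis of the filter. The
  -- resulting sequence puts `ζ` into the limit set.
  by_contra! hcon
  obtain ⟨U, hU⟩ := (ratioFilter t).exists_antitone_basis
  have hex : ∀ k : ℕ, ∃ x ∈ U k, ∃ z : ℂ, ‖z‖ = 1 ∧ dist z ζ < 1 / ((k : ℝ) + 1) ∧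
      (popuc (fun m => a m x.2) β x.1).eval z = 0 := by
    intro k
    have h1 := hcon (1 / ((k : ℝ) + 1)) (by positivity)
    obtain ⟨x, hx, hxU⟩ := (h1.and_eventually (hU.mem k)).exists
    exact ⟨x, hxU, hx⟩
  choose x hxU z hz1 hzd hz0 using hex
  have hx : Tendsto x atTop (ratioFilter t) := hU.tendsto hxU
  refine h ⟨hζ, fun k => (x k).1, fun k => (x k).2, isRatioSeq_iff.2 hx, Tendsto.liminf_eq ?_⟩
  have hlim : Tendsto (fun k : ℕ => ENNReal.ofReal (1 / ((k : ℝ) + 1))) atTop (𝓝 0) := by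
    have := ENNReal.tendsto_ofReal tendsto_one_div_add_atTop_nhds_zero_nat
    rwa [ENNReal.ofReal_zero] at this
  refine tendsto_of_tendsto_of_tendsto_of_le_of_le tendsto_const_nhds hlim
    (fun _ => zero_le) fun k => ?_
  refine (Metric.infEDist_le_edist_of_mem
    (show z k ∈ popucZeros a β (x k).1 (x k).2 from ⟨hz1 k, hz0 k⟩)).trans ?_
  rw [edist_comm, edist_dist]
  exact ENNReal.ofReal_le_ofReal (hzd k).le

theorem eval_popuc_eq {β : ℂ} (hβ : ‖β‖ = 1) (x : ℕ × ℕ) (z : ℂ) :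
    (popuc (fun m => a m x.2) β (x.1 + 1)).eval z =
      -starRingEnd ℂ β * (starVal a x z - β * z * opucVal a x z) := by
  have : starRingEnd ℂ β * β = 1 := by
    rw [mul_comm, Complex.mul_conj', hβ]
    simp
  rw [eval_popuc_succ, starVal, opucVal]
  linear_combination -z * eval z (opuc (fun m => a m x.2) x.1) * this

theorem eventually_bounds_near_circle (ha : ∀ n N, ‖a n N‖ < 1) {β ζ : ℂ} (hβ : ‖β‖ = 1)
    (hζ : ‖ζ‖ = 1) (h : ζ ∉ limitZeros a t β) :
    ∃ e M : ℝ, 0 < e ∧ e ≤ 1 ∧ ∀ᶠ x in ratioFilter t, ∀ z ∈ Metric.ball ζ e,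
      starVal a x z ≠ 0 ∧ opucVal a x z ≠ 0 ∧ starVal a x z - β * z * opucVal a x z ≠ 0 ∧
      ‖opucVal a x z / starVal a x z‖ ≤ M ∧ ‖starVal a x z / opucVal a x z‖ ≤ M ∧
      ‖starVal a x z / (starVal a x z - β * z * opucVal a x z)‖ ≤ M := by
  obtain ⟨δ, hδ, hfree⟩ := exists_zero_free_of_notMem_limitZeros hζ h
  set s := min (δ / 2) (1 / 2) with hs
  have hs0 : 0 < s := by positivity
  have hs1 : s ≤ 1 / 2 := min_le_right _ _
  have hs2 : s < δ := (min_le_left _ _).trans_lt (by linarith)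
  refine ⟨s ^ 2 / 148, 4 * (18 / s + 1), by positivity, by nlinarith, ?_⟩
  filter_upwards [(tendsto_ratioFilter_add t 1).eventually hfree] with x hx z hz
  have hin : ∀ z, ‖z‖ ≤ 1 → ‖opucVal a x z‖ ≤ ‖starVal a x z‖ := fun z hz =>
    (eval_opucStar_ne_zero_and_le (fun n => ha n x.2) hz x.1).2
  have hout : ∀ z, 1 ≤ ‖z‖ → ‖starVal a x z‖ ≤ ‖opucVal a x z‖ := fun z hz =>
    (eval_opuc_ne_zero_and_le (fun n => ha n x.2) hz x.1).2
  refine bounds_near_circle (differentiable_starVal a x) (differentiable_opucVal a x) hin hout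
    hβ hζ hs0 hs1 (fun w hw h0 => ?_) hz
  have h1 : starVal a x w = β * w * opucVal a x w := sub_eq_zero.1 h0
  have h2 : ‖starVal a x w‖ = ‖w‖ * ‖opucVal a x w‖ := by
    rw [h1, norm_mul, norm_mul, hβ, one_mul]
  -- A zero of `Φ^* - β w Φ` gives `|Φ^*| = |w| |Φ|`, which off the circle contradicts the
  -- comparison of the two, as the larger one is not zero.
  have hw1 : ‖w‖ = 1 := by
    refine le_antisymm (not_lt.1 fun h3 => ?_) (not_lt.1 fun h3 => ?_)
    · have h4 := norm_pos_iff.2 (eval_opuc_ne_zero_and_le (fun n => ha n x.2) h3.le x.1).1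
      have h5 := hout w h3.le
      rw [h2] at h5
      change 0 < ‖opucVal a x w‖ at h4
      nlinarith
    · have h4 := norm_pos_iff.2 (eval_opucStar_ne_zero_and_le (fun n => ha n x.2) h3.le x.1).1
      have h5 := hin w h3.le
      change 0 < ‖starVal a x w‖ at h4
      nlinarith [norm_nonneg (opucVal a x w), norm_nonneg w]
  refine hx w hw1 (lt_of_le_of_lt hw hs2) ?_
  rw [eval_popuc_eq hβ, h0, mul_zero]

theorem eventually_starRatio_le {K : Set ℂ} {M : ℝ} (hK : ∀ z ∈ K, ‖z‖ ≤ 2)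
    (ha : ∀ n N, ‖a n N‖ < 1)
    (h : ∀ᶠ x in ratioFilter t, ∀ z ∈ K,
      starVal a x z ≠ 0 ∧ ‖opucVal a x z / starVal a x z‖ ≤ M) (m : ℕ) :
    ∀ᶠ x in ratioFilter t, ∀ z ∈ K,
      ‖starVal a (x.1 + m, x.2) z / starVal a x z‖ ≤ (1 + 2 * |M|) ^ m := by
  induction m with
  | zero =>
    filter_upwards [h] with x hx z hz
    simp [div_self (hx z hz).1]
  | succ m ih =>
    filter_upwards [ih, (tendsto_ratioFilter_add t m).eventually h] with x h1 h2 z hz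
    obtain ⟨h3, h4⟩ := h2 z hz
    have e : starVal a (x.1 + (m + 1), x.2) z / starVal a x z =
        (1 - a (x.1 + m) x.2 * z *
          (opucVal a (x.1 + m, x.2) z / starVal a (x.1 + m, x.2) z)) *
          (starVal a (x.1 + m, x.2) z / starVal a x z) := by
      rw [← mul_div_assoc, sub_mul, one_mul, mul_assoc (a (x.1 + m) x.2 * z), div_mul_cancel₀ _ h3]
      congr 1
      exact eval_opucStar_succ _ _ _
    rw [e, norm_mul, pow_succ']
    refine mul_le_mul ?_ (h1 z hz) (norm_nonneg _) (by positivity)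
    refine (norm_sub_le _ _).trans ?_
    rw [norm_one, norm_mul, norm_mul]
    have h5 : ‖a (x.1 + m) x.2‖ * ‖z‖ ≤ 1 * 2 :=
      mul_le_mul (ha _ _).le (hK z hz) (norm_nonneg _) zero_le_one
    have h6 := h4.trans (le_abs_self M)
    have := mul_le_mul h5 h6 (norm_nonneg _) (by norm_num)
    linarith

theorem opucVal_div_starVal (ha : ∀ n N, ‖a n N‖ < 1) {z : ℂ} (hz : ‖z‖ ≤ 1) (x : ℕ × ℕ) :
    opucVal a x z / starVal a x z = schurRatio a x z := by
  rw [opucVal, eval_opuc_eq (fun n => ha n x.2) hz]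
  exact mul_div_cancel_right₀ _ (eval_opucStar_ne_zero_and_le (fun n => ha n x.2) hz x.1).1

theorem vanishesOn_ratio_sub_near_circle (hp : 0 < p) (hα : ∀ n, ‖α n‖ < 1)
    (hper : Function.Periodic α p) (ha : ∀ n N, ‖a n N‖ < 1)
    (hlim : Tendsto (fun x : ℕ × ℕ => a x.1 x.2 - α x.1) (ratioFilter t) (𝓝 0))
    {ζ : ℂ} (hζ : ‖ζ‖ = 1) {e M : ℝ} (he : 0 < e) (he1 : e ≤ 1)
    (h : ∀ᶠ x in ratioFilter t, ∀ z ∈ Metric.ball ζ e,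
      starVal a x z ≠ 0 ∧ ‖opucVal a x z / starVal a x z‖ ≤ M) :
    VanishesOn (ratioFilter t) (fun x z =>
      opucVal a (x.1 + p, x.2) z / starVal a (x.1 + p, x.2) z - opucVal a x z / starVal a x z)
      (Metric.closedBall ζ (e / 4)) := by
  have h' := (tendsto_ratioFilter_add t p).eventually h
  refine VanishesOn.of_bounded_near_circle (M := M + M) hζ he he1 ?_ ?_ fun r hr => ?_
  · filter_upwards [h, h'] with x h1 h2
    exact ((differentiable_opucVal a _).differentiableOn.div
      (differentiable_starVal a _).differentiableOn fun z hz => (h2 z hz).1).sub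
      ((differentiable_opucVal a _).differentiableOn.div
      (differentiable_starVal a _).differentiableOn fun z hz => (h1 z hz).1)
  · filter_upwards [h, h'] with x h1 h2 z hz
    exact (norm_sub_le _ _).trans (add_le_add (h2 z hz).2 (h1 z hz).2)
  · refine (vanishesOn_schurRatio_add_sub hp hα hper ha hlim hr).congr
      (Eventually.of_forall fun x z hz => ?_)
    have hz1 : ‖z‖ ≤ 1 := by
      rw [mem_closedBall_zero_iff] at hz
      exact hz.trans hr.le
    rw [opucVal_div_starVal ha hz1, opucVal_div_starVal ha hz1]

/-- If `P_{n+p} / P_n → G`, and `T_n / P_n` changes little over a period and is bounded below,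
then `T_{n+p} / T_n → G`. -/
theorem VanishesOn.ratio_transfer {K : Set ℂ} {P T : ℕ × ℕ → ℂ → ℂ} {G : ℂ → ℂ} {C M : ℝ}
    (hP : ∀ᶠ x in ratioFilter t, ∀ z ∈ K, P x z ≠ 0)
    (hR : VanishesOn (ratioFilter t) (fun x z => P (x.1 + p, x.2) z / P x z - G z) K)
    (hC : ∀ᶠ x in ratioFilter t, ∀ z ∈ K, ‖P (x.1 + p, x.2) z / P x z‖ ≤ C)
    (hd : VanishesOn (ratioFilter t)
      (fun x z => T (x.1 + p, x.2) z / P (x.1 + p, x.2) z - T x z / P x z) K)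
    (hT : ∀ᶠ x in ratioFilter t, ∀ z ∈ K, T x z ≠ 0 ∧ ‖P x z / T x z‖ ≤ M) :
    VanishesOn (ratioFilter t) (fun x z => T (x.1 + p, x.2) z / T x z - G z) K := by
  have h1 := hd.mul_bounded (hT.mono fun x hx z hz => (hx z hz).2)
  have hP' := (tendsto_ratioFilter_add t p).eventually hP
  refine (VanishesOn.mul_sub
    (u := fun x z => T (x.1 + p, x.2) z / P (x.1 + p, x.2) z * (P x z / T x z))
    hR (h1.congr ?_) hC).congr ?_
  · filter_upwards [hP, hT] with x h2 h3 z hz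
    have := h2 z hz
    have := (h3 z hz).1
    field_simp
  · filter_upwards [hP, hT, hP'] with x h2 h3 h4 z hz
    have := h2 z hz
    have := (h3 z hz).1
    have := h4 z hz
    field_simp

/-- Outside the disk the limit is known for `Φ_n`. The assumed bound on `Φ_n / Φ_n^*` transfers it
to `Φ_n^*`, so that the limit near the circle can be identified from both sides. -/
theorem tendsto_starRatio_outside (hp : 0 < p) (hα : ∀ n, ‖α n‖ < 1)
    (hper : Function.Periodic α p) (ha : ∀ n N, ‖a n N‖ < 1)
    (hlim : Tendsto (fun x : ℕ × ℕ => a x.1 x.2 - α x.1) (ratioFilter t) (𝓝 0)) {z : ℂ}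
    (hz : 1 < ‖z‖) {M : ℝ}
    (h : ∀ᶠ x in ratioFilter t, starVal a x z ≠ 0 ∧ ‖opucVal a x z / starVal a x z‖ ≤ M) :
    Tendsto (fun x : ℕ × ℕ => starVal a (x.1 + p, x.2) z / starVal a x z) (ratioFilter t)
      (𝓝 (gDelta p α z)) := by
  have hw : ‖z⁻¹‖ < 1 := by
    rw [norm_inv]
    exact inv_lt_one_of_one_lt₀ hz
  have hR := vanishesOn_opucRatio hp hα hper ha hlim hw (K := {z}) (M := ‖z‖) (by simp [hz])
  have hα' : ∀ n, ‖starRingEnd ℂ (α n)‖ < 1 := fun n => by simpa using hα n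
  have hd := (vanishesOn_schurRatio_add_sub hp hα' (periodic_conj hper)
    (fun n N => by simpa [conjCoeff] using ha n N) (tendsto_conjCoeff hlim) hw).comp_inv
    (K := {z}) (by simp)
  have key := VanishesOn.ratio_transfer (p := p) (T := starVal a) (K := {z})
    (Eventually.of_forall fun x w hw => by
      rw [hw]
      exact (eval_opuc_ne_zero_and_le (fun n => ha n x.2) hz.le x.1).1)
    hR (hR.bounded (M := ‖gDelta p α z‖) (by simp))
    (hd.congr (Eventually.of_forall fun x w hw => by
      rw [hw, starVal_div_opucVal ha hz.le, starVal_div_opucVal ha hz.le]))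
    (M := M) (h.mono fun x hx w hw => by rw [hw]; exact hx)
  rw [tendsto_iff_norm_sub_tendsto_zero, Metric.tendsto_nhds]
  intro ε hε
  filter_upwards [key ε hε] with x hx
  simpa using hx z rfl

theorem mem_closure_norm_ne_one {z : ℂ} (hz : ‖z‖ = 1) : z ∈ closure {w : ℂ | ‖w‖ ≠ 1} := by
  have hc : Tendsto (fun r : ℝ => ((1 + r : ℝ) : ℂ) * z) (𝓝[>] 0) (𝓝 z) := by
    have : Continuous fun r : ℝ => ((1 + r : ℝ) : ℂ) * z := by fun_prop
    have h := this.tendsto 0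
    simp only [add_zero, Complex.ofReal_one, one_mul] at h
    exact h.mono_left nhdsWithin_le_nhds
  refine mem_closure_of_tendsto hc ?_
  filter_upwards [self_mem_nhdsWithin] with r hr
  have hr' : (0 : ℝ) < r := hr
  change ‖_‖ ≠ 1
  rw [norm_mul, hz, mul_one, Complex.norm_real, Real.norm_of_nonneg (by linarith)]
  linarith

theorem continuous_transferMatrix (α : ℕ → ℂ) (n : ℕ) :
    Continuous fun z => transferMatrix α z n := by
  induction n with
  | zero => exact continuous_const
  | succ n ih =>
    refine Continuous.matrix_mul (A := fun z => stepMatrix (α n) z) ?_ ih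
    refine continuous_matrix fun i j => ?_
    unfold stepMatrix
    fin_cases i <;> fin_cases j <;> simp <;> fun_prop

/-- Near a point of the circle, a holomorphic extension of `G_Δ` from the complement of the circle
agrees with `G_Δ` on the circle as well: by the maximum principle, the moduli of the two
eigenvalues of the transfer matrix cannot coincide. -/
theorem gDelta_eq_of_differentiableOn (hp : 0 < p) (hα : ∀ n, ‖α n‖ < 1)
    (hper : Function.Periodic α p) {ζ : ℂ} (hζ : ‖ζ‖ = 1) {e : ℝ} (he : 0 < e) (he1 : e ≤ 1)
    {H : ℂ → ℂ} (hH : DifferentiableOn ℂ H (Metric.ball ζ e))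
    (hG : ∀ z ∈ Metric.ball ζ e, ‖z‖ ≠ 1 → H z = gDelta p α z) {z : ℂ}
    (hz : z ∈ Metric.ball ζ e) : H z = gDelta p α z := by
  set l : ℂ → ℂ := fun z => H z / rhoProd p α with hl
  have hP := rhoProd_ne_zero p hα
  have hld : DifferentiableOn ℂ l (Metric.ball ζ e) := hH.div_const _
  have hHl : ∀ z, H z = rhoProd p α * l z := fun z => (mul_div_cancel₀ _ hP).symm
  have hne0 : ∀ w ∈ Metric.ball ζ e, w ≠ 0 := by
    rintro w hw rfl
    rw [Metric.mem_ball, dist_comm, dist_zero_right, hζ] at hw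
    linarith
  have hoff : ∀ w ∈ Metric.ball ζ e, ‖w‖ ≠ 1 →
      l w ^ 2 - (transferMatrix α w p).trace * l w + w ^ p = 0 ∧ ‖w‖ ^ p < ‖l w‖ ^ 2 := by
    intro w hw hw1
    obtain ⟨l', h1, h2, h3, -⟩ := exists_eigenvalue hp hα hper (hne0 w hw) hw1
    have : l w = l' := by
      rw [hl]
      dsimp only
      rw [hG w hw hw1, h1, mul_div_cancel_left₀ _ hP]
    rw [this]
    exact ⟨h2, h3⟩
  have hon : ∀ w ∈ Metric.ball ζ e,
      l w ^ 2 - (transferMatrix α w p).trace * l w + w ^ p = 0 ∧ ‖w‖ ^ p ≤ ‖l w‖ ^ 2 := by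
    intro w hw
    by_cases hw1 : ‖w‖ = 1
    · have hcl := mem_closure_norm_ne_one hw1
      rw [mem_closure_iff_nhdsWithin_neBot] at hcl
      have hlc : ContinuousAt l w :=
        (hld.differentiableAt (Metric.isOpen_ball.mem_nhds hw)).continuousAt
      have hev : ∀ᶠ v in 𝓝[{w : ℂ | ‖w‖ ≠ 1}] w,
          l v ^ 2 - (transferMatrix α v p).trace * l v + v ^ p = 0 ∧ ‖v‖ ^ p < ‖l v‖ ^ 2 := by
        filter_upwards [self_mem_nhdsWithin,
          nhdsWithin_le_nhds (Metric.isOpen_ball.mem_nhds hw)] with v h1 h2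
        exact hoff v h2 h1
      constructor
      · have htr : ContinuousAt (fun v => (transferMatrix α v p).trace) w :=
          (continuous_transferMatrix α p).matrix_trace.continuousAt
        have hc : ContinuousAt
            (fun v => l v ^ 2 - (transferMatrix α v p).trace * l v + v ^ p) w := by fun_prop
        refine tendsto_nhds_unique (hc.tendsto.mono_left nhdsWithin_le_nhds)
          (tendsto_const_nhds.congr' ?_) (l := 𝓝[{w : ℂ | ‖w‖ ≠ 1}] w)
        exact hev.mono fun v hv => hv.1.symm
      · have hc1 : ContinuousAt (fun v : ℂ => ‖v‖ ^ p) w := by fun_prop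
        have hc2 : ContinuousAt (fun v : ℂ => ‖l v‖ ^ 2) w := by fun_prop
        exact le_of_tendsto_of_tendsto (hc1.tendsto.mono_left nhdsWithin_le_nhds)
          (hc2.tendsto.mono_left nhdsWithin_le_nhds) (hev.mono fun v hv => hv.2.le)
    · exact ⟨(hoff w hw hw1).1, (hoff w hw hw1).2.le⟩
  have hl0 : ∀ w ∈ Metric.ball ζ e, l w ≠ 0 := by
    intro w hw h0
    have h1 := (hon w hw).2
    have h2 : 0 < ‖w‖ ^ p := pow_pos (norm_pos_iff.2 (hne0 w hw)) p
    rw [h0, norm_zero] at h1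
    norm_num at h1
    linarith
  by_cases hz1 : ‖z‖ = 1
  · rw [hHl]
    refine (gDelta_eq_of_eigenvalue p α (hne0 z hz) (hon z hz).1 ?_).symm
    refine lt_of_le_of_ne (hon z hz).2 fun heq => ?_
    -- The quotient of the two eigenvalues. Equal moduli at `z` would be an interior maximum of
    -- `|q|`, hence `|q| = 1` on the whole disk, contrary to strict dominance off the circle.
    set q : ℂ → ℂ := fun w => w ^ p / l w ^ 2 with hq
    have hqn : ∀ w, ‖q w‖ = ‖w‖ ^ p / ‖l w‖ ^ 2 := fun w => by
      rw [hq, norm_div, norm_pow, norm_pow]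
    have hqd : DifferentiableOn ℂ q (Metric.ball ζ e) :=
      ((differentiable_id.pow p).differentiableOn).div (hld.pow 2)
        fun w hw => pow_ne_zero _ (hl0 w hw)
    have hpos : ∀ w ∈ Metric.ball ζ e, 0 < ‖l w‖ ^ 2 := fun w hw =>
      pow_pos (norm_pos_iff.2 (hl0 w hw)) 2
    have hqz : ‖q z‖ = 1 := by rw [hqn, heq, div_self (hpos z hz).ne']
    have hmax : IsMaxOn (norm ∘ q) (Metric.ball ζ e) z := by
      intro w hw
      change ‖q w‖ ≤ ‖q z‖
      rw [hqz, hqn, div_le_one (hpos w hw)]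
      exact (hon w hw).2
    have hconst := Complex.eqOn_of_isPreconnected_of_isMaxOn_norm
      (convex_ball ζ e).isPreconnected Metric.isOpen_ball hqd hz hmax
    set w : ℂ := ((1 - e / 2 : ℝ) : ℂ) * ζ with hw
    have hwn : ‖w‖ = 1 - e / 2 := by
      rw [hw, norm_mul, hζ, mul_one, Complex.norm_real, Real.norm_of_nonneg (by linarith)]
    have hwb : w ∈ Metric.ball ζ e := by
      have : w - ζ = ((-(e / 2) : ℝ) : ℂ) * ζ := by rw [hw]; push_cast; ring
      rw [Metric.mem_ball, dist_eq_norm, this, norm_mul, hζ, mul_one, Complex.norm_real, norm_neg,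
        Real.norm_of_nonneg (by positivity)]
      linarith
    have h1 : ‖q w‖ = 1 := by rw [hconst hwb, Function.const_apply, hqz]
    rw [hqn, div_eq_one_iff_eq (hpos w hwb).ne'] at h1
    exact (hoff w hwb (by rw [hwn]; linarith)).2.ne h1
  · exact hG z hz hz1

theorem vanishesOn_starRatio_near_circle [(ratioFilter t).NeBot] (hp : 0 < p)
    (hα : ∀ n, ‖α n‖ < 1) (hper : Function.Periodic α p) (ha : ∀ n N, ‖a n N‖ < 1)
    (hlim : Tendsto (fun x : ℕ × ℕ => a x.1 x.2 - α x.1) (ratioFilter t) (𝓝 0))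
    {ζ : ℂ} (hζ : ‖ζ‖ = 1) {e M : ℝ} (he : 0 < e) (he1 : e ≤ 1)
    (h : ∀ᶠ x in ratioFilter t, ∀ z ∈ Metric.ball ζ e,
      starVal a x z ≠ 0 ∧ ‖opucVal a x z / starVal a x z‖ ≤ M) :
    VanishesOn (ratioFilter t)
      (fun x z => starVal a (x.1 + p, x.2) z / starVal a x z - gDelta p α z)
      (Metric.ball ζ (e / 4)) := by
  set R : ℕ × ℕ → ℂ → ℂ := fun x z => starVal a (x.1 + p, x.2) z / starVal a x z with hR
  have hRd : ∀ᶠ x in ratioFilter t, DifferentiableOn ℂ (R x) (Metric.ball ζ e) :=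
    h.mono fun x hx => (differentiable_starVal a _).differentiableOn.div
      (differentiable_starVal a _).differentiableOn fun z hz => (hx z hz).1
  have hK : ∀ z ∈ Metric.ball ζ e, ‖z‖ ≤ 2 := fun z hz => by
    rw [Metric.mem_ball, dist_eq_norm] at hz
    have := norm_sub_norm_le z ζ
    linarith
  have hRb := eventually_starRatio_le hK ha h p
  have hin : ∀ r < 1, VanishesOn (ratioFilter t) (fun x z => R x z - gDelta p α z)
      (Metric.closedBall 0 r) := fun r hr => vanishesOn_starRatio hp hα hper ha hlim hr
  -- `G_Δ` is not yet known to be holomorphic across the circle, so convergence is propagated for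
  -- differences of two members of the family, as a Cauchy property.
  have hcauchy : VanishesOn (ratioFilter t ×ˢ ratioFilter t)
      (fun y z => R y.1 z - R y.2 z) (Metric.closedBall ζ (e / 4)) := by
    refine VanishesOn.of_bounded_near_circle hζ he he1
      (M := (1 + 2 * |M|) ^ p + (1 + 2 * |M|) ^ p) ?_ ?_ fun r hr => ?_
    · exact (hRd.prod_mk hRd).mono fun y hy => hy.1.sub hy.2
    · exact (hRb.prod_mk hRb).mono fun y hy z hz =>
        (norm_sub_le _ _).trans (add_le_add (hy.1 z hz) (hy.2 z hz))
    · exact (((hin r hr).comp tendsto_fst).sub ((hin r hr).comp tendsto_snd)).congr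
        (Eventually.of_forall fun y z _ => by ring)
  have hUC : UniformCauchySeqOn R (ratioFilter t) (Metric.ball ζ (e / 4)) := by
    intro u hu
    obtain ⟨ε, hε, hεu⟩ := Metric.mem_uniformity_dist.1 hu
    filter_upwards [hcauchy ε hε] with y hy z hz
    exact hεu (by rw [dist_eq_norm]; exact hy z (Metric.ball_subset_closedBall hz))
  have hpt : ∀ z, ∃ w, z ∈ Metric.ball ζ (e / 4) →
      Tendsto (fun x => R x z) (ratioFilter t) (𝓝 w) := by
    intro z
    by_cases hz : z ∈ Metric.ball ζ (e / 4)
    · obtain ⟨w, hw⟩ := cauchy_map_iff_exists_tendsto.1 (hUC.cauchy_map hz)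
      exact ⟨w, fun _ => hw⟩
    · exact ⟨0, fun hz' => absurd hz' hz⟩
  choose H hH using hpt
  have hunif : TendstoUniformlyOn R H (ratioFilter t) (Metric.ball ζ (e / 4)) :=
    hUC.tendstoUniformlyOn_of_tendsto hH
  have hsub : Metric.ball ζ (e / 4) ⊆ Metric.ball ζ e := Metric.ball_subset_ball (by linarith)
  have hHd : DifferentiableOn ℂ H (Metric.ball ζ (e / 4)) :=
    hunif.tendstoLocallyUniformlyOn.differentiableOn (hRd.mono fun x hx => hx.mono hsub)
      Metric.isOpen_ball
  have hG : ∀ z ∈ Metric.ball ζ (e / 4), ‖z‖ ≠ 1 → H z = gDelta p α z := by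
    intro z hz hz1
    refine tendsto_nhds_unique (hH z hz) ?_
    rcases lt_or_gt_of_ne hz1 with h1 | h1
    · rw [tendsto_iff_norm_sub_tendsto_zero, Metric.tendsto_nhds]
      intro ε hε
      filter_upwards [hin ‖z‖ h1 ε hε] with x hx
      simpa using hx z (by simp)
    · exact tendsto_starRatio_outside hp hα hper ha hlim h1 (M := M)
        (h.mono fun x hx => hx z (hsub hz))
  intro ε hε
  filter_upwards [Metric.tendstoUniformlyOn_iff.1 hunif ε hε] with x hx z hz
  rw [← gDelta_eq_of_differentiableOn hp hα hper hζ (by positivity) (by linarith) hHd hG hz,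
    ← dist_eq_norm, dist_comm]
  exact hx z hz

end Circle

/-! ### From local convergence to convergence on compact sets -/

section Assembly

variable {p : ℕ} {α : ℕ → ℂ} {a : ℕ → ℕ → ℂ} {t : ℝ}

/-- The quotients `T_{n+p} / T_n` converge to `G_Δ` locally uniformly near `z`. -/
def RatioConvergesNear (t : ℝ) (p : ℕ) (G : ℂ → ℂ) (T : ℕ × ℕ → ℂ → ℂ) (z : ℂ) : Prop :=
  ∃ U ∈ 𝓝 z, VanishesOn (ratioFilter t) (fun x z => T (x.1 + p, x.2) z / T x z - G z) U ∧
    ∀ᶠ x in ratioFilter t, ∀ z ∈ U, T x z ≠ 0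

/-- Compactness, by induction over finite unions. A nontrivial filter may be assumed because the
claim starts from a given sequence along it. -/
theorem quotientsConverge_of_near {T : ℕ → ℕ → ℂ[X]} {G : ℂ → ℂ} {S : Set ℂ}
    (h : (ratioFilter t).NeBot → ∀ z ∈ S,
      RatioConvergesNear t p G (fun x z => (T x.1 x.2).eval z) z) :
    QuotientsConverge t (fun n N => T (n + p) N) T G S := by
  intro K hKS hK n N hnN
  have hlim := isRatioSeq_iff.1 hnN
  have hne : (ratioFilter t).NeBot := hlim.neBot
  have key : VanishesOn (ratioFilter t)
      (fun x z => (T (x.1 + p) x.2).eval z / (T x.1 x.2).eval z - G z) K ∧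
      ∀ᶠ x in ratioFilter t, ∀ z ∈ K, (T x.1 x.2).eval z ≠ 0 := by
    refine hK.induction_on (p := fun K => VanishesOn (ratioFilter t)
      (fun x z => (T (x.1 + p) x.2).eval z / (T x.1 x.2).eval z - G z) K ∧
      ∀ᶠ x in ratioFilter t, ∀ z ∈ K, (T x.1 x.2).eval z ≠ 0) ?_ ?_ ?_ ?_
    · exact ⟨fun ε _ => Eventually.of_forall fun x z hz => hz.elim,
        Eventually.of_forall fun x z hz => hz.elim⟩
    · exact fun s s' hs h => ⟨h.1.mono hs, h.2.mono fun x hx z hz => hx z (hs hz)⟩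
    · exact fun s s' h h' => ⟨h.1.union h'.1, (h.2.and h'.2).mono fun x hx z hz =>
        hz.elim (hx.1 z) (hx.2 z)⟩
    · intro z hz
      obtain ⟨U, hU, h1, h2⟩ := h hne z (hKS hz)
      exact ⟨U, nhdsWithin_le_nhds hU, h1, h2⟩
  refine ⟨hlim.eventually key.2, Metric.tendstoUniformlyOn_iff.2 fun ε hε => ?_⟩
  filter_upwards [hlim.eventually (key.1 ε hε)] with i hi z hz
  rw [dist_comm, dist_eq_norm]
  exact hi z hz

/-- The value of the paraorthogonal polynomial with index one larger. -/
def popucVal (a : ℕ → ℕ → ℂ) (β : ℂ) (x : ℕ × ℕ) (z : ℂ) : ℂ :=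
  (popuc (fun m => a m x.2) β (x.1 + 1)).eval z

theorem RatioConvergesNear.popuc_of_popucVal {β z : ℂ} {G : ℂ → ℂ}
    (h : RatioConvergesNear t p G (popucVal a β) z) :
    RatioConvergesNear t p G (fun x z => (popuc (fun m => a m x.2) β x.1).eval z) z := by
  obtain ⟨U, hU, h1, h2⟩ := h
  have hs := tendsto_ratioFilter_sub t 1
  refine ⟨U, hU, (h1.comp hs).congr ?_, ?_⟩
  · filter_upwards [eventually_ratioFilter_ge t 1] with x hx z _
    simp only [popucVal]
    rw [Nat.sub_add_cancel hx, add_right_comm, Nat.sub_add_cancel hx]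
  · filter_upwards [eventually_ratioFilter_ge t 1, hs.eventually h2] with x hx h3 z hz
    have := h3 z hz
    simp only [popucVal] at this
    rwa [Nat.sub_add_cancel hx] at this

theorem continuousOn_periodicSchur (hp : 0 < p) (hα : ∀ n, ‖α n‖ < 1)
    (hper : Function.Periodic α p) (n : ℕ) :
    ContinuousOn (fun z => periodicSchur p α z n) (Metric.ball 0 1) := by
  have hc : ∀ m, ContinuousOn (fun z => schurIterate α z 1 m) (Metric.ball 0 1) := by
    intro m
    induction m with
    | zero => exact continuousOn_const
    | succ m ih =>
      refine ContinuousOn.div (by fun_prop) (by fun_prop) fun z hz => ?_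
      have hz1 : ‖z‖ ≤ 1 := (mem_ball_zero_iff.1 hz).le
      exact schurStep_denom_ne_zero (hα m) hz1 (norm_schurIterate_le hα hz1 norm_one.le m)
  intro z hz
  have hz1 : ‖z‖ < 1 := mem_ball_zero_iff.1 hz
  obtain ⟨r, hr, hr1⟩ := exists_between hz1
  have hu : TendstoUniformlyOn (fun k z => schurIterate α z 1 (n + k * p))
      (fun z => periodicSchur p α z n) atTop (Metric.closedBall 0 r) := by
    rw [Metric.tendstoUniformlyOn_iff]
    intro ε hε
    obtain ⟨m, η, hη, h⟩ := exists_schurIterate_sub_periodicSchur_lt hp hα hper hr1 hε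
    filter_upwards [eventually_ge_atTop m] with k hk w hw
    have hw1 : ‖w‖ ≤ r := by simpa using hw
    have hkp : k ≤ k * p := Nat.le_mul_of_pos_right k hp
    have h1 := h α hα (n + k * p) (by omega) (fun j _ => by simpa using hη) w hw1
    have h2 := (periodic_periodicSchur hp hα hper (hw1.trans_lt hr1)).nat_mul k n
    rw [Nat.cast_id] at h2
    rw [h2] at h1
    rw [dist_comm, dist_eq_norm]
    exact h1
  have hcont := hu.continuousOn (Frequently.of_forall fun k => (hc (n + k * p)).mono
    (Metric.closedBall_subset_ball hr1))
  refine (hcont.continuousAt ?_).continuousWithinAt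
  exact Filter.mem_of_superset (Metric.isOpen_ball.mem_nhds (mem_ball_zero_iff.2 hr))
    Metric.ball_subset_closedBall

theorem norm_diskLimit_le (hp : 0 < p) (hα : ∀ n, ‖α n‖ < 1)
    (hper : Function.Periodic α p) {z : ℂ} (hz : ‖z‖ < 1) : ‖diskLimit p α z‖ ≤ 2 ^ p := by
  rw [diskLimit, norm_prod]
  refine (Finset.prod_le_prod (g := fun _ => (2 : ℝ)) (fun _ _ => norm_nonneg _) fun j _ => ?_).trans
    (by simp)
  refine (norm_sub_le _ _).trans ?_
  rw [norm_one, norm_mul]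
  have := mul_le_one₀ (norm_mul_le_one (hα j).le hz.le) (norm_nonneg _)
    (norm_periodicSchur_le hp hα hper hz j)
  linarith

/-! ### Local convergence in the disk, in the exterior and near the circle -/

section Near

variable (hp : 0 < p) (hα : ∀ n, ‖α n‖ < 1) (hper : Function.Periodic α p)
  (ha : ∀ n N, ‖a n N‖ < 1)
  (hlim : Tendsto (fun x : ℕ × ℕ => a x.1 x.2 - α x.1) (ratioFilter t) (𝓝 0))
include hp hα hper ha hlim

/-- The product of the `s_j` over a period is continuous and not zero at `z₀`. As every factor has
modulus at most one, a lower bound for the product bounds each factor below, uniformly in `n`. -/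
theorem exists_inv_schurRatio_bounded {z₀ : ℂ} (hz₀ : ‖z₀‖ < 1)
    (hf : ∀ n, periodicSchur p α z₀ n ≠ 0) :
    ∃ U ∈ 𝓝 z₀, ∃ M : ℝ, ∀ᶠ x in ratioFilter t, ∀ z ∈ U,
      schurRatio a x z ≠ 0 ∧ ‖(schurRatio a x z)⁻¹‖ ≤ M := by
  obtain ⟨r, hr, hr1⟩ := exists_between hz₀
  set g : ℂ → ℂ := fun z => ∏ n ∈ Finset.range p, periodicSchur p α z n with hg
  have hgc : ContinuousAt g z₀ := by
    have : ContinuousOn g (Metric.ball 0 1) := continuousOn_finsetProd _ fun n _ =>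
      continuousOn_periodicSchur hp hα hper n
    exact this.continuousAt (Metric.isOpen_ball.mem_nhds (mem_ball_zero_iff.2 hz₀))
  have hg0 : 0 < ‖g z₀‖ := norm_pos_iff.2 (Finset.prod_ne_zero_iff.2 fun n _ => hf n)
  set c := ‖g z₀‖ / 2 with hc
  have hc0 : 0 < c := by positivity
  have hU : {z : ℂ | c < ‖g z‖} ∩ Metric.closedBall 0 r ∈ 𝓝 z₀ := by
    refine inter_mem ?_ ?_
    · exact hgc.norm.eventually (lt_mem_nhds (half_lt_self hg0))
    · exact Filter.mem_of_superset (Metric.isOpen_ball.mem_nhds (mem_ball_zero_iff.2 hr))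
        Metric.ball_subset_closedBall
  refine ⟨_, hU, 2 / c, ?_⟩
  filter_upwards [vanishesOn_schurRatio_sub hp hα hper ha hlim hr1 (c / 2) (by positivity)]
    with x hx z hz
  have hz1 : ‖z‖ < 1 := (mem_closedBall_zero_iff.1 hz.2).trans_lt hr1
  have h1 := hx z hz.2
  have h2 : c ≤ ‖periodicSchur p α z x.1‖ := by
    have h3 : c < ‖g z‖ := hz.1
    rw [← (periodic_periodicSchur hp hα hper hz1).map_mod_nat]
    refine h3.le.trans ?_
    simp only [hg]
    rw [norm_prod, ← Finset.mul_prod_erase _ _ (Finset.mem_range.2 (Nat.mod_lt x.1 hp))]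
    exact mul_le_of_le_one_right (norm_nonneg _) (Finset.prod_le_one (fun _ _ => norm_nonneg _)
      fun n _ => norm_periodicSchur_le hp hα hper hz1 n)
  have h3 := norm_sub_norm_le (periodicSchur p α z x.1) (schurRatio a x z)
  rw [norm_sub_rev] at h3
  have h4 : c / 2 ≤ ‖schurRatio a x z‖ := by linarith
  refine ⟨norm_pos_iff.1 (by linarith), ?_⟩
  rw [norm_inv, inv_le_comm₀ (by linarith) (by positivity), inv_div]
  exact h4

/-- The reference family is `Φ_n^*`, which has no zeros here. The other two follow by
`VanishesOn.ratio_transfer`; for the paraorthogonal polynomials the lower bound `1 - r` holds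
without further conditions. -/
theorem near_disk {z₀ β : ℂ} (hβ : ‖β‖ = 1) (hz₀ : ‖z₀‖ < 1) :
    RatioConvergesNear t p (gDelta p α) (popucVal a β) z₀ ∧
    ((∀ n, periodicSchur p α z₀ n ≠ 0) →
      RatioConvergesNear t p (gDelta p α) (opucVal a) z₀) ∧
    RatioConvergesNear t p (gDelta p α) (starVal a) z₀ := by
  obtain ⟨r, hr, hr1⟩ := exists_between hz₀
  set K := Metric.closedBall (0 : ℂ) r with hK
  have hKn : K ∈ 𝓝 z₀ :=
    Filter.mem_of_superset (Metric.isOpen_ball.mem_nhds (mem_ball_zero_iff.2 hr))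
      Metric.ball_subset_closedBall
  have hz1 : ∀ z ∈ K, ‖z‖ < 1 := fun z hz => (mem_closedBall_zero_iff.1 hz).trans_lt hr1
  have hA : ∀ x, ∀ z ∈ K, starVal a x z ≠ 0 := fun x z hz =>
    (eval_opucStar_ne_zero_and_le (fun n => ha n x.2) (hz1 z hz).le x.1).1
  have hA' : ∀ᶠ x in ratioFilter t, ∀ z ∈ K, starVal a x z ≠ 0 := Eventually.of_forall hA
  have hR := vanishesOn_starRatio hp hα hper ha hlim hr1
  have hC := hR.bounded (M := 2 ^ p) fun z hz => by
    rw [gDelta_eq_diskLimit hp hα hper (hz1 z hz)]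
    exact norm_diskLimit_le hp hα hper (hz1 z hz)
  have hd : VanishesOn (ratioFilter t) (fun x z => opucVal a (x.1 + p, x.2) z /
      starVal a (x.1 + p, x.2) z - opucVal a x z / starVal a x z) K :=
    (vanishesOn_schurRatio_add_sub hp hα hper ha hlim hr1).congr
      (Eventually.of_forall fun x z hz => by
        rw [opucVal_div_starVal ha (hz1 z hz).le, opucVal_div_starVal ha (hz1 z hz).le])
  refine ⟨?_, fun hf => ?_, ⟨K, hKn, hR, hA'⟩⟩
  · have hT : ∀ x, ∀ z ∈ K, popucVal a β x z ≠ 0 ∧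
        ‖starVal a x z / popucVal a β x z‖ ≤ (1 - r)⁻¹ := by
      intro x z hz
      have h0 := hA x z hz
      have e : popucVal a β x z =
          -starRingEnd ℂ β * ((1 - β * z * (opucVal a x z / starVal a x z)) * starVal a x z) := by
        rw [popucVal, eval_popuc_eq hβ, sub_mul, mul_assoc (β * z), div_mul_cancel₀ _ h0, one_mul]
      have hle : 1 - r ≤ ‖1 - β * z * (opucVal a x z / starVal a x z)‖ := by
        rw [opucVal_div_starVal ha (hz1 z hz).le]
        have h2 := one_sub_norm_le' (α := β) (z := z) hβ.le (norm_schurIterate_le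
          (fun n => ha n x.2) (hz1 z hz).le norm_one.le x.1)
        have h3 : ‖z‖ ≤ r := mem_closedBall_zero_iff.1 hz
        exact (by linarith : 1 - r ≤ 1 - ‖z‖).trans h2
      have hpos : 0 < 1 - r := sub_pos.2 hr1
      have hne : 1 - β * z * (opucVal a x z / starVal a x z) ≠ 0 :=
        norm_pos_iff.1 (hpos.trans_le hle)
      have hβ0 : starRingEnd ℂ β ≠ 0 := by
        rw [← norm_pos_iff, RCLike.norm_conj, hβ]
        exact one_pos
      refine ⟨?_, ?_⟩
      · rw [e]
        exact mul_ne_zero (neg_ne_zero.2 hβ0) (mul_ne_zero hne h0)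
      · rw [e, norm_div, norm_mul, norm_mul, norm_neg, RCLike.norm_conj, hβ, one_mul,
          div_mul_cancel_right₀ (norm_ne_zero_iff.2 h0)]
        exact inv_anti₀ hpos hle
    refine ⟨K, hKn, VanishesOn.ratio_transfer (P := starVal a) hA' hR hC ?_
      (Eventually.of_forall hT), Eventually.of_forall fun x z hz => (hT x z hz).1⟩
    refine (hd.mul_bounded (g := fun _ z => z) (M := 1)
      (Eventually.of_forall fun x z hz => (hz1 z hz).le)).congr
      (Eventually.of_forall fun x z hz => ?_)
    have h1 := hA x z hz
    have h2 := hA (x.1 + p, x.2) z hz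
    simp only [popucVal, eval_popuc_succ]
    change _ = (z * opucVal a (x.1 + p, x.2) z - starRingEnd ℂ β * starVal a (x.1 + p, x.2) z) /
      starVal a (x.1 + p, x.2) z -
      (z * opucVal a x z - starRingEnd ℂ β * starVal a x z) / starVal a x z
    field_simp
    ring
  · obtain ⟨U, hU, M, hM⟩ := exists_inv_schurRatio_bounded hp hα hper ha hlim hz₀ hf
    have hB : ∀ᶠ x in ratioFilter t, ∀ z ∈ U ∩ K, opucVal a x z ≠ 0 ∧
        ‖starVal a x z / opucVal a x z‖ ≤ M := by
      filter_upwards [hM] with x hx z hz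
      have h1 := hx z hz.1
      rw [← opucVal_div_starVal ha (hz1 z hz.2).le, inv_div] at h1
      exact ⟨fun h => h1.1 (by rw [h, zero_div]), h1.2⟩
    exact ⟨U ∩ K, inter_mem hU hKn, VanishesOn.ratio_transfer (P := starVal a)
      (hA'.mono fun x hx z hz => hx z hz.2) (hR.mono Set.inter_subset_right)
      (hC.mono fun x hx z hz => hx z hz.2) (hd.mono Set.inter_subset_right) hB,
      hB.mono fun x hx z hz => (hx z hz).1⟩

/-- The roles are exchanged: `Φ_n` has no zeros here and serves as the reference family. -/
theorem near_exterior {z₀ β : ℂ} (hβ : ‖β‖ = 1) (hz₀ : 1 < ‖z₀‖) :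
    RatioConvergesNear t p (gDelta p α) (popucVal a β) z₀ ∧
    RatioConvergesNear t p (gDelta p α) (opucVal a) z₀ ∧
    ((∀ n, periodicSchur p (fun j => starRingEnd ℂ (α j)) z₀⁻¹ n ≠ 0) →
      RatioConvergesNear t p (gDelta p α) (starVal a) z₀) := by
  have hα' : ∀ n, ‖starRingEnd ℂ (α n)‖ < 1 := fun n => by simpa using hα n
  have ha' : ∀ n N, ‖conjCoeff a n N‖ < 1 := fun n N => by simpa [conjCoeff] using ha n N
  have hlim' := tendsto_conjCoeff hlim
  have hper' := periodic_conj hper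
  have hz₀0 : z₀ ≠ 0 := norm_pos_iff.1 (one_pos.trans hz₀)
  have hw₀ : ‖z₀⁻¹‖ < 1 := by
    rw [norm_inv]
    exact inv_lt_one_of_one_lt₀ hz₀
  obtain ⟨r, hr, hr1⟩ := exists_between hw₀
  have hr0 : 0 < r := (norm_nonneg _).trans_lt hr
  obtain ⟨s, hs1, hs⟩ := exists_between hz₀
  set K : Set ℂ := {z | s < ‖z‖ ∧ ‖z⁻¹‖ < r ∧ ‖z‖ < ‖z₀‖ + 1} with hK
  have hKn : K ∈ 𝓝 z₀ := by
    refine (continuousAt_id.norm.eventually (lt_mem_nhds hs)).and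
      (((continuousAt_inv₀ hz₀0).norm.eventually (gt_mem_nhds hr)).and
      (continuousAt_id.norm.eventually (gt_mem_nhds (lt_add_one _))))
  have hz1 : ∀ z ∈ K, 1 < ‖z‖ := fun z hz => hs1.trans hz.1
  have hB : ∀ x, ∀ z ∈ K, opucVal a x z ≠ 0 := fun x z hz =>
    (eval_opuc_ne_zero_and_le (fun n => ha n x.2) (hz1 z hz).le x.1).1
  have hB' : ∀ᶠ x in ratioFilter t, ∀ z ∈ K, opucVal a x z ≠ 0 := Eventually.of_forall hB
  have hR := vanishesOn_opucRatio hp hα hper ha hlim hr1 (K := K) (M := ‖z₀‖ + 1)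
    fun z hz => ⟨hz1 z hz, hz.2.1.le, hz.2.2.le⟩
  have hC := hR.bounded (M := (‖z₀‖ + 1) ^ p * 2 ^ p) fun z hz => by
    obtain ⟨-, -, -, -, h4⟩ := exists_eigenvalue hp hα hper
      (norm_pos_iff.1 (one_pos.trans (hz1 z hz))) (hz1 z hz).ne'
    rw [h4 (hz1 z hz), norm_mul, norm_pow]
    exact mul_le_mul (pow_le_pow_left₀ (norm_nonneg _) hz.2.2.le p)
      (norm_diskLimit_le hp hα' hper' (hz.2.1.trans hr1)) (norm_nonneg _) (by positivity)
  have hd : VanishesOn (ratioFilter t) (fun x z => starVal a (x.1 + p, x.2) z /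
      opucVal a (x.1 + p, x.2) z - starVal a x z / opucVal a x z) K :=
    ((vanishesOn_schurRatio_add_sub hp hα' hper' ha' hlim' hr1).comp_inv
      (K := K) fun z hz => hz.2.1.le).congr (Eventually.of_forall fun x z hz => by
        rw [starVal_div_opucVal ha (hz1 z hz).le, starVal_div_opucVal ha (hz1 z hz).le])
  refine ⟨?_, ⟨K, hKn, hR, hB'⟩, fun hf => ?_⟩
  · have hT : ∀ x, ∀ z ∈ K, popucVal a β x z ≠ 0 ∧
        ‖opucVal a x z / popucVal a β x z‖ ≤ (s - 1)⁻¹ := by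
      intro x z hz
      have h0 := hB x z hz
      have e : popucVal a β x z =
          (z - starRingEnd ℂ β * (starVal a x z / opucVal a x z)) * opucVal a x z := by
        rw [popucVal, eval_popuc_succ, sub_mul, mul_assoc (starRingEnd ℂ β), div_mul_cancel₀ _ h0]
        rfl
      have hle : s - 1 ≤ ‖z - starRingEnd ℂ β * (starVal a x z / opucVal a x z)‖ := by
        have h1 := norm_sub_norm_le z (starRingEnd ℂ β * (starVal a x z / opucVal a x z))
        have h2 : ‖starRingEnd ℂ β * (starVal a x z / opucVal a x z)‖ ≤ 1 := by
          rw [norm_mul, RCLike.norm_conj, hβ, one_mul, norm_div]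
          exact div_le_one_of_le₀
            (eval_opuc_ne_zero_and_le (fun n => ha n x.2) (hz1 z hz).le x.1).2 (norm_nonneg _)
        have := hz.1
        linarith
      have hpos : 0 < s - 1 := sub_pos.2 hs1
      refine ⟨?_, ?_⟩
      · rw [e]
        exact mul_ne_zero (norm_pos_iff.1 (hpos.trans_le hle)) h0
      · rw [e, norm_div, norm_mul, div_mul_cancel_right₀ (norm_ne_zero_iff.2 h0)]
        exact inv_anti₀ hpos hle
    refine ⟨K, hKn, VanishesOn.ratio_transfer (P := opucVal a) hB' hR hC ?_
      (Eventually.of_forall hT), Eventually.of_forall fun x z hz => (hT x z hz).1⟩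
    refine (hd.mul_bounded (g := fun _ _ => -starRingEnd ℂ β) (M := 1)
      (Eventually.of_forall fun x z hz => by rw [norm_neg, RCLike.norm_conj, hβ])).congr
      (Eventually.of_forall fun x z hz => ?_)
    have h1 := hB x z hz
    have h2 := hB (x.1 + p, x.2) z hz
    simp only [popucVal, eval_popuc_succ]
    change _ = (z * opucVal a (x.1 + p, x.2) z - starRingEnd ℂ β * starVal a (x.1 + p, x.2) z) /
      opucVal a (x.1 + p, x.2) z -
      (z * opucVal a x z - starRingEnd ℂ β * starVal a x z) / opucVal a x z
    field_simp
    ring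
  · obtain ⟨U, hU, M, hM⟩ := exists_inv_schurRatio_bounded hp hα' hper' ha' hlim' hw₀ hf
    have hUn : (fun z : ℂ => z⁻¹) ⁻¹' U ∈ 𝓝 z₀ := (continuousAt_inv₀ hz₀0).preimage_mem_nhds hU
    have hA : ∀ᶠ x in ratioFilter t, ∀ z ∈ (fun z : ℂ => z⁻¹) ⁻¹' U ∩ K, starVal a x z ≠ 0 ∧
        ‖opucVal a x z / starVal a x z‖ ≤ M := by
      filter_upwards [hM] with x hx z hz
      have h1 := hx z⁻¹ hz.1
      rw [← starVal_div_opucVal ha (hz1 z hz.2).le, inv_div] at h1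
      exact ⟨fun h => h1.1 (by rw [h, zero_div]), h1.2⟩
    exact ⟨_ ∩ K, inter_mem hUn hKn, VanishesOn.ratio_transfer (P := opucVal a)
      (hB'.mono fun x hx z hz => hx z hz.2) (hR.mono Set.inter_subset_right)
      (hC.mono fun x hx z hz => hx z hz.2) (hd.mono Set.inter_subset_right) hA,
      hA.mono fun x hx z hz => (hx z hz).1⟩

theorem near_circle [(ratioFilter t).NeBot] {ζ β : ℂ} (hβ : ‖β‖ = 1) (hζ : ‖ζ‖ = 1)
    (h : ζ ∉ limitZeros a t β) :
    RatioConvergesNear t p (gDelta p α) (popucVal a β) ζ ∧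
    RatioConvergesNear t p (gDelta p α) (opucVal a) ζ ∧
    RatioConvergesNear t p (gDelta p α) (starVal a) ζ := by
  obtain ⟨e, M, he, he1, hall⟩ := eventually_bounds_near_circle ha hβ hζ h
  set K := Metric.ball ζ (e / 4) with hK
  have hKn : K ∈ 𝓝 ζ := Metric.ball_mem_nhds ζ (by positivity)
  have hKe : K ⊆ Metric.ball ζ e := Metric.ball_subset_ball (by linarith)
  have hz2 : ∀ z ∈ K, ‖z‖ ≤ 2 := fun z hz => by
    rw [hK, Metric.mem_ball, dist_eq_norm] at hz
    have := norm_sub_norm_le z ζ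
    linarith
  have hb : ∀ᶠ x in ratioFilter t, ∀ z ∈ Metric.ball ζ e,
      starVal a x z ≠ 0 ∧ ‖opucVal a x z / starVal a x z‖ ≤ M :=
    hall.mono fun x hx z hz => ⟨(hx z hz).1, (hx z hz).2.2.2.1⟩
  have hbK := hb.mono fun x hx z (hz : z ∈ K) => hx z (hKe hz)
  have hA : ∀ᶠ x in ratioFilter t, ∀ z ∈ K, starVal a x z ≠ 0 :=
    hbK.mono fun x hx z hz => (hx z hz).1
  have hR := vanishesOn_starRatio_near_circle hp hα hper ha hlim hζ he he1 hb
  have hC := eventually_starRatio_le hz2 ha hbK p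
  have hd := (vanishesOn_ratio_sub_near_circle hp hα hper ha hlim hζ he he1 hb).mono
    Metric.ball_subset_closedBall
  have hβ0 : starRingEnd ℂ β ≠ 0 := by
    rw [← norm_pos_iff, RCLike.norm_conj, hβ]
    exact one_pos
  refine ⟨?_, ?_, ⟨K, hKn, hR, hA⟩⟩
  · have hT : ∀ᶠ x in ratioFilter t, ∀ z ∈ K, popucVal a β x z ≠ 0 ∧
        ‖starVal a x z / popucVal a β x z‖ ≤ M := by
      filter_upwards [hall] with x hx z hz
      obtain ⟨-, -, h3, -, -, h6⟩ := hx z (hKe hz)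
      rw [popucVal, eval_popuc_eq hβ]
      refine ⟨mul_ne_zero (neg_ne_zero.2 hβ0) h3, ?_⟩
      rwa [norm_div, norm_mul, norm_neg, RCLike.norm_conj, hβ, one_mul, ← norm_div]
    refine ⟨K, hKn, VanishesOn.ratio_transfer (P := starVal a) hA hR hC ?_ hT,
      hT.mono fun x hx z hz => (hx z hz).1⟩
    -- The quotient of the paraorthogonal polynomial by `Φ_n^*` is `z Φ_n / Φ_n^*` minus a constant,
    -- so its change over a period is `z` times that of `Φ_n / Φ_n^*`.
    refine (hd.mul_bounded (g := fun _ z => z) (M := 2) (Eventually.of_forall fun x => hz2)).congr ?_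
    filter_upwards [hA, (tendsto_ratioFilter_add t p).eventually hA] with x h1 h2 z hz
    have h1 := h1 z hz
    have h2 := h2 z hz
    simp only [popucVal, eval_popuc_succ]
    change _ = (z * opucVal a (x.1 + p, x.2) z - starRingEnd ℂ β * starVal a (x.1 + p, x.2) z) /
      starVal a (x.1 + p, x.2) z -
      (z * opucVal a x z - starRingEnd ℂ β * starVal a x z) / starVal a x z
    field_simp
    ring
  · have hB : ∀ᶠ x in ratioFilter t, ∀ z ∈ K, opucVal a x z ≠ 0 ∧
        ‖starVal a x z / opucVal a x z‖ ≤ M :=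
      hall.mono fun x hx z hz => ⟨(hx z (hKe hz)).2.1, (hx z (hKe hz)).2.2.2.2.1⟩
    exact ⟨K, hKn, VanishesOn.ratio_transfer (P := starVal a) hA hR hC hd hB,
      hB.mono fun x hx z hz => (hx z hz).1⟩

end Near

end Assembly

end VaryingOPUC

end

/-! ### The main theorem -/

theorem corollary3p7 (p : ℕ) (hp : 0 < p) (t : ℝ) (ht : 0 < t) (β : ℂ) (hβ : ‖β‖ = 1)
    (a : ℕ → ℕ → ℂ) (ha : ∀ n N, ‖a n N‖ < 1)
    (α : ℕ → ℂ) (hα : ∀ n, ‖α n‖ < 1) (hper : Function.Periodic α p) (hne : ∃ j < p, α j ≠ 0)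
    (hlim : VaryingOPUC.AsymptoticallyPeriodic a t p α) :
    VaryingOPUC.QuotientsConverge t
      (fun n N => VaryingOPUC.popuc (fun m => a m N) β (n + p))
      (fun n N => VaryingOPUC.popuc (fun m => a m N) β n)
      (VaryingOPUC.gDelta p α) (VaryingOPUC.limitZeros a t β)ᶜ ∧
    VaryingOPUC.QuotientsConverge t
      (fun n N => VaryingOPUC.opuc (fun m => a m N) (n + p))
      (fun n N => VaryingOPUC.opuc (fun m => a m N) n)
      (VaryingOPUC.gDelta p α)
      (VaryingOPUC.limitZerosInter a t ∪ VaryingOPUC.zeroSet p α hα)ᶜ ∧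
    VaryingOPUC.QuotientsConverge t
      (fun n N => VaryingOPUC.opucStar (fun m => a m N) (n + p))
      (fun n N => VaryingOPUC.opucStar (fun m => a m N) n)
      (VaryingOPUC.gDelta p α)
      (VaryingOPUC.limitZerosInter a t ∪ VaryingOPUC.poleSet p α hα)ᶜ := by
  have hc := hlim.tendsto_sub hp hper
  refine ⟨VaryingOPUC.quotientsConverge_of_near
      (T := fun n N => VaryingOPUC.popuc (fun m => a m N) β n) fun _ z hz => ?_,
    VaryingOPUC.quotientsConverge_of_near
      (T := fun n N => VaryingOPUC.opuc (fun m => a m N) n) fun _ z hz => ?_,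
    VaryingOPUC.quotientsConverge_of_near
      (T := fun n N => VaryingOPUC.opucStar (fun m => a m N) n) fun _ z hz => ?_⟩
  · refine VaryingOPUC.RatioConvergesNear.popuc_of_popucVal ?_
    rcases lt_trichotomy ‖z‖ 1 with h | h | h
    · exact (VaryingOPUC.near_disk hp hα hper ha hc hβ h).1
    · exact (VaryingOPUC.near_circle hp hα hper ha hc hβ h hz).1
    · exact (VaryingOPUC.near_exterior hp hα hper ha hc hβ h).1
  · rw [Set.mem_compl_iff, Set.mem_union, not_or] at hz
    rcases lt_trichotomy ‖z‖ 1 with h | h | h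
    · exact (VaryingOPUC.near_disk hp hα hper ha hc hβ h).2.1
        (VaryingOPUC.periodicSchur_ne_zero_of_notMem_zeroSet hp hα hper h hz.2)
    -- `Φ_n` does not involve `β`, so the argument on the circle may use any parameter whose limit
    -- set misses `z`; this is why only the intersection is excluded.
    · obtain ⟨β', hβ', hz'⟩ : ∃ β', ‖β'‖ = 1 ∧ z ∉ VaryingOPUC.limitZeros a t β' := by
        by_contra! hcon
        exact hz.1 hcon
      exact (VaryingOPUC.near_circle hp hα hper ha hc hβ' h hz').2.1
    · exact (VaryingOPUC.near_exterior hp hα hper ha hc hβ h).2.1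
  · rw [Set.mem_compl_iff, Set.mem_union, not_or] at hz
    rcases lt_trichotomy ‖z‖ 1 with h | h | h
    · exact (VaryingOPUC.near_disk hp hα hper ha hc hβ h).2.2
    · obtain ⟨β', hβ', hz'⟩ : ∃ β', ‖β'‖ = 1 ∧ z ∉ VaryingOPUC.limitZeros a t β' := by
        by_contra! hcon
        exact hz.1 hcon
      exact (VaryingOPUC.near_circle hp hα hper ha hc hβ' h hz').2.2
    · exact (VaryingOPUC.near_exterior hp hα hper ha hc hβ h).2.2
        (VaryingOPUC.periodicSchur_ne_zero_of_notMem_poleSet hp hα hper h hz.2)
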